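/- **Setting.** Let $\varepsilon>0$ and let $f=f(w,v)\in C^3(\mathbb R^2)$ have bounded derivatives of all orders $\le 3$. Let $\bar w,\bar v:\mathbb R\to\varepsilon\mathbb Z$ be right continuous, piecewise constant with finitely many jumps, compactly supported, with values in a rectangular neighbourhood of $(0,0)$ on which $\partial_w f>-1$. Write $g_\varepsilon$ for the piecewise affine interpolation of $g$ at the points of $\varepsilon\mathbb Z$. Let $(w,v)$ be the wavefront solution of $w_t+\partial_wf(w,v)\,w_x=0$, $v_t-v_x=0$ with data $(\bar w,\bar v)$: $v(t,x)=\bar v(x+t)$, and at each point the jump $(w^-,w^+)$ of $w$ is resolved by the scalar Riemann solver with flux $f_\varepsilon(\cdot,v(t,x))$. The discontinuity lines of $v$ (resp. $w$) are the wavefronts of the first (resp. second) family. Let $0=t_0<t_1<t_2<\dots$ be the collision times, and assume that at each $t_j$, $j\ge1$, exactly two wavefronts meet, at the point $x_j$. The point $(t_j,x_j)$ is an *interaction point* if both are of the second family and have the same sign, a *cancellation point* if both are of the second family and have opposite signs, and a *transversal interaction point* if they are of different families; in the last case $|v_{h(j)}|$ is the absolute value of the jump of $v$ at $(t_j,x_j)$.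 **Waves.** Let $W(x)=\mathrm{Tot.Var.}(\bar w;(-\infty,x])$, $\mathcal W=\{1,\dots,\mathrm{Tot.Var.}(\bar w)/\varepsilon\}$, $\mathtt x(0,s)=\inf\{x:\varepsilon s\le W(x)\}$, $\mathcal S(s)=\mathrm{sign}[\bar w(\mathtt x(0,s))-\bar w(\mathtt x(0,s)-)]$, $\hat w(s)=\bar w(\mathtt x(0,s)-)+\mathcal S(s)[\varepsilon s-W(\mathtt x(0,s)-)]$, and let $|s|=\varepsilon$ be the strength of the wave $s$; the strength of a set of waves is $|K|=\varepsilon\,\mathrm{card}\,K$. The wave $s$ occupies the segment $(\hat w(s)-\varepsilon,\hat w(s)]$ if $\mathcal S(s)=1$, and $[\hat w(s),\hat w(s)+\varepsilon)$ if $\mathcal S(s)=-1$. For an interval $K$ of waves of the same sign and $s\in K$, let $I$ be the union of the segments of the waves of $K$; $\sigma^{\rm ent}(g,K,s)$ is the derivative on the interior of the segment of $s$ of the convex envelope of $g_\varepsilon$ on $\overline I$ if the waves are positive, of the concave envelope if they are negative. The Riemann problem $K$ with flux $g$ *divides* $s,s'\in K$ if $\sigma^{\rm ent}(g,K,s)\ne\sigma^{\rm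 ent}(g,K,s')$. The position $\mathtt x(t,s)$ moves with the speed $\sigma(t_j,s)=\sigma^{\rm ent}\big(f(\cdot,v(t_j,\mathtt x(t_j,s))),\{p:\mathtt x(t_j,p)=\mathtt x(t_j,s)\},s\big)$ for $t_j\le t\le t_{j+1}$. The waves reaching $(t_{j+1},x_{j+1})$ which do not satisfy $\mathcal S(s)w(t_{j+1},x_{j+1}-)\le\mathcal S(s)\hat w(s)-\varepsilon$ and $\mathcal S(s)\hat w(s)\le\mathcal S(s)w(t_{j+1},x_{j+1})$ are canceled, and their position is $+\infty$ from then on. Let $\mathcal W(t)$ be the set of waves with finite position at time $t$, and $\mathcal W(t,x)$ the set of those with position $x$. **Pairs of waves.** Let $s<s'$ be in $\mathcal W(t_j)$. They have *already interacted* if $\mathtt x(t,s)=\mathtt x(t,s')$ for some $t\in[0,t_j]$. They are *joined* at $t_j$ if they have the same position and the same speed $\sigma$ at time $t_j$; if they have already interacted and are not joined they are *divided*. For a divided pair, let $\mathtt T$ be the last time $t\le t_j$ at which they have the same position, and let $\mathcal I(t_j,s,s')$ be the set of waves of $\mathcal W(t_j)$ which have that same position at time $\mathtt T$. On each maximal interval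 of waves of $\mathcal W(t_j)$ with the same sign let $\mathtt f^{\rm eff}_{t_j}$ be a $C^{1,1}$ function (unique up to affine functions) with second derivative $\partial^2_{ww}f(w,v(t_j,\mathtt x(t_j,p)))$ at a.e. $w$ in the segment of the wave $p$. The partition $\mathcal P(t_j,s,s')$ of $\mathcal I(t_j,s,s')$ is defined recursively: if $t_j=\mathtt T$, then $p,p'$ are equivalent iff they are joined at $t_j$; if $t_j>\mathtt T$, then $p,p'$ are equivalent iff they belong to the same $\mathcal J\in\mathcal P(t_{j-1},s,s')$ and the Riemann problem $\mathcal J\cap\mathcal W(t_j)$ with flux $\mathtt f^{\rm eff}_{t_j}$ does not divide them. Let $\pi(t_j,s,s')[p,p']$, for $p<p'$ in $\mathcal I(t_j,s,s')$, be $0$ if $j=0$ or $s,s'$ are joined at $t_{j-1}$; otherwise let it be $\pi(t_{j-1},s,s')[p,p']$ if $(t_j,x_j)$ is an interaction or cancellation point, and $\pi(t_{j-1},s,s')[p,p']+2\|\partial^3_{wwv}f\|_{L^\infty}|v_{h(j)}|M$ if it is a transversal interaction point. Here $M$ is the total strength of the $\mathcal J\in\mathcal P(t_{j-1},s,s')$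 with $\mathcal J_p\le\mathcal J\le\mathcal J_{p'}$ and $\mathcal J\subseteq\mathcal W(t_j,x_j)$, where $\mathcal J_p,\mathcal J_{p'}\in\mathcal P(t_{j-1},s,s')$ are the elements containing $p,p'$. **The functional.** Let $$\mathfrak Q(t_j)=\sum_{\substack{s,s'\in\mathcal W(t_j)\\ s<s'}}\mathfrak q(t_j,s,s')\,|s||s'|,$$ where $\mathfrak q(t_j,s,s')$ is $0$ if $s,s'$ are joined at $t_j$, is $\dfrac{\pi(t_j,s,s')[s,s']}{|\hat w(s')-(\hat w(s)-\mathcal S(s)\varepsilon)|}$ if they are divided at $t_j$, and is $\|\partial^2_{ww}f\|_{L^\infty}$ if they have not yet interacted at $t_j$. **Statement.** For every interaction point $(t_j,x_j)$, $$\sum_{s\in\mathcal W(t_j)}|\sigma(t_j,s)-\sigma(t_{j-1},s)|\,|s|\le 2\big[\mathfrak Q(t_{j-1})-\mathfrak Q(t_j)\big].$$ -/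

import Mathlib

noncomputable section

open scoped Classical

/-! ### Convex envelopes, interpolation and the approximate Riemann solver -/

/-- The convex envelope of `g` in the interval `[a, b]`: the supremum of the functions that are
convex on `[a, b]` and lie below `g` there. -/
def convEnv (a b : ℝ) (g : ℝ → ℝ) (u : ℝ) : ℝ :=
  sSup {y : ℝ | ∃ h : ℝ → ℝ, ConvexOn ℝ (Set.Icc a b) h ∧
    (∀ z ∈ Set.Icc a b, h z ≤ g z) ∧ y = h u}

/-- The concave envelope of `g` in the interval `[a, b]`. -/
def concEnv (a b : ℝ) (g : ℝ → ℝ) (u : ℝ) : ℝ :=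
  -convEnv a b (fun z => -g z) u

/-- The piecewise affine interpolation of `g` with grid size `ε`: it coincides with `g` at the
points `m ε`, `m ∈ ℤ`, and is affine in between. -/
def interp (ε : ℝ) (g : ℝ → ℝ) (u : ℝ) : ℝ :=
  g (⌊u / ε⌋ * ε) + (u / ε - ⌊u / ε⌋) * (g ((⌊u / ε⌋ + 1) * ε) - g (⌊u / ε⌋ * ε))

/-- The speed that the scalar Riemann problem with left state `a`, right state `b` (both in `ε ℤ`)
and flux `g_ε` assigns to the elementary jump over the grid cell `(c, c + ε)`, `c ∈ ε ℤ`: the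
derivative on that cell of the convex envelope of `g_ε` in `[a, b]` if `a ≤ b`, and of the concave
envelope of `g_ε` in `[b, a]` if `b < a`. The envelope of a function which is affine on the grid
cells is affine on the grid cells too, so this derivative is constant on the cell and equal to the
difference quotient below. -/
def riemannSpeed (ε : ℝ) (g : ℝ → ℝ) (a b c : ℝ) : ℝ :=
  if a ≤ b then
    (convEnv a b (interp ε g) (c + ε) - convEnv a b (interp ε g) c) / ε
  else
    (concEnv b a (interp ε g) (c + ε) - concEnv b a (interp ε g) c) / ε

/-- `[m ε, (m + 1) ε]` is one of the grid cells between the states `a` and `b`. -/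
def IsCellBetween (ε a b : ℝ) (m : ℤ) : Prop :=
  min a b ≤ m * ε ∧ (m + 1) * ε ≤ max a b

/-- The right continuous self-similar solution `ξ = x / t ↦ w` of the scalar Riemann problem
with left state `a`, right state `b` and flux `g_ε`: starting from `a`, all the elementary jumps
with speed at most `ξ` have been crossed. -/
def riemannFan (ε : ℝ) (g : ℝ → ℝ) (a b ξ : ℝ) : ℝ :=
  a + Real.sign (b - a) * ε *
    ({m : ℤ | IsCellBetween ε a b m ∧ riemannSpeed ε g a b (m * ε) ≤ ξ}.ncard : ℝ)

/-- `u` is piecewise constant with finitely many jumps, and right continuous. -/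
def IsStepFunction (u : ℝ → ℝ) : Prop :=
  ∃ F : Finset ℝ, ∀ x y : ℝ, x < y → (∀ z ∈ F, z ∉ Set.Ioc x y) → u x = u y

/-- The two families of wavefronts: the jumps of `v` (first) and the jumps of `w` (second). -/
inductive Family
  | first
  | second

/-- A wavefront leaving the point `start` with the given speed. -/
structure Front where
  family : Family
  start : ℝ
  speed : ℝ

/-- The flux `f(w, v)`, the grid size `ε` and the discretized initial data. -/
structure WavefrontData where
  f : ℝ → ℝ → ℝ
  ε : ℝ
  w₀ : ℝ → ℝ
  v₀ : ℝ → ℝ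

namespace WavefrontData

variable (D : WavefrontData)

/-! ### The wavefront solution -/

/-- The first family: `v_t - v_x = 0`. -/
def v (t x : ℝ) : ℝ := D.v₀ (x + t)

/-- The wavefronts that leave the time `t` when the second family has the profile `u` there: the
jumps of `v(t, ·)`, which have speed `-1`, and those of the solutions of the Riemann problems
`(u(y-), u(y))` with flux `f_ε(·, v(t, y))`, one for each speed. -/
def fronts (t : ℝ) (u : ℝ → ℝ) : Set Front :=
  {φ | match φ.family with
    | .first => Function.leftLim (D.v t) φ.start ≠ D.v t φ.start ∧ φ.speed = -1
    | .second => ∃ m : ℤ, IsCellBetween D.ε (Function.leftLim u φ.start) (u φ.start) m ∧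
        φ.speed = riemannSpeed D.ε (fun z => D.f z (D.v t φ.start))
          (Function.leftLim u φ.start) (u φ.start) (m * D.ε)}

/-- Two different wavefronts leaving the time `t` meet after the time `τ` at the point `x`. -/
def Meet (t : ℝ) (u : ℝ → ℝ) (φ ψ : Front) (τ x : ℝ) : Prop :=
  φ ∈ D.fronts t u ∧ ψ ∈ D.fronts t u ∧ φ ≠ ψ ∧
    φ.start + φ.speed * τ = x ∧ ψ.start + ψ.speed * τ = x

/-- The delays `τ > 0` after which two of the wavefronts leaving the time `t` would meet. -/
def collisionDelays (t : ℝ) (u : ℝ → ℝ) : Set ℝ :=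
  {τ | 0 < τ ∧ ∃ φ ψ x, D.Meet t u φ ψ τ x}

/-- The profile at time `t + τ`, up to the next collision: the (compactly supported) profile `u`
at time `t` with each of its jumps replaced by the solution of the Riemann problem there. -/
def evolve (t : ℝ) (u : ℝ → ℝ) (τ : ℝ) (x : ℝ) : ℝ :=
  ∑ᶠ (y : ℝ) (_ : Function.leftLim u y ≠ u y),
    (riemannFan D.ε (fun z => D.f z (D.v t y)) (Function.leftLim u y) (u y) ((x - y) / τ)
      - Function.leftLim u y)

/-- The collision time `t_j` (with `t_0 = 0`) and the profile `w(t_j, ·)`. When there are no more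
collisions the sequence is continued as a constant one. -/
def state : ℕ → ℝ × (ℝ → ℝ)
  | 0 => (0, D.w₀)
  | j + 1 =>
    if (D.collisionDelays (state j).1 (state j).2).Nonempty then
      ((state j).1 + sInf (D.collisionDelays (state j).1 (state j).2),
        D.evolve (state j).1 (state j).2 (sInf (D.collisionDelays (state j).1 (state j).2)))
    else state j

/-- The collision times `t_j`. -/
def time (j : ℕ) : ℝ := (D.state j).1

/-- The profile `w(t_j, ·)`. -/
def profile (j : ℕ) : ℝ → ℝ := (D.state j).2

/-- There is a `j`-th collision, or `j = 0`. -/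
def Reached : ℕ → Prop
  | 0 => True
  | j + 1 => (D.collisionDelays (D.time j) (D.profile j)).Nonempty

/-- The wavefronts `φ ≠ ψ` collide at the point `x` at the time `t_j`, `j ≥ 1`. -/
def CollideAt : ℕ → Front → Front → ℝ → Prop
  | 0, _, _, _ => False
  | j + 1, φ, ψ, x => D.Reached (j + 1) ∧
      D.Meet (D.time j) (D.profile j) φ ψ (D.time (j + 1) - D.time j) x

/-- The position `x_j` of the collision at time `t_j`. -/
def collisionPoint (j : ℕ) : ℝ := sInf {x | ∃ φ ψ, D.CollideAt j φ ψ x}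

/-- The jump `w(t_j, y) - w(t_j, y-)`, whose sign is the sign of the wavefronts of the second
family leaving `(t_j, y)`. -/
def jump (j : ℕ) (y : ℝ) : ℝ := D.profile j y - Function.leftLim (D.profile j) y

/-- `(t_j, x_j)`, `j ≥ 1`, is an interaction point: the two wavefronts that collide there are
of the second family and have the same sign. -/
def IsInteraction : ℕ → Prop
  | 0 => False
  | j + 1 => ∃ φ ψ x, D.CollideAt (j + 1) φ ψ x ∧ φ.family = .second ∧ ψ.family = .second ∧
      0 < D.jump j φ.start * D.jump j ψ.start

/-- `(t_j, x_j)`, `j ≥ 1`, is a transversal interaction point: the two wavefronts that collide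
there are of different families. -/
def IsTransversal (j : ℕ) : Prop :=
  ∃ φ ψ x, D.CollideAt j φ ψ x ∧ φ.family = .first ∧ ψ.family = .second

/-- Standing assumptions on the flux, on the grid size, on the discretized initial data, and on
the wavefront solution. -/
structure Admissible : Prop where
  ε_pos : 0 < D.ε
  smooth : ContDiff ℝ 3 (fun p : ℝ × ℝ => D.f p.1 p.2)
  bounded : ∀ k : ℕ, k ≤ 3 → ∃ C : ℝ, ∀ p : ℝ × ℝ,
    ‖iteratedFDeriv ℝ k (fun p : ℝ × ℝ => D.f p.1 p.2) p‖ ≤ C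
  w_step : IsStepFunction D.w₀
  w_support : HasCompactSupport D.w₀
  w_grid : ∀ x, ∃ m : ℤ, D.w₀ x = m * D.ε
  v_step : IsStepFunction D.v₀
  v_support : HasCompactSupport D.v₀
  v_grid : ∀ x, ∃ m : ℤ, D.v₀ x = m * D.ε
  /-- `∂f/∂w > -1` in a (rectangular) neighbourhood of the origin that contains the data. -/
  hyperbolic : ∃ U ∈ nhds (0 : ℝ), ∃ V ∈ nhds (0 : ℝ), U.OrdConnected ∧ V.OrdConnected ∧
    (∀ x, D.w₀ x ∈ U) ∧ (∀ x, D.v₀ x ∈ V) ∧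
    ∀ w ∈ U, ∀ y ∈ V, -1 < deriv (fun z => D.f z y) w
  /-- At each collision time exactly two wavefronts collide. -/
  binary : ∀ (j : ℕ) (φ ψ φ' ψ' : Front) (x x' : ℝ),
    D.CollideAt j φ ψ x → D.CollideAt j φ' ψ' x' → ({φ, ψ} : Set Front) = {φ', ψ'}

/-! ### Waves -/

/-- The total variation function `x ↦ Tot.Var.(w₀; (-∞, x])`. -/
def totVar (x : ℝ) : ℝ := (eVariationOn D.w₀ (Set.Iic x)).toReal

/-- The set of waves `𝒲 = {1, …, Tot.Var.(w₀) / ε}`. -/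
def waves : Finset ℕ := Finset.Icc 1 ⌊(eVariationOn D.w₀ Set.univ).toReal / D.ε⌋₊

/-- The position of the wave `s` at time `0`. -/
def initialPos (s : ℕ) : ℝ := sInf {x : ℝ | D.ε * s ≤ D.totVar x}

/-- The sign `𝒮(s) ∈ {-1, 1}` of the wave `s`. -/
def sgn (s : ℕ) : ℝ :=
  Real.sign (D.w₀ (D.initialPos s) - Function.leftLim D.w₀ (D.initialPos s))

/-- The right state `ŵ(s)` of the wave `s`. -/
def hatw (s : ℕ) : ℝ :=
  Function.leftLim D.w₀ (D.initialPos s) +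
    D.sgn s * (D.ε * s - Function.leftLim D.totVar (D.initialPos s))

/-- The segment of states occupied by the wave `s`. -/
def segment (s : ℕ) : Set ℝ :=
  if 0 < D.sgn s then Set.Ioc (D.hatw s - D.ε) (D.hatw s)
  else Set.Ico (D.hatw s) (D.hatw s + D.ε)

/-- The entropic speed `σ^ent(g, K, s)` given to the wave `s ∈ K` by the Riemann problem `K` (a
homogeneous interval of waves) with flux function `g`. -/
def entropicSpeed (g : ℝ → ℝ) (K : Finset ℕ) (s : ℕ) : ℝ :=
  if 0 < D.sgn s then
    riemannSpeed D.ε g (sInf (⋃ p ∈ K, D.segment p)) (sSup (⋃ p ∈ K, D.segment p))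
      (D.hatw s - D.ε)
  else
    riemannSpeed D.ε g (sSup (⋃ p ∈ K, D.segment p)) (sInf (⋃ p ∈ K, D.segment p))
      (D.hatw s)

/-- The speed of the wave `s` at time `t` if the positions of the waves are given by `pos`
(meaningful only if `pos s` is finite): the speed given to it by the Riemann problem at its
position, with flux `f(·, v(t, pos s))`. -/
def speedFrom (t : ℝ) (pos : ℕ → WithTop ℝ) (s : ℕ) : ℝ :=
  D.entropicSpeed (fun z => D.f z (D.v t ((pos s).untopD 0)))
    (D.waves.filter fun p => pos p = pos s) s

/-- The wave `s` arriving at `(t_j, x_j)` survives the possible cancellation there. -/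
def Survives (j : ℕ) (s : ℕ) : Prop :=
  D.sgn s * Function.leftLim (D.profile j) (D.collisionPoint j) ≤ D.sgn s * D.hatw s - D.ε ∧
    D.sgn s * D.hatw s ≤ D.sgn s * D.profile j (D.collisionPoint j)

/-- The position `x(t_j, s)` of the wave `s` at time `t_j`; it is `⊤` if `s` has been canceled. -/
def wavePos : ℕ → ℕ → WithTop ℝ
  | 0 => fun s => if s ∈ D.waves then (D.initialPos s : WithTop ℝ) else ⊤
  | j + 1 => fun s =>
    let arrival : ℝ := (wavePos j s).untopD 0 +
      D.speedFrom (D.time j) (wavePos j) s * (D.time (j + 1) - D.time j)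
    if wavePos j s = ⊤ then ⊤
    else if arrival ≠ D.collisionPoint (j + 1) ∨ D.Survives (j + 1) s then
      (arrival : WithTop ℝ)
    else ⊤

/-- The speed `σ(t_j, s)` of the wave `s` at time `t_j` (meaningful only for `s ∈ 𝒲(t_j)`). -/
def waveSpeed (j : ℕ) (s : ℕ) : ℝ := D.speedFrom (D.time j) (D.wavePos j) s

/-- The set `𝒲(t_j)` of the real waves at time `t_j`. -/
def realWaves (j : ℕ) : Finset ℕ := D.waves.filter fun s => D.wavePos j s ≠ ⊤

/-- The set `𝒲(t_j, x)`. -/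
def wavesAt (j : ℕ) (x : WithTop ℝ) : Finset ℕ := D.waves.filter fun s => D.wavePos j s = x

/-- The index `j` with `t ∈ [t_j, t_{j+1})`. -/
def stage (t : ℝ) : ℕ := sSup {j : ℕ | D.Reached j ∧ D.time j ≤ t}

/-- The position `x(t, s)` of the wave `s` at any time `t ≥ 0`. -/
def posAt (t : ℝ) (s : ℕ) : WithTop ℝ :=
  (D.wavePos (D.stage t) s).map
    fun y => y + D.waveSpeed (D.stage t) s * (t - D.time (D.stage t))

/-! ### The effective flux -/

/-- `∂²f/∂w²`. -/
def fww (w y : ℝ) : ℝ := iteratedDeriv 2 (fun z => D.f z y) w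

/-- `∂³f/∂w²∂v`. -/
def fwwv (w y : ℝ) : ℝ := deriv (fun z => D.fww w z) y

/-- The norm `‖D²_{ww} f‖_{L^∞}` (the function is continuous and bounded). -/
def normww : ℝ := ⨆ p : ℝ × ℝ, |D.fww p.1 p.2|

/-- The norm `‖D³_{wwv} f‖_{L^∞}` (the function is continuous and bounded). -/
def normwwv : ℝ := ⨆ p : ℝ × ℝ, |D.fwwv p.1 p.2|

/-- The maximal homogeneous interval of waves at time `t_j` that contains `s`. -/
def maxHomogeneous (j s : ℕ) : Finset ℕ :=
  (D.realWaves j).filter fun p => ∀ q ∈ D.realWaves j, q ∈ Set.uIcc p s → D.sgn q = D.sgn s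

/-- The second derivative of the effective flux: at the states `z` in the segment of a wave `p`
it is `∂²f/∂w²(z, v(t_j, x(t_j, p)))`. -/
def effCurvature (j s : ℕ) (z : ℝ) : ℝ :=
  ∑ p ∈ D.maxHomogeneous j s,
    (D.segment p).indicator (fun y => D.fww y (D.v (D.time j) ((D.wavePos j p).untopD 0))) z

/-- The effective flux function at time `t_j` on the maximal homogeneous interval of waves that
contains `s`. It is determined by its second derivative up to affine functions, which play no
role in what follows; this is the choice that vanishes at `0` together with its derivative. -/
def effFlux (j s : ℕ) (w : ℝ) : ℝ := ∫ z in (0 : ℝ)..w, (w - z) * D.effCurvature j s z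

/-! ### Pairs of waves, the intervals and the partitions -/

/-- The waves `s`, `s'` have already interacted at time `t_j`. -/
def Interacted (j s s' : ℕ) : Prop :=
  ∃ t : ℝ, 0 ≤ t ∧ t ≤ D.time j ∧ D.posAt t s = D.posAt t s'

/-- The waves `s`, `s'` are joined in the real solution at time `t_j`; otherwise they are
divided (if they have already interacted). -/
def Joined (j s s' : ℕ) : Prop :=
  D.wavePos j s = D.wavePos j s' ∧ D.waveSpeed j s = D.waveSpeed j s'

/-- The time of last interaction `T(t_j, s, s')`. -/
def lastTime (j s s' : ℕ) : ℝ :=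
  sSup {t : ℝ | 0 ≤ t ∧ t ≤ D.time j ∧ D.posAt t s = D.posAt t s'}

/-- The interval of waves `I(t_j, s, s')`: the waves that are still real at time `t_j` and were
at the same place as `s`, `s'` at the time of their last interaction. -/
def commonInterval (j s s' : ℕ) : Finset ℕ :=
  (D.realWaves j).filter fun p =>
    D.posAt (D.lastTime j s s') p = D.posAt (D.lastTime j s s') s

/-- The equivalence relation on `I(t_j, s, s')` that defines the partition `P(t_j, s, s')`. The
time `t_j` is that of the last interaction exactly when `s`, `s'` have the same position at
time `t_j`. -/
def SamePart : ℕ → ℕ → ℕ → ℕ → ℕ → Prop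
  | 0, s, s', p, p' =>
    p ∈ D.commonInterval 0 s s' ∧ p' ∈ D.commonInterval 0 s s' ∧ D.Joined 0 p p'
  | j + 1, s, s', p, p' =>
    p ∈ D.commonInterval (j + 1) s s' ∧ p' ∈ D.commonInterval (j + 1) s s' ∧
    if D.wavePos (j + 1) s = D.wavePos (j + 1) s' then D.Joined (j + 1) p p'
    else
      SamePart j s s' p p' ∧
      D.entropicSpeed (D.effFlux (j + 1) p)
          ((D.realWaves (j + 1)).filter fun r => SamePart j s s' p r) p =
        D.entropicSpeed (D.effFlux (j + 1) p)
          ((D.realWaves (j + 1)).filter fun r => SamePart j s s' p r) p'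

/-- The element of the partition `P(t_j, s, s')` that contains `p`. -/
def part (j s s' p : ℕ) : Finset ℕ :=
  (D.commonInterval j s s').filter fun r => D.SamePart j s s' p r

/-- The partition `P(t_j, s, s')` of `I(t_j, s, s')`. -/
def partition (j s s' : ℕ) : Finset (Finset ℕ) :=
  (D.commonInterval j s s').image fun p => D.part j s s' p

end WavefrontData

/-- The relation `K₁ ≤ K₂` between intervals of waves: they are equal or each wave in the first
one precedes each wave in the second one. -/
def IntervalLE (K₁ K₂ : Finset ℕ) : Prop :=
  (∀ p ∈ K₁, ∀ q ∈ K₂, p < q) ∨ K₁ = K₂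

namespace WavefrontData

variable (D : WavefrontData)

/-! ### The functional -/

/-- The strength `|K|` of a set of waves. -/
def strength (K : Finset ℕ) : ℝ := D.ε * K.card

/-- The quantity `M(t_{j+1}, s, s')[p, p']`: the total strength of the elements of `P(t_j, s, s')`
that lie between the element of `p` and that of `p'` (included) and are contained in the set of
waves `𝒲(t_{j+1}, x_{j+1})`. -/
def transversalLength (j s s' p p' : ℕ) : ℝ :=
  ∑ K ∈ (D.partition j s s').filter (fun K =>
      IntervalLE (D.part j s s' p) K ∧ IntervalLE K (D.part j s s' p') ∧
      K ⊆ D.wavesAt (j + 1) (D.collisionPoint (j + 1) : WithTop ℝ)),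
    D.strength K

/-- The strength of the wavefront of the first family involved in a transversal interaction at
`(t_j, x_j)`: the jump of `v` there. -/
def firstStrength (j : ℕ) : ℝ :=
  |D.v (D.time j) (D.collisionPoint j) -
    Function.leftLim (D.v (D.time j)) (D.collisionPoint j)|

/-- The map `π(t_j, s, s')[p, p']`: it vanishes at the time when `s`, `s'` are divided, and
increases only at the later transversal interactions. -/
def pairGap : ℕ → ℕ → ℕ → ℕ → ℕ → ℝ
  | 0, _, _, _, _ => 0
  | j + 1, s, s', p, p' =>
    if D.Joined j s s' then 0
    else if D.IsTransversal (j + 1) then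
      pairGap j s s' p p' +
        2 * D.normwwv * D.firstStrength (j + 1) * D.transversalLength j s s' p p'
    else pairGap j s s' p p'

/-- The weight `q(t_j, s, s')` of the pair of waves `s < s'`. -/
def weight (j s s' : ℕ) : ℝ :=
  if D.Joined j s s' then 0
  else if D.Interacted j s s' then
    D.pairGap j s s' s s' / |D.hatw s' - (D.hatw s - D.sgn s * D.ε)|
  else D.normww

/-- The functional `Q(t_j)`. -/
def functionalQ (j : ℕ) : ℝ :=
  ∑ s ∈ D.realWaves j, ∑ s' ∈ D.realWaves j with s < s', D.weight j s s' * D.ε * D.ε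

end WavefrontData

end

/-! At an interaction point two wavefronts `L` and `R` of the same sign merge, and `v` has one value
along both. Let l and r be the numbers of their waves, and d the slopes of the interpolated flux on
the segments of the waves. A wavefront is an interval of waves on which the envelope is affine (a
shock), so it moves with the average of d over its waves. Since `L` catches up with `R`, its average
A exceeds the average B of `R`; decreasing speeds make `L ∪ R` a shock, so afterwards all its waves
move with the average C over `L ∪ R`. No other wave changes speed. With (l + r) C = l A + r B this
gives (l + r) Σ |Δσ| ε = 2 ε l r (A - B): `Interaction.sum_speed_change`.

The functional falls by at least ε² times the sum of the weights over `L ×ˢ R`, because these pairs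
become joined and no other weight grows (`Interaction.sum_weight_le`). So it suffices to bound l r
(A - B), the sum of d(s) - d(s') over these pairs, by ε (l + r) times the sum of their weights
(`Interaction.card_mul_average_sub_le`). Here ε (l + r) bounds the denominator of every weight
involved. If s, s' have not interacted, d(s) - d(s') is at most ‖f_ww‖ times the length spanned by
their segments. If they are divided, a single difference is not controlled, but averages are: the
divided pairs split into rectangles J × J', with J and J' the elements of the partition containing s
and s'. The partition is the same for all pairs of a rectangle, and on the rectangle d(s) - d(s')
may be replaced by the difference of the averages over J and J' (`Interaction.sum_meanDiff`), which
is at most π[s, s'] (`Interaction.meanDiff_le`).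

This last bound is part of `PartInvariant`, proved by induction on the collisions after the last
meeting of the pair, together with the facts that the elements of the partition are intervals, are
shocks for the effective flux and stay inside one wavefront. At the last meeting the elements are
the wavefronts leaving the point, whose speeds are ordered (`partInvariant_self`). At a later
collision (`PartInvariant.succ`) the new speed of p is at most the new average over those waves of
its old element that are at least as fast as p; they form a final piece of an old shock, whose old
average is at most the old speed. The mirror argument holds for the slow waves around q. Hence the
difference of the speeds grows no more than the differences of slopes do, and these change only
where `v` changes: `effFlux_slope_sub_le` bounds that change by the increment of π.

All this needs the solution to be described faithfully by its waves. `Coherent` says so at one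
collision time, and `coherent_zero` and `coherent_succ` propagate it. Envelopes enter only through
`IsEnvelope`, which `isDiscreteEnvelope_convEnv` and `IsContiguous.isEnvelope` extract from the
definition by suprema. -/

noncomputable section
open scoped Classical

/-! ### Ranks in a finite set of natural numbers -/

/-- The number of elements of `K` up to `p`. -/
def rankIn (K : Finset ℕ) (p : ℕ) : ℕ := (K.filter (· ≤ p)).card

lemma rankIn_mono (K : Finset ℕ) {p q : ℕ} (h : p ≤ q) : rankIn K p ≤ rankIn K q :=
  Finset.card_le_card fun x hx => by
    simp only [Finset.mem_filter] at hx ⊢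
    exact ⟨hx.1, hx.2.trans h⟩

lemma rankIn_lt {K : Finset ℕ} {p q : ℕ} (hq : q ∈ K) (h : p < q) : rankIn K p < rankIn K q := by
  refine Finset.card_lt_card (Finset.ssubset_iff_subset_ne.2 ⟨?_, ?_⟩)
  · intro x hx
    simp only [Finset.mem_filter] at hx ⊢
    exact ⟨hx.1, hx.2.trans h.le⟩
  · intro hE
    have : q ∈ K.filter (· ≤ q) := by simp [hq]
    rw [← hE] at this
    simp only [Finset.mem_filter] at this
    omega

lemma rankIn_pos {K : Finset ℕ} {p : ℕ} (hp : p ∈ K) : 1 ≤ rankIn K p :=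
  Finset.card_pos.2 ⟨p, by simp [hp]⟩

lemma rankIn_le_card (K : Finset ℕ) (p : ℕ) : rankIn K p ≤ K.card :=
  Finset.card_le_card (Finset.filter_subset _ _)

lemma rankIn_le_iff {K : Finset ℕ} {p q : ℕ} (hp : p ∈ K) : rankIn K p ≤ rankIn K q ↔ p ≤ q := by
  refine ⟨fun h => ?_, rankIn_mono K⟩
  by_contra hlt
  exact absurd (rankIn_lt hp (not_le.1 hlt)) (not_lt.2 h)

lemma rankIn_injOn (K : Finset ℕ) : Set.InjOn (rankIn K) K := fun _ hp _ hq h =>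
  le_antisymm ((rankIn_le_iff hp).1 h.le) ((rankIn_le_iff hq).1 h.ge)

/-- Injectivity and a count of elements show that no rank is skipped; this moves sums over waves to
sums over indices. -/
lemma image_rankIn (K : Finset ℕ) (n : ℕ) :
    (K.filter (· ≤ n)).image (rankIn K) = Finset.Icc 1 (rankIn K n) := by
  apply Finset.eq_of_subset_of_card_le
  · intro i hi
    obtain ⟨p, hp, rfl⟩ := Finset.mem_image.1 hi
    simp only [Finset.mem_filter] at hp
    exact Finset.mem_Icc.2 ⟨rankIn_pos hp.1, rankIn_mono K hp.2⟩
  · rw [Finset.card_image_of_injOn ((rankIn_injOn K).mono (by intro x; simp +contextual))]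
    simp [rankIn]

lemma exists_rankIn_eq {K : Finset ℕ} {i : ℕ} (h1 : 1 ≤ i) (h2 : i ≤ K.card) :
    ∃ p ∈ K, rankIn K p = i := by
  have hK : K.Nonempty := Finset.card_pos.1 (by omega)
  have hr : rankIn K (K.max' hK) = K.card := by
    unfold rankIn
    rw [Finset.filter_true_of_mem]
    exact fun x hx => K.le_max' x hx
  have : i ∈ (K.filter (· ≤ K.max' hK)).image (rankIn K) := by
    rw [image_rankIn, hr]; exact Finset.mem_Icc.2 ⟨h1, h2⟩
  obtain ⟨p, hp, hpi⟩ := Finset.mem_image.1 this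
  exact ⟨p, (Finset.mem_filter.1 hp).1, hpi⟩

lemma sum_rankIn (K : Finset ℕ) (n : ℕ) (F : ℕ → ℝ) :
    ∑ q ∈ K.filter (· ≤ n), F (rankIn K q) = ∑ i ∈ Finset.range (rankIn K n), F (i + 1) := by
  have h1 : ∑ q ∈ K.filter (· ≤ n), F (rankIn K q) = ∑ i ∈ Finset.Icc 1 (rankIn K n), F i := by
    rw [← image_rankIn, Finset.sum_image]
    exact (rankIn_injOn K).mono (by intro x; simp +contextual)
  rw [h1, Finset.range_eq_Ico, Finset.sum_Ico_add' F 0 (rankIn K n) 1]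
  rfl

/-! ### Discrete convex envelopes -/

/-- `E` is the convex envelope of the finite sequence `g 0, …, g n`. -/
structure IsDiscreteEnvelope (n : ℕ) (g E : ℕ → ℝ) : Prop where
  le : ∀ i ≤ n, E i ≤ g i
  convex : ∀ i, i + 2 ≤ n → E (i + 1) - E i ≤ E (i + 2) - E (i + 1)
  affine_le : ∀ α β : ℝ, (∀ i ≤ n, α + β * i ≤ g i) → ∀ i ≤ n, α + β * i ≤ E i

namespace IsDiscreteEnvelope

variable {n : ℕ} {g E : ℕ → ℝ}

/-- Waves of negative sign run through the states downwards; reversing the index lets the convex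
case serve them too. -/
lemma reverse (h : IsDiscreteEnvelope n g E) :
    IsDiscreteEnvelope n (fun i => g (n - i)) (fun i => E (n - i)) where
  le i hi := h.le _ (Nat.sub_le _ _)
  convex i hi := by
    have := h.convex (n - (i + 2)) (by omega)
    rw [show n - (i + 2) + 1 = n - (i + 1) by omega, show n - (i + 2) + 2 = n - i by omega] at this
    linarith
  affine_le α β hab i hi := by
    have := h.affine_le (α + β * n) (-β) (fun k hk => by
      have := hab (n - k) (Nat.sub_le _ _)
      rw [Nat.sub_sub_self hk] at this
      rw [Nat.cast_sub hk] at this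
      linarith) (n - i) (Nat.sub_le _ _)
    rw [Nat.cast_sub hi] at this
    linarith

lemma eq_zero (h : IsDiscreteEnvelope n g E) : E 0 = g 0 := by
  refine le_antisymm (h.le 0 (Nat.zero_le _)) ?_
  set B := ∑ i ∈ Finset.range (n + 1), |g i - g 0| with hB
  have hB0 : 0 ≤ B := Finset.sum_nonneg fun _ _ => abs_nonneg _
  -- The line of slope `-B` through the first point lies below `g`, since `B` dominates every
  -- difference from `g 0`.
  have := h.affine_le (g 0) (-B) (fun i hi => by
    rcases Nat.eq_zero_or_pos i with rfl | hpos
    · simp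
    · have h1 : |g i - g 0| ≤ B := Finset.single_le_sum (f := fun i => |g i - g 0|)
        (fun _ _ => abs_nonneg _) (Finset.mem_range.2 (by omega))
      have h2 : (1 : ℝ) ≤ i := by exact_mod_cast hpos
      have h3 := neg_abs_le (g i - g 0)
      nlinarith) 0 (Nat.zero_le _)
  simpa using this

lemma eq_last (h : IsDiscreteEnvelope n g E) : E n = g n := by
  have := h.reverse.eq_zero
  simpa using this

lemma slope_mono (h : IsDiscreteEnvelope n g E) {i k : ℕ} (hik : i ≤ k) (hk : k + 1 ≤ n) :
    E (i + 1) - E i ≤ E (k + 1) - E k := by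
  induction k, hik using Nat.le_induction with
  | base => exact le_rfl
  | succ k _ ih => exact (ih (by omega)).trans (h.convex k (by omega))

/-- A convex envelope bends only where it touches. At a corner without contact, a line of
intermediate slope passing slightly above the corner would still lie below `g`, against `affine_le`.
-/
lemma eq_of_slope_lt (h : IsDiscreteEnvelope n g E) {k : ℕ} (hk : k + 2 ≤ n)
    (hlt : E (k + 1) - E k < E (k + 2) - E (k + 1)) : E (k + 1) = g (k + 1) := by
  refine le_antisymm (h.le _ (by omega)) ?_
  by_contra hcon
  push Not at hcon
  set l1 := E (k + 1) - E k with hl1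
  set l2 := E (k + 2) - E (k + 1) with hl2
  -- The first bound keeps the raised line below `E` at the two neighbours, hence by convexity at
  -- all other points; the second keeps it below `g` at the corner.
  set η := min ((l2 - l1) / 2) (g (k + 1) - E (k + 1)) with hη
  have hη0 : 0 < η := lt_min (by linarith) (by linarith)
  have hη1 : η ≤ (l2 - l1) / 2 := min_le_left _ _
  have hη2 : η ≤ g (k + 1) - E (k + 1) := min_le_right _ _
  set l := (l1 + l2) / 2 with hl
  have up : ∀ m, k + 2 + m ≤ n → E (k + 1) + η + l * (1 + m) ≤ E (k + 2 + m) := by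
    intro m
    induction m with
    | zero => intro _; simp only [Nat.cast_zero, add_zero]; linarith
    | succ m ih =>
      intro hm
      have h1 := ih (by omega)
      have h2 := h.slope_mono (i := k + 1) (k := k + 2 + m) (by omega) (by omega)
      push_cast
      have h3 : E (k + 1 + 1) = E (k + 2) := rfl
      rw [show k + 2 + (m + 1) = k + 2 + m + 1 by ring]
      nlinarith
  have dn : ∀ m, m ≤ k → E (k + 1) + η - l * (1 + m) ≤ E (k - m) := by
    intro m
    induction m with
    | zero => intro _; simp only [Nat.cast_zero, add_zero, Nat.sub_zero]; linarith
    | succ m ih =>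
      intro hm
      have h1 := ih (by omega)
      have h2 := h.slope_mono (i := k - (m + 1)) (k := k) (by omega) (by omega)
      rw [show k - (m + 1) + 1 = k - m by omega] at h2
      push_cast
      nlinarith
  have key := h.affine_le (E (k + 1) + η - l * (k + 1)) l (fun i hi => by
    rcases lt_trichotomy i (k + 1) with hlt' | rfl | hgt
    · have h1 := dn (k - i) (by omega)
      rw [Nat.sub_sub_self (by omega : i ≤ k), Nat.cast_sub (by omega : i ≤ k)] at h1
      have := h.le i hi
      nlinarith
    · push_cast; linarith
    · have h1 := up (i - (k + 2)) (by omega)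
      rw [show k + 2 + (i - (k + 2)) = i by omega, Nat.cast_sub (by omega : k + 2 ≤ i)] at h1
      have := h.le i hi
      push_cast at h1
      nlinarith) (k + 1) (by omega)
  push_cast at key
  linarith

end IsDiscreteEnvelope

/-! ### Envelopes of slopes on a finite set, and shocks -/

/-- `e` assigns to the elements of `K` the slopes of the convex envelope of the sequence which has
increments `d`. -/
structure IsEnvelope (K : Finset ℕ) (d e : ℕ → ℝ) : Prop where
  mono : ∀ p ∈ K, ∀ q ∈ K, p ≤ q → e p ≤ e q
  prefix_nonneg : ∀ n, 0 ≤ ∑ q ∈ K.filter (· ≤ n), (d q - e q)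
  level : ∀ c : ℝ, ∑ q ∈ K.filter (e · ≤ c), (d q - e q) = 0

/-- The average of `d` over `J`. -/
def average (J : Finset ℕ) (d : ℕ → ℝ) : ℝ := (∑ q ∈ J, d q) / J.card

/-- The convex envelope of the sequence with increments `d` is affine on `J`. -/
def IsShock (J : Finset ℕ) (d : ℕ → ℝ) : Prop :=
  ∀ n, ((J.filter (· ≤ n)).card : ℝ) * average J d ≤ ∑ q ∈ J.filter (· ≤ n), d q

lemma card_mul_average (J : Finset ℕ) (d : ℕ → ℝ) :
    (J.card : ℝ) * average J d = ∑ q ∈ J, d q := by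
  rcases J.eq_empty_or_nonempty with rfl | h
  · simp
  · have : (J.card : ℝ) ≠ 0 := by exact_mod_cast h.card_pos.ne'
    unfold average
    field_simp

lemma average_eq {J : Finset ℕ} (hJ : J.Nonempty) {d : ℕ → ℝ} {a : ℝ}
    (h : ∑ q ∈ J, d q = J.card * a) : average J d = a := by
  have : (J.card : ℝ) ≠ 0 := by exact_mod_cast hJ.card_pos.ne'
  unfold average
  rw [h]
  field_simp

lemma average_add_const {J : Finset ℕ} (hJ : J.Nonempty) {d d' : ℕ → ℝ} {c : ℝ}
    (h : ∀ p ∈ J, d' p = d p + c) : average J d' = average J d + c := by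
  refine average_eq hJ ?_
  rw [mul_add, card_mul_average, Finset.sum_congr rfl h, Finset.sum_add_distrib,
    Finset.sum_const, nsmul_eq_mul]

/-- The effective flux matters only up to affine functions, which shift all slopes by one constant.
This is how shocks pass between the effective flux and the flux itself. -/
lemma IsShock.add_const {J : Finset ℕ} {d d' : ℕ → ℝ} {c : ℝ} (hs : IsShock J d)
    (h : ∀ p ∈ J, d' p = d p + c) : IsShock J d' := by
  rcases J.eq_empty_or_nonempty with rfl | hJ
  · intro n; simp
  intro n
  rw [average_add_const hJ h, Finset.sum_congr rfl
    (fun p hp => h p (Finset.mem_filter.1 hp).1), Finset.sum_add_distrib, Finset.sum_const,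
    nsmul_eq_mul, mul_add]
  linarith [hs n]

/-- The average over an initial part of a shock is at least that over the shock. -/
lemma IsShock.le_sum_of_lower {J C : Finset ℕ} {d : ℕ → ℝ} (hs : IsShock J d) (hC : C ⊆ J)
    (hlow : ∀ r ∈ J, ∀ a ∈ C, r ≤ a → r ∈ C) : (C.card : ℝ) * average J d ≤ ∑ q ∈ C, d q := by
  rcases C.eq_empty_or_nonempty with rfl | hne
  · simp
  have : C = J.filter (· ≤ C.max' hne) := by
    ext r
    simp only [Finset.mem_filter]
    exact ⟨fun h => ⟨hC h, C.le_max' r h⟩, fun h => hlow r h.1 _ (C.max'_mem hne) h.2⟩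
  rw [this]
  exact hs _

/-- The average over a final part of a shock is at most that over the shock. -/
lemma IsShock.sum_le_of_upper {J C : Finset ℕ} {d : ℕ → ℝ} (hs : IsShock J d) (hC : C ⊆ J)
    (hup : ∀ r ∈ J, ∀ a ∈ C, a ≤ r → r ∈ C) : ∑ q ∈ C, d q ≤ (C.card : ℝ) * average J d := by
  have h1 := hs.le_sum_of_lower (C := J \ C) Finset.sdiff_subset (fun r hr a ha hra => by
    simp only [Finset.mem_sdiff] at ha ⊢
    exact ⟨hr, fun hrC => ha.2 (hup a ha.1 r hrC hra)⟩)
  have h2 := Finset.sum_sdiff (f := d) hC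
  have h3 := card_mul_average J d
  have h4 : ((J \ C).card : ℝ) = J.card - C.card := by
    rw [Finset.card_sdiff_of_subset hC, Nat.cast_sub (Finset.card_le_card hC)]
  rw [h4] at h1
  linarith

namespace IsEnvelope

variable {K : Finset ℕ} {d e : ℕ → ℝ}

lemma level_lt (h : IsEnvelope K d e) (c : ℝ) : ∑ q ∈ K.filter (e · < c), (d q - e q) = 0 := by
  rcases (K.filter (e · < c)).eq_empty_or_nonempty with h0 | hne
  · rw [h0]; simp
  · obtain ⟨m, hm, hmax⟩ := Finset.exists_max_image _ e hne
    have : K.filter (e · < c) = K.filter (e · ≤ e m) := by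
      ext r
      simp only [Finset.mem_filter] at hm hmax ⊢
      exact ⟨fun hr => ⟨hr.1, hmax r hr⟩, fun hr => ⟨hr.1, hr.2.trans_lt hm.2⟩⟩
    rw [this, h.level]

lemma total (h : IsEnvelope K d e) : ∑ q ∈ K, (d q - e q) = 0 := by
  rcases K.eq_empty_or_nonempty with rfl | hne
  · simp
  · obtain ⟨m, hm, hmax⟩ := Finset.exists_max_image K e hne
    have := h.level (e m)
    rwa [Finset.filter_true_of_mem hmax] at this

lemma level_ge (h : IsEnvelope K d e) (c : ℝ) : ∑ q ∈ K.filter (c ≤ e ·), (d q - e q) = 0 := by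
  have h1 := Finset.sum_filter_add_sum_filter_not K (e · < c) (fun q => d q - e q)
  rw [h.level_lt, h.total, zero_add] at h1
  simpa only [not_lt] using h1

/-- Contact at the bends lets `e` replace `d` in the sum over an upper level set. With
`sum_lower_le` it compares single envelope speeds with averages of slopes in the induction for the
pair gap. -/
lemma sum_upper_ge (h : IsEnvelope K d e) (c : ℝ) :
    ((K.filter (c ≤ e ·)).card : ℝ) * c ≤ ∑ q ∈ K.filter (c ≤ e ·), d q := by
  have h1 := h.level_ge c
  rw [Finset.sum_sub_distrib] at h1
  have h2 : ((K.filter (c ≤ e ·)).card : ℝ) * c ≤ ∑ q ∈ K.filter (c ≤ e ·), e q := by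
    rw [← nsmul_eq_mul]
    exact Finset.card_nsmul_le_sum _ _ _ fun q hq => (Finset.mem_filter.1 hq).2
  linarith

lemma sum_lower_le (h : IsEnvelope K d e) (c : ℝ) :
    ∑ q ∈ K.filter (e · ≤ c), d q ≤ ((K.filter (e · ≤ c)).card : ℝ) * c := by
  have h1 := h.level c
  rw [Finset.sum_sub_distrib] at h1
  have h2 : ∑ q ∈ K.filter (e · ≤ c), e q ≤ ((K.filter (e · ≤ c)).card : ℝ) * c := by
    rw [← nsmul_eq_mul]
    exact Finset.sum_le_card_nsmul _ _ _ fun q hq => (Finset.mem_filter.1 hq).2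
  linarith

/-- The average of `d` over the lower level set of `e p` is at most `e p`. Through this, lower
bounds on slopes become lower bounds on speeds. -/
lemma exists_le (h : IsEnvelope K d e) {p : ℕ} (hp : p ∈ K) : ∃ q ∈ K, d q ≤ e p := by
  have h1 := h.sum_lower_le (e p)
  rw [← nsmul_eq_mul, ← Finset.sum_const] at h1
  obtain ⟨q, hq, hle⟩ := Finset.exists_le_of_sum_le ⟨p, by simp [hp]⟩ h1
  exact ⟨q, (Finset.mem_filter.1 hq).1, hle⟩

lemma sum_level_eq (h : IsEnvelope K d e) (c : ℝ) :
    ∑ q ∈ K.filter (e · = c), (d q - e q) = 0 := by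
  have h1 := h.level c
  have h2 := h.level_lt c
  have h3 : K.filter (e · ≤ c) = K.filter (e · < c) ∪ K.filter (e · = c) := by
    ext r; simp only [Finset.mem_filter, Finset.mem_union, le_iff_lt_or_eq]; tauto
  rw [h3, Finset.sum_union, h2, zero_add] at h1
  · exact h1
  · rw [Finset.disjoint_left]
    intro r hr hr'
    simp only [Finset.mem_filter] at hr hr'
    exact hr.2.ne hr'.2

lemma average_level (h : IsEnvelope K d e) {c : ℝ} (hne : (K.filter (e · = c)).Nonempty) :
    average (K.filter (e · = c)) d = c := by
  refine average_eq hne ?_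
  have h1 := h.sum_level_eq c
  rw [Finset.sum_sub_distrib, sub_eq_zero] at h1
  rw [h1, Finset.sum_congr rfl (fun q hq => (Finset.mem_filter.1 hq).2), Finset.sum_const,
    nsmul_eq_mul]

/-- The level sets of an envelope are shocks. -/
lemma isShock_level (h : IsEnvelope K d e) (c : ℝ) : IsShock (K.filter (e · = c)) d := by
  intro n
  rcases ((K.filter (e · = c)).filter (· ≤ n)).eq_empty_or_nonempty with h0 | ⟨r0, hr0⟩
  · rw [h0]; simp
  have hne : (K.filter (e · = c)).Nonempty := ⟨r0, (Finset.mem_filter.1 hr0).1⟩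
  rw [h.average_level hne]
  simp only [Finset.mem_filter] at hr0
  have key : 0 ≤ ∑ q ∈ (K.filter (e · = c)).filter (· ≤ n), (d q - e q) := by
    -- If the cut lies beyond the level set, the partial sum is the full one and vanishes. Otherwise
    -- it is a prefix sum minus the sum over a lower level set, which vanishes.
    by_cases hex : ∃ r ∈ K, r ≤ n ∧ c < e r
    · obtain ⟨r, hr, hrn, hcr⟩ := hex
      rw [Finset.filter_true_of_mem, h.sum_level_eq]
      intro q hq
      simp only [Finset.mem_filter] at hq
      by_contra hnq
      have := h.mono r hr q hq.1 (by omega)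
      linarith [hq.2]
    · push Not at hex
      have h3 : K.filter (· ≤ n) = K.filter (e · < c) ∪ (K.filter (e · = c)).filter (· ≤ n) := by
        ext r
        simp only [Finset.mem_filter, Finset.mem_union]
        constructor
        · rintro ⟨h1, h2⟩
          rcases (hex r h1 h2).lt_or_eq with h4 | h4
          · exact Or.inl ⟨h1, h4⟩
          · exact Or.inr ⟨⟨h1, h4⟩, h2⟩
        · rintro (⟨h1, h2⟩ | ⟨⟨h1, h2⟩, h4⟩)
          · refine ⟨h1, ?_⟩
            by_contra hrn
            have := h.mono r0 hr0.1.1 r h1 (by omega)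
            linarith [hr0.1.2]
          · exact ⟨h1, h4⟩
      have h1 := h.prefix_nonneg n
      rw [h3, Finset.sum_union, h.level_lt, zero_add] at h1
      · exact h1
      · rw [Finset.disjoint_left]
        intro r hr hr'
        simp only [Finset.mem_filter] at hr hr'
        exact hr.2.ne hr'.1.2
  rw [Finset.sum_sub_distrib, Finset.sum_congr rfl
    (fun q hq => (Finset.mem_filter.1 (Finset.mem_filter.1 hq).1).2 :
      ∀ q ∈ (K.filter (e · = c)).filter (· ≤ n), e q = c), Finset.sum_const, nsmul_eq_mul] at key
  linarith

/-- An interval of `K` which is a shock is not divided by the envelope on `K`. -/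
lemma eq_of_isShock (h : IsEnvelope K d e) {J : Finset ℕ} (hJ : J ⊆ K)
    (hconv : ∀ r ∈ K, ∀ a ∈ J, ∀ b ∈ J, a ≤ r → r ≤ b → r ∈ J) (hs : IsShock J d)
    {p q : ℕ} (hp : p ∈ J) (hq : q ∈ J) : e p = e q := by
  wlog hlt : e p < e q generalizing p q
  · by_contra hne
    rcases lt_or_gt_of_ne hne with h1 | h1
    · exact this hp hq h1 |> hne
    · exact this hq hp h1 |>.symm |> hne
  exfalso
  set c := e p with hc
  set a := average J d with ha
  have hJne : J.Nonempty := ⟨p, hp⟩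
  set m := J.min' hJne with hm
  have hmJ : m ∈ J := J.min'_mem hJne
  have hmin : ∀ r ∈ J, m ≤ r := fun r hr => J.min'_le r hr
  -- Everything after `J` has slope above `c` because `q` has, so the level set is cut inside `J`.
  -- The waves before `J` contribute a nonnegative amount to a vanishing sum, so on the slow part of
  -- `J` the sum of `d` is at most that of `e`.
  have hK1 : K.filter (e · ≤ c) = K.filter (· < m) ∪ J.filter (e · ≤ c) := by
    ext r
    simp only [Finset.mem_filter, Finset.mem_union]
    constructor
    · rintro ⟨h1, h2⟩
      by_cases h3 : r < m
      · exact Or.inl ⟨h1, h3⟩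
      · refine Or.inr ⟨hconv r h1 m hmJ q hq (by omega) ?_, h2⟩
        by_contra h4
        have := h.mono q (hJ hq) r h1 (by omega)
        linarith
    · rintro (⟨h1, h2⟩ | ⟨h1, h2⟩)
      · exact ⟨h1, h.mono r h1 p (hJ hp) (h2.le.trans (hmin p hp))⟩
      · exact ⟨hJ h1, h2⟩
  have hlow : 0 ≤ ∑ r ∈ K.filter (· < m), (d r - e r) := by
    rcases Nat.eq_zero_or_pos m with h0 | hpos
    · rw [h0]; simp
    · have := h.prefix_nonneg (m - 1)
      rwa [show K.filter (· ≤ m - 1) = K.filter (· < m) by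
        ext r; simp only [Finset.mem_filter]; constructor <;> (rintro ⟨h1, h2⟩; exact ⟨h1, by omega⟩)]
        at this
  have h1 : ∑ r ∈ J.filter (e · ≤ c), (d r - e r) ≤ 0 := by
    have := h.level c
    rw [hK1, Finset.sum_union] at this
    · linarith
    · rw [Finset.disjoint_left]
      intro r hr hr'
      simp only [Finset.mem_filter] at hr hr'
      have := hmin r hr'.1
      omega
  set M := J.max' hJne with hM
  have hMJ : M ∈ J := J.max'_mem hJne
  have hmax : ∀ r ∈ J, r ≤ M := fun r hr => J.le_max' r hr
  -- Mirror argument: the prefix ending with `J` is a level set followed by the fast part of `J`, on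
  -- which the sum of `d` is therefore at least that of `e`.
  have hK2 : K.filter (· ≤ M) = K.filter (e · ≤ c) ∪ J.filter (c < e ·) := by
    ext r
    simp only [Finset.mem_filter, Finset.mem_union]
    constructor
    · rintro ⟨h1, h2⟩
      by_cases h3 : e r ≤ c
      · exact Or.inl ⟨h1, h3⟩
      · refine Or.inr ⟨hconv r h1 p hp M hMJ ?_ h2, by linarith⟩
        by_contra h4
        exact h3 (h.mono r h1 p (hJ hp) (by omega))
    · rintro (⟨h1, h2⟩ | ⟨h1, h2⟩)
      · refine ⟨h1, ?_⟩
        by_contra h4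
        have := h.mono q (hJ hq) r h1 ((hmax q hq).trans (by omega))
        linarith
      · exact ⟨hJ h1, hmax r h1⟩
  have h2 : 0 ≤ ∑ r ∈ J.filter (c < e ·), (d r - e r) := by
    have := h.prefix_nonneg M
    rw [hK2, Finset.sum_union, h.level, zero_add] at this
    · exact this
    · rw [Finset.disjoint_left]
      intro r hr hr'
      simp only [Finset.mem_filter] at hr hr'
      linarith [hr.2, hr'.2]
  rw [Finset.sum_sub_distrib] at h1 h2
  have h3 := hs.le_sum_of_lower (C := J.filter (e · ≤ c)) (Finset.filter_subset _ _)
    (fun r hr b hb hrb => by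
      simp only [Finset.mem_filter] at hb ⊢
      exact ⟨hr, (h.mono r (hJ hr) b (hJ hb.1) hrb).trans hb.2⟩)
  have h4 := hs.sum_le_of_upper (C := J.filter (c < e ·)) (Finset.filter_subset _ _)
    (fun r hr b hb hrb => by
      simp only [Finset.mem_filter] at hb ⊢
      exact ⟨hr, hb.2.trans_le (h.mono b (hJ hb.1) r (hJ hr) hrb)⟩)
  have h5 : ∑ r ∈ J.filter (e · ≤ c), e r ≤ ((J.filter (e · ≤ c)).card : ℝ) * c := by
    rw [← nsmul_eq_mul]
    exact Finset.sum_le_card_nsmul _ _ _ fun q hq => (Finset.mem_filter.1 hq).2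
  have hq' : (J.filter (c < e ·)).Nonempty := ⟨q, by simp [hq, hlt]⟩
  have h6 : ((J.filter (c < e ·)).card : ℝ) * c < ∑ r ∈ J.filter (c < e ·), e r := by
    rw [← nsmul_eq_mul, ← Finset.sum_const]
    exact Finset.sum_lt_sum_of_nonempty hq' fun q hq => (Finset.mem_filter.1 hq).2
  have h7 : (0 : ℝ) < (J.filter (e · ≤ c)).card := by
    exact_mod_cast Finset.card_pos.2 ⟨p, by simp [hp, hc]⟩
  have h8 : (0 : ℝ) < (J.filter (c < e ·)).card := by exact_mod_cast hq'.card_pos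
  -- The slow part, an initial piece of the shock, puts its average at or below `c`; the fast part,
  -- a final piece, puts it strictly above.
  have h9 : a ≤ c := by
    have : ((J.filter (e · ≤ c)).card : ℝ) * a ≤ ((J.filter (e · ≤ c)).card : ℝ) * c := by linarith
    exact le_of_mul_le_mul_left this h7
  have h10 : c < a := by
    have : ((J.filter (c < e ·)).card : ℝ) * c < ((J.filter (c < e ·)).card : ℝ) * a := by linarith
    exact lt_of_mul_lt_mul_left this h8.le
  linarith

/-- The envelope on a shock is constant and equal to the average. -/
lemma eq_average (h : IsEnvelope K d e) (hs : IsShock K d) {p : ℕ} (hp : p ∈ K) :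
    e p = average K d := by
  symm
  refine average_eq ⟨p, hp⟩ ?_
  have h1 := h.total
  rw [Finset.sum_sub_distrib, sub_eq_zero] at h1
  rw [h1, Finset.sum_congr rfl (fun q hq => h.eq_of_isShock (Finset.Subset.refl K)
    (fun r hr _ _ _ _ _ _ => hr) hs hq hp), Finset.sum_const, nsmul_eq_mul]

end IsEnvelope

/-- Two consecutive shocks with decreasing speeds form a single shock. -/
lemma IsShock.union {L R : Finset ℕ} {d : ℕ → ℝ} (hL : IsShock L d) (hR : IsShock R d)
    (hLR : ∀ a ∈ L, ∀ b ∈ R, a < b) (havg : average R d ≤ average L d) :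
    IsShock (L ∪ R) d := by
  have hdisj : Disjoint L R := Finset.disjoint_left.2 fun a ha hb => (hLR a ha a hb).ne rfl
  rcases (L ∪ R).eq_empty_or_nonempty with h0 | hne
  · rw [h0]; intro n; simp
  set a := average (L ∪ R) d with ha
  have h1 := card_mul_average (L ∪ R) d
  rw [Finset.sum_union hdisj, Finset.card_union_of_disjoint hdisj, ← card_mul_average L,
    ← card_mul_average R, ← ha] at h1
  push_cast at h1
  have hpos : (0 : ℝ) < (L.card : ℝ) + R.card := by
    have := hne.card_pos
    rw [Finset.card_union_of_disjoint hdisj] at this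
    exact_mod_cast this
  have hLn : (0 : ℝ) ≤ L.card := Nat.cast_nonneg _
  have hRn : (0 : ℝ) ≤ R.card := Nat.cast_nonneg _
  have haL : a ≤ average L d := by
    have : ((L.card : ℝ) + R.card) * a ≤ ((L.card : ℝ) + R.card) * average L d := by
      rw [h1]; nlinarith
    exact le_of_mul_le_mul_left this hpos
  have haR : average R d ≤ a := by
    have : ((L.card : ℝ) + R.card) * average R d ≤ ((L.card : ℝ) + R.card) * a := by
      rw [h1]; nlinarith
    exact le_of_mul_le_mul_left this hpos
  intro n
  rw [← ha, Finset.filter_union, Finset.card_union_of_disjoint (Finset.disjoint_filter_filter hdisj),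
    Finset.sum_union (Finset.disjoint_filter_filter hdisj)]
  push_cast
  have h2 := hL n
  have h3 := hR n
  -- Before the cut reaches `R`, the bound for `L` suffices, as its average is the larger one.
  -- Afterwards `L` is complete, and its surplus over `a` equals the total deficit of `R`, of which
  -- the cut uses only a part.
  by_cases hR0 : (R.filter (· ≤ n)).Nonempty
  · obtain ⟨b, hb⟩ := hR0
    simp only [Finset.mem_filter] at hb
    have hLf : L.filter (· ≤ n) = L :=
      Finset.filter_true_of_mem fun x hx => (hLR x hx b hb.1).le.trans hb.2
    rw [hLf] at h2 ⊢
    have h4 : ((R.filter (· ≤ n)).card : ℝ) ≤ R.card := by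
      exact_mod_cast Finset.card_le_card (Finset.filter_subset _ _)
    nlinarith
  · rw [Finset.not_nonempty_iff_eq_empty] at hR0
    rw [hR0] at h3 ⊢
    have : (0 : ℝ) ≤ (L.filter (· ≤ n)).card := Nat.cast_nonneg _
    simp only [Finset.card_empty, Nat.cast_zero, add_zero, Finset.sum_empty]
    nlinarith

/-- The slopes of a discrete envelope, transported to a finite set of natural numbers. -/
lemma IsDiscreteEnvelope.isEnvelope {K : Finset ℕ} {g E : ℕ → ℝ} {ε : ℝ} (hε : 0 < ε)
    (h : IsDiscreteEnvelope K.card g E) {d e : ℕ → ℝ}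
    (hd : ∀ p ∈ K, d p = (g (rankIn K p) - g (rankIn K p - 1)) / ε)
    (he : ∀ p ∈ K, e p = (E (rankIn K p) - E (rankIn K p - 1)) / ε) : IsEnvelope K d e := by
  have mono : ∀ p ∈ K, ∀ q ∈ K, p ≤ q → e p ≤ e q := by
    intro p hp q hq hpq
    rw [he p hp, he q hq]
    have h1 := rankIn_pos hp
    have h2 := rankIn_pos hq
    have h3 := rankIn_mono K hpq
    have h4 := h.slope_mono (i := rankIn K p - 1) (k := rankIn K q - 1) (by omega)
      (by have := rankIn_le_card K q; omega)
    rw [Nat.sub_add_cancel h1, Nat.sub_add_cancel h2] at h4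
    gcongr
  have hsum : ∀ n, ∑ q ∈ K.filter (· ≤ n), (d q - e q) =
      (g (rankIn K n) - E (rankIn K n)) / ε := by
    intro n
    have h1 : ∑ q ∈ K.filter (· ≤ n), (d q - e q) = ∑ q ∈ K.filter (· ≤ n),
        (fun i => ((g i - E i) - (g (i - 1) - E (i - 1))) / ε) (rankIn K q) := by
      refine Finset.sum_congr rfl fun q hq => ?_
      rw [hd q (Finset.mem_filter.1 hq).1, he q (Finset.mem_filter.1 hq).1]
      ring
    rw [h1, sum_rankIn K n (fun i => ((g i - E i) - (g (i - 1) - E (i - 1))) / ε)]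
    simp only [Nat.add_sub_cancel]
    rw [← Finset.sum_div, Finset.sum_range_sub (fun i => g i - E i), h.eq_zero]
    ring
  refine ⟨mono, fun n => ?_, fun c => ?_⟩
  · rw [hsum]
    exact div_nonneg (sub_nonneg.2 (h.le _ (rankIn_le_card K n))) hε.le
  · rcases (K.filter (e · ≤ c)).eq_empty_or_nonempty with h0 | hne
    · rw [h0]; simp
    set p := (K.filter (e · ≤ c)).max' hne with hpdef
    have hp := Finset.mem_filter.1 ((K.filter (e · ≤ c)).max'_mem hne)
    rw [← hpdef] at hp
    have hset : K.filter (e · ≤ c) = K.filter (· ≤ p) := by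
      ext r
      constructor
      · intro hr
        exact Finset.mem_filter.2 ⟨(Finset.mem_filter.1 hr).1, Finset.le_max' _ _ hr⟩
      · intro hr
        simp only [Finset.mem_filter] at hr ⊢
        exact ⟨hr.1, (mono r hr.1 p hp.1 hr.2).trans hp.2⟩
    rw [hset, hsum]
    rcases (rankIn_le_card K p).eq_or_lt with hr | hr
    · rw [hr, h.eq_last]; simp
    · obtain ⟨p', hp', hrk⟩ := exists_rankIn_eq (K := K) (i := rankIn K p + 1) (by omega) hr
      have hlt : c < e p' := by
        by_contra hcon
        have hmem : p' ∈ K.filter (· ≤ p) := by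
          rw [← hset]; exact Finset.mem_filter.2 ⟨hp', not_lt.1 hcon⟩
        have := rankIn_mono K (Finset.mem_filter.1 hmem).2
        omega
      have h2 : e p < e p' := hp.2.trans_lt hlt
      rw [he p hp.1, he p' hp', hrk, div_lt_div_iff_of_pos_right hε] at h2
      have h3 := rankIn_pos hp.1
      obtain ⟨k, hk⟩ : ∃ k, rankIn K p = k + 1 := ⟨rankIn K p - 1, by omega⟩
      rw [hk] at h2 ⊢
      rw [h.eq_of_slope_lt (k := k) (by omega) (by simpa using h2)]
      simp

/-! ### The convex envelope of a piecewise affine interpolation -/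

lemma interp_grid {ε : ℝ} (hε : 0 < ε) (g : ℝ → ℝ) (k : ℤ) : interp ε g (k * ε) = g (k * ε) := by
  unfold interp
  rw [mul_div_assoc, div_self hε.ne', mul_one, Int.floor_intCast]
  ring

lemma neg_interp (ε : ℝ) (g : ℝ → ℝ) :
    (fun z => -interp ε g z) = interp ε (fun z => -g z) := by
  funext z
  unfold interp
  ring

/-- On each cell the interpolation is a convex combination of nodal values, so affine minorants need
testing at the nodes only. -/
lemma affine_le_interp {ε : ℝ} (hε : 0 < ε) {g : ℝ → ℝ} {m : ℤ} {n : ℕ} {α β : ℝ}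
    (h : ∀ i : ℕ, i ≤ n → α + β * i ≤ g ((m + i) * ε)) {u : ℝ}
    (hu : u ∈ Set.Icc (m * ε) ((m + n) * ε)) : α + β * (u / ε - m) ≤ interp ε g u := by
  obtain ⟨h1, h2⟩ := hu
  have h1' : (m : ℝ) ≤ u / ε := by rwa [le_div_iff₀ hε]
  have h2' : u / ε ≤ m + n := by rwa [div_le_iff₀ hε]
  have hk : m ≤ ⌊u / ε⌋ := Int.le_floor.2 h1'
  obtain ⟨i, hi⟩ := Int.eq_ofNat_of_zero_le (sub_nonneg.2 hk)
  have hki : ⌊u / ε⌋ = m + i := by omega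
  have hkr : ((⌊u / ε⌋ : ℤ) : ℝ) = m + i := by rw [hki]; push_cast; rfl
  have hf1 := Int.floor_le (u / ε)
  have hf2 := Int.lt_floor_add_one (u / ε)
  rw [hkr] at hf1 hf2
  have hin : i ≤ n := by
    have : (i : ℝ) ≤ n := by linarith
    exact_mod_cast this
  have e1 := h i hin
  unfold interp
  rw [hkr]
  rcases hin.lt_or_eq with hlt | rfl
  · have e2 := h (i + 1) hlt
    push_cast at e2
    rw [← add_assoc] at e2
    set θ := u / ε - (m + i) with hθ
    have hθ0 : 0 ≤ θ := by linarith
    have hθ1 : θ ≤ 1 := by linarith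
    have : u / ε - m = i + θ := by rw [hθ]; ring
    rw [this]
    nlinarith
  -- At the right end the node `i + 1` is out of range, but the fractional part vanishes.
  · have : u / ε = m + i := le_antisymm h2' hf1
    rw [this]
    simp only [sub_self, zero_mul, add_zero]
    have : (m : ℝ) + i - m = i := by ring
    rw [this]
    exact e1

/-- The supremum of convex minorants is itself convex and a minorant, and an affine minorant of the
nodal values is one of the competitors. -/
lemma isDiscreteEnvelope_convEnv {ε : ℝ} (hε : 0 < ε) (g : ℝ → ℝ) (m : ℤ) (n : ℕ) :
    IsDiscreteEnvelope n (fun i => g ((m + i) * ε))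
      (fun i => convEnv (m * ε) ((m + n) * ε) (interp ε g) ((m + i) * ε)) := by
  set a : ℝ := m * ε with ha
  set b : ℝ := (m + n) * ε with hb
  set G := interp ε g with hG
  set A : ℝ → Set ℝ := fun u => {y : ℝ | ∃ h : ℝ → ℝ, ConvexOn ℝ (Set.Icc a b) h ∧
    (∀ z ∈ Set.Icc a b, h z ≤ G z) ∧ y = h u} with hA
  -- A constant competitor is needed because the real `sSup` of the empty set is `0`.
  have hne : ∀ u, (A u).Nonempty := by
    intro u
    set B := ∑ i ∈ Finset.range (n + 1), |g ((m + i) * ε)| with hB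
    refine ⟨-B, fun _ => -B, convexOn_const _ (convex_Icc _ _), fun z hz => ?_, rfl⟩
    have := affine_le_interp hε (g := g) (m := m) (n := n) (α := -B) (β := 0) (fun i hi => by
      have h1 : |g ((m + i) * ε)| ≤ B :=
        Finset.single_le_sum (f := fun i : ℕ => |g ((m + i) * ε)|)
          (fun _ _ => abs_nonneg _) (Finset.mem_range.2 (by omega))
      have := neg_abs_le (g ((m + i) * ε))
      linarith) hz
    simpa using this
  have hbdd : ∀ u ∈ Set.Icc a b, BddAbove (A u) := by
    intro u hu
    refine ⟨G u, ?_⟩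
    rintro y ⟨h, _, hle, rfl⟩
    exact hle u hu
  have hE : ∀ u, convEnv a b G u = sSup (A u) := fun u => rfl
  have hle : ∀ u ∈ Set.Icc a b, convEnv a b G u ≤ G u := by
    intro u hu
    rw [hE]
    refine csSup_le (hne u) ?_
    rintro y ⟨h, _, hle, rfl⟩
    exact hle u hu
  have hconv : ConvexOn ℝ (Set.Icc a b) (convEnv a b G) := by
    refine ⟨convex_Icc _ _, fun x hx y hy s t hs ht hst => ?_⟩
    rw [hE]
    refine csSup_le (hne _) ?_
    rintro z ⟨h, hc, hl, rfl⟩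
    have h1 : h x ≤ convEnv a b G x := le_csSup (hbdd x hx) ⟨h, hc, hl, rfl⟩
    have h2 : h y ≤ convEnv a b G y := le_csSup (hbdd y hy) ⟨h, hc, hl, rfl⟩
    have h3 := hc.2 hx hy hs ht hst
    simp only [smul_eq_mul] at h3 ⊢
    nlinarith
  have hmem : ∀ i : ℕ, i ≤ n → ((m : ℝ) + i) * ε ∈ Set.Icc a b := by
    intro i hi
    have : (i : ℝ) ≤ n := by exact_mod_cast hi
    exact ⟨by rw [ha]; nlinarith [(Nat.cast_nonneg i : (0 : ℝ) ≤ i)], by rw [hb]; nlinarith⟩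
  refine ⟨fun i hi => ?_, fun i hi => ?_, fun α β hab i hi => ?_⟩
  · have := hle _ (hmem i hi)
    have h2 := interp_grid hε g (m + i)
    push_cast at h2
    rwa [hG, h2] at this
  · have := hconv.2 (hmem i (by omega)) (hmem (i + 2) (by omega))
      (by norm_num : (0 : ℝ) ≤ 1 / 2) (by norm_num : (0 : ℝ) ≤ 1 / 2) (by norm_num)
    simp only [smul_eq_mul] at this
    rw [show (1 / 2 : ℝ) * ((m + i) * ε) + 1 / 2 * ((m + ((i + 2 : ℕ) : ℝ)) * ε) =
      (m + ((i + 1 : ℕ) : ℝ)) * ε by push_cast; ring] at this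
    linarith
  · have : α + β * (((m + i) * ε) / ε - m) ≤ convEnv a b G ((m + i) * ε) := by
      refine le_csSup (hbdd _ (hmem i hi)) ⟨fun u => α + β * (u / ε - m), ?_, ?_, rfl⟩
      · refine ⟨convex_Icc _ _, fun x _ y _ s t _ _ hst => le_of_eq ?_⟩
        simp only [smul_eq_mul]
        have : s = 1 - t := by linarith
        rw [this]; field_simp; ring
      · exact fun z hz => affine_le_interp hε hab hz
    rwa [mul_div_assoc, div_self hε.ne', mul_one, add_sub_cancel_left] at this

/-! ### Homogeneous intervals of waves -/

namespace WavefrontData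

variable (D : WavefrontData)

/-- The slope of the interpolated flux on the segment of the wave `p`. -/
def cellSlope (g : ℝ → ℝ) (p : ℕ) : ℝ :=
  D.sgn p * (g (D.hatw p) - g (D.hatw p - D.sgn p * D.ε)) / D.ε

/-- The left end of the segment of the wave `p`, in the space of states. -/
def cellLeft (p : ℕ) : ℝ := if 0 < D.sgn p then D.hatw p - D.ε else D.hatw p

/-- `K` is a set of waves of sign `S` whose segments are adjacent, beginning at `m ε`. -/
structure IsContiguous (K : Finset ℕ) (S : ℝ) (m : ℤ) : Prop where
  sign : S = 1 ∨ S = -1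
  sgn_eq : ∀ p ∈ K, D.sgn p = S
  hatw_eq : ∀ p ∈ K, D.hatw p = (m + S * rankIn K p) * D.ε

variable {D}

/-- The segments are half-open on the same side, so adjacent ones tile exactly; rounding `x / ε` up
finds the wave that contains `x`. -/
lemma IsContiguous.iUnion_segment_pos (hε : 0 < D.ε) {K : Finset ℕ} {m : ℤ}
    (h : D.IsContiguous K 1 m) :
    ⋃ p ∈ K, D.segment p = Set.Ioc (m * D.ε) ((m + K.card) * D.ε) := by
  ext x
  simp only [Set.mem_iUnion, exists_prop]
  constructor
  · rintro ⟨p, hp, hx⟩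
    rw [segment, h.sgn_eq p hp, if_pos one_pos, h.hatw_eq p hp] at hx
    have h1 : (1 : ℝ) ≤ rankIn K p := by exact_mod_cast rankIn_pos hp
    have h2 : (rankIn K p : ℝ) ≤ K.card := by exact_mod_cast rankIn_le_card K p
    exact ⟨by nlinarith [hx.1], by nlinarith [hx.2]⟩
  · rintro ⟨h1, h2⟩
    rw [← lt_div_iff₀ hε] at h1
    rw [← div_le_iff₀ hε] at h2
    have hc1 : m < ⌈x / D.ε⌉ := Int.lt_ceil.2 h1
    have hc2 : ⌈x / D.ε⌉ ≤ m + K.card := Int.ceil_le.2 (by push_cast; exact h2)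
    obtain ⟨p, hp, hr⟩ := exists_rankIn_eq (K := K) (i := (⌈x / D.ε⌉ - m).toNat)
      (by omega) (by omega)
    have hr' : (rankIn K p : ℝ) = ⌈x / D.ε⌉ - m := by
      have : ((rankIn K p : ℕ) : ℤ) = ⌈x / D.ε⌉ - m := by rw [hr]; omega
      exact_mod_cast this
    refine ⟨p, hp, ?_⟩
    rw [segment, h.sgn_eq p hp, if_pos one_pos, h.hatw_eq p hp, hr']
    have e1 := Int.le_ceil (x / D.ε)
    have e2 := Int.ceil_lt_add_one (x / D.ε)
    rw [div_le_iff₀ hε] at e1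
    rw [← sub_lt_iff_lt_add, lt_div_iff₀ hε] at e2
    exact ⟨by linarith, by linarith⟩

lemma IsContiguous.iUnion_segment_neg (hε : 0 < D.ε) {K : Finset ℕ} {m : ℤ}
    (h : D.IsContiguous K (-1) m) :
    ⋃ p ∈ K, D.segment p = Set.Ico ((m - K.card) * D.ε) (m * D.ε) := by
  have hn : ¬ (0 : ℝ) < -1 := by norm_num
  ext x
  simp only [Set.mem_iUnion, exists_prop]
  constructor
  · rintro ⟨p, hp, hx⟩
    rw [segment, h.sgn_eq p hp, if_neg hn, h.hatw_eq p hp] at hx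
    have h1 : (1 : ℝ) ≤ rankIn K p := by exact_mod_cast rankIn_pos hp
    have h2 : (rankIn K p : ℝ) ≤ K.card := by exact_mod_cast rankIn_le_card K p
    exact ⟨by nlinarith [hx.1], by nlinarith [hx.2]⟩
  · rintro ⟨h1, h2⟩
    rw [← le_div_iff₀ hε] at h1
    rw [← div_lt_iff₀ hε] at h2
    have hc1 : ⌊x / D.ε⌋ < m := Int.floor_lt.2 h2
    have hc2 : m - K.card ≤ ⌊x / D.ε⌋ := Int.le_floor.2 (by push_cast; exact h1)
    obtain ⟨p, hp, hr⟩ := exists_rankIn_eq (K := K) (i := (m - ⌊x / D.ε⌋).toNat)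
      (by omega) (by omega)
    have hr' : (rankIn K p : ℝ) = m - ⌊x / D.ε⌋ := by
      have : ((rankIn K p : ℕ) : ℤ) = m - ⌊x / D.ε⌋ := by rw [hr]; omega
      exact_mod_cast this
    refine ⟨p, hp, ?_⟩
    rw [segment, h.sgn_eq p hp, if_neg hn, h.hatw_eq p hp, hr']
    have e1 := Int.floor_le (x / D.ε)
    have e2 := Int.lt_floor_add_one (x / D.ε)
    rw [le_div_iff₀ hε] at e1
    rw [div_lt_iff₀ hε] at e2
    exact ⟨by linarith, by linarith⟩

/-- The entropic speed on a homogeneous interval is a Riemann speed. -/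
lemma IsContiguous.entropicSpeed_eq (hε : 0 < D.ε) {K : Finset ℕ} {S : ℝ} {m : ℤ}
    (h : D.IsContiguous K S m) (g : ℝ → ℝ) {p : ℕ} (hp : p ∈ K) :
    D.entropicSpeed g K p =
      riemannSpeed D.ε g (m * D.ε) ((m + S * K.card) * D.ε) (D.cellLeft p) := by
  have hc : (1 : ℝ) ≤ K.card := by exact_mod_cast Finset.card_pos.2 ⟨p, hp⟩
  rcases h.sign with rfl | rfl
  · have h1 : (m : ℝ) * D.ε < (m + K.card) * D.ε := by nlinarith
    rw [entropicSpeed, cellLeft, h.sgn_eq p hp, if_pos one_pos, if_pos one_pos,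
      h.iUnion_segment_pos hε, csInf_Ioc h1, csSup_Ioc h1, one_mul]
  · have hn : ¬ (0 : ℝ) < -1 := by norm_num
    have h1 : ((m : ℝ) - K.card) * D.ε < m * D.ε := by nlinarith
    rw [entropicSpeed, cellLeft, h.sgn_eq p hp, if_neg hn, if_neg hn,
      h.iUnion_segment_neg hε, csInf_Ico h1, csSup_Ico h1, neg_one_mul, ← sub_eq_add_neg]

/-- The entropic speeds on a homogeneous interval of waves are the slopes of an envelope. -/
theorem IsContiguous.isEnvelope (hε : 0 < D.ε) {K : Finset ℕ} {S : ℝ} {m : ℤ}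
    (h : D.IsContiguous K S m) (g : ℝ → ℝ) :
    IsEnvelope K (D.cellSlope g) (D.entropicSpeed g K) := by
  rcases h.sign with rfl | rfl
  · refine (isDiscreteEnvelope_convEnv hε g m K.card).isEnvelope hε (fun p hp => ?_)
      (fun p hp => ?_)
    · have h1 := rankIn_pos hp
      rw [cellSlope, h.sgn_eq p hp, h.hatw_eq p hp, Nat.cast_sub h1]
      push_cast
      rw [show ((m : ℝ) + 1 * rankIn K p) * D.ε - 1 * D.ε = (m + (rankIn K p - 1)) * D.ε by ring]
      simp only [one_mul]
    · have h1 := rankIn_pos hp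
      have hc : (1 : ℝ) ≤ K.card := by exact_mod_cast Finset.card_pos.2 ⟨p, hp⟩
      have h2 : (m : ℝ) * D.ε ≤ (m + 1 * K.card) * D.ε := by nlinarith
      rw [h.entropicSpeed_eq hε g hp, riemannSpeed, if_pos h2, cellLeft, h.sgn_eq p hp,
        if_pos one_pos, h.hatw_eq p hp, Nat.cast_sub h1]
      push_cast
      rw [show ((m : ℝ) + 1 * rankIn K p) * D.ε - D.ε = (m + (rankIn K p - 1)) * D.ε by ring,
        show ((m : ℝ) + (rankIn K p - 1)) * D.ε + D.ε = (m + rankIn K p) * D.ε by ring]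
      simp only [one_mul]
  -- For negative waves the concave envelope is minus the convex envelope of `-g`, and the rank
  -- counts cells downwards from `m`.
  · have key := (isDiscreteEnvelope_convEnv hε (fun z => -g z) (m - K.card) K.card).reverse
    refine key.isEnvelope hε (fun p hp => ?_) (fun p hp => ?_)
    · have h1 := rankIn_pos hp
      have h2 := rankIn_le_card K p
      rw [cellSlope, h.sgn_eq p hp, h.hatw_eq p hp, Nat.cast_sub h2,
        Nat.cast_sub (by omega : rankIn K p - 1 ≤ K.card), Nat.cast_sub h1]
      push_cast
      rw [show ((m : ℝ) + -1 * rankIn K p) * D.ε - -1 * D.ε =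
          (m - K.card + (K.card - (rankIn K p - 1))) * D.ε by ring,
        show ((m : ℝ) + -1 * rankIn K p) * D.ε =
          (m - K.card + (K.card - rankIn K p)) * D.ε by ring]
      ring
    · have h1 := rankIn_pos hp
      have h3 := rankIn_le_card K p
      have hn : ¬ (0 : ℝ) < -1 := by norm_num
      have hc : (1 : ℝ) ≤ K.card := by exact_mod_cast Finset.card_pos.2 ⟨p, hp⟩
      have h2 : ¬ (m : ℝ) * D.ε ≤ (m + -1 * K.card) * D.ε := by nlinarith
      rw [h.entropicSpeed_eq hε g hp, riemannSpeed, if_neg h2, cellLeft, h.sgn_eq p hp,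
        if_neg hn, h.hatw_eq p hp, Nat.cast_sub h3,
        Nat.cast_sub (by omega : rankIn K p - 1 ≤ K.card), Nat.cast_sub h1]
      unfold concEnv
      rw [neg_interp]
      push_cast
      rw [show ((m : ℝ) + -1 * rankIn K p) * D.ε + D.ε =
          (m - K.card + (K.card - (rankIn K p - 1))) * D.ε by ring,
        show ((m : ℝ) + -1 * rankIn K p) * D.ε =
          (m - K.card + (K.card - rankIn K p)) * D.ε by ring,
        show ((m : ℝ) + -1 * K.card) * D.ε = (m - K.card) * D.ε by ring,
        show ((m : ℝ) - K.card + K.card) * D.ε = m * D.ε by ring]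
      ring

end WavefrontData

/-! ### Step functions -/

/-- With no point of `F` strictly between `l` and `y`, the left limit at `y` of a step function is
its value at `l`. -/
lemma exists_lt_forall_le (F : Finset ℝ) (y : ℝ) : ∃ l < y, ∀ z ∈ F, z < y → z ≤ l := by
  rcases (F.filter (· < y)).eq_empty_or_nonempty with h0 | hne
  · refine ⟨y - 1, by linarith, fun z hz hzy => ?_⟩
    have : z ∈ F.filter (· < y) := Finset.mem_filter.2 ⟨hz, hzy⟩
    rw [h0] at this
    simp at this
  · refine ⟨(F.filter (· < y)).max' hne, (Finset.mem_filter.1 (Finset.max'_mem _ hne)).2,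
      fun z hz hzy => Finset.le_max' _ _ (Finset.mem_filter.2 ⟨hz, hzy⟩)⟩

lemma exists_gt_forall_le (F : Finset ℝ) (y : ℝ) : ∃ u, y < u ∧ ∀ z ∈ F, y < z → u < z := by
  rcases (F.filter (y < ·)).eq_empty_or_nonempty with h0 | hne
  · refine ⟨y + 1, by linarith, fun z hz hzy => ?_⟩
    have : z ∈ F.filter (y < ·) := Finset.mem_filter.2 ⟨hz, hzy⟩
    rw [h0] at this
    simp at this
  · have h1 := (Finset.mem_filter.1 (Finset.min'_mem _ hne)).2
    refine ⟨(y + (F.filter (y < ·)).min' hne) / 2, by linarith, fun z hz hzy => ?_⟩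
    have := Finset.min'_le _ _ (Finset.mem_filter.2 ⟨hz, hzy⟩ : z ∈ F.filter (y < ·))
    linarith

lemma leftLim_eq_of_forall {f : ℝ → ℝ} {l y c : ℝ} (hl : l < y) (h : ∀ x, l < x → x < y → f x = c) :
    Function.leftLim f y = c := by
  apply leftLim_eq_of_tendsto
  refine tendsto_const_nhds.congr' ?_
  filter_upwards [Ioo_mem_nhdsLT hl] with x hx
  exact (h x hx.1 hx.2).symm

/-- `u` is constant on the intervals `[x, y]` for which `(x, y]` does not meet `F`. -/
def StepOn (F : Finset ℝ) (u : ℝ → ℝ) : Prop :=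
  ∀ x y : ℝ, x < y → (∀ z ∈ F, z ∉ Set.Ioc x y) → u x = u y

namespace StepOn

variable {F : Finset ℝ} {u : ℝ → ℝ}

lemma leftLim_eq (h : StepOn F u) {l y : ℝ} (hl : l < y) (hF : ∀ z ∈ F, z < y → z ≤ l) :
    Function.leftLim u y = u l :=
  leftLim_eq_of_forall hl fun x h1 h2 => (h l x h1 fun z hz hzx =>
    absurd (hF z hz (hzx.2.trans_lt h2)) (not_le.2 hzx.1)).symm

lemma eq_zero (h : StepOn F u) (hc : HasCompactSupport u) {x : ℝ} (hx : ∀ z ∈ F, x < z) :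
    u x = 0 := by
  obtain ⟨b, hb⟩ := hc.isCompact.bddBelow
  have h1 : u (min b x - 1) = 0 := by
    by_contra hne
    have := hb (subset_tsupport u (Function.mem_support.2 hne))
    have := min_le_left b x
    linarith
  rw [← h1, eq_comm]
  refine h _ _ (by have := min_le_right b x; linarith) fun z hz hzx => ?_
  exact absurd hzx.2 (not_le.2 (hx z hz))

/-- The function is constant up to a possible jump at `y`, hence monotone up to a sign. -/
lemma eVariationOn_Icc (h : StepOn F u) {x y : ℝ} (hxy : x < y) (hF : ∀ z ∈ F, z < y → z ≤ x) :
    eVariationOn u (Set.Icc x y) = ENNReal.ofReal |u y - u x| := by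
  have hconst : ∀ z, x ≤ z → z < y → u z = u x := by
    intro z h1 h2
    rcases h1.eq_or_lt with rfl | h1
    · rfl
    · exact (h x z h1 fun t ht htz => absurd (hF t ht (htz.2.trans_lt h2)) (not_le.2 htz.1)).symm
  have hx : x ∈ Set.Icc x y := ⟨le_rfl, hxy.le⟩
  have hy : y ∈ Set.Icc x y := ⟨hxy.le, le_rfl⟩
  have mono : ∀ f : ℝ → ℝ, (∀ z, x ≤ z → z < y → f z = f x) → f x ≤ f y →
      eVariationOn f (Set.Icc x y) = ENNReal.ofReal (f y - f x) := by
    intro f hf hle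
    have hm : MonotoneOn f (Set.Icc x y) := by
      intro a ha b hb hab
      rcases hb.2.eq_or_lt with rfl | hby
      · rcases ha.2.eq_or_lt with rfl | hay
        · exact le_rfl
        · rw [hf a ha.1 hay]; exact hle
      · rw [hf b hb.1 hby, hf a ha.1 (hab.trans_lt hby)]
    have := hm.eVariationOn_eq hx hy
    rwa [Set.inter_self] at this
  rcases le_total (u x) (u y) with hle | hle
  · rw [abs_of_nonneg (by linarith)]
    exact mono u hconst hle
  · rw [abs_of_nonpos (by linarith)]
    have h1 := mono (fun z => -u z) (fun z h1 h2 => by rw [hconst z h1 h2]) (by simpa using hle)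
    have h2 : eVariationOn (fun z => -u z) (Set.Icc x y) = eVariationOn u (Set.Icc x y) := by
      simp only [eVariationOn, edist_neg_neg]
    rw [← h2, h1]
    congr 1; ring

end StepOn

namespace WavefrontData

variable {D : WavefrontData}

/-- `𝒲(t_j)` reproduces the profile at time `t_j`. -/
structure Coherent (D : WavefrontData) (j : ℕ) : Prop where
  profile_eq : ∀ x : ℝ, D.profile j x =
    D.ε * ∑ r ∈ (D.realWaves j).filter (fun r => D.wavePos j r ≤ (x : WithTop ℝ)), D.sgn r
  mono : ∀ r ∈ D.realWaves j, ∀ r' ∈ D.realWaves j, r ≤ r' → D.wavePos j r ≤ D.wavePos j r'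
  hatw_eq : ∀ r ∈ D.realWaves j, D.hatw r = D.ε * ∑ q ∈ (D.realWaves j).filter (· ≤ r), D.sgn q
  homogeneous : ∀ r ∈ D.realWaves j, ∀ r' ∈ D.realWaves j,
    D.wavePos j r = D.wavePos j r' → D.sgn r = D.sgn r'

/-! ### The initial data -/

section Initial

variable {F : Finset ℝ}

/-- Induction on the number of break points up to `x`, removing the last one; each jump is a
multiple of `ε`. -/
lemma exists_eVariationOn_eq (hD : D.Admissible) (hF : StepOn F D.w₀) (x : ℝ) :
    ∃ n : ℕ, eVariationOn D.w₀ (Set.Iic x) = ENNReal.ofReal (n * D.ε) := by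
  induction hk : (F.filter (· ≤ x)).card using Nat.strong_induction_on generalizing x with
  | _ k ih =>
  rcases (F.filter (· ≤ x)).eq_empty_or_nonempty with h0 | hne
  · refine ⟨0, ?_⟩
    have hlt : ∀ y ≤ x, ∀ z ∈ F, y < z := by
      intro y hy z hz
      by_contra hcon
      have : z ∈ F.filter (· ≤ x) := Finset.mem_filter.2 ⟨hz, (not_lt.1 hcon).trans hy⟩
      rw [h0] at this
      simp at this
    rw [eVariationOn.constant_on]
    · simp
    · rintro _ ⟨a, ha, rfl⟩ _ ⟨b, hb, rfl⟩
      rw [hF.eq_zero hD.w_support (hlt a ha), hF.eq_zero hD.w_support (hlt b hb)]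
  · set z := (F.filter (· ≤ x)).max' hne with hz
    have hzm := Finset.mem_filter.1 ((F.filter (· ≤ x)).max'_mem hne)
    rw [← hz] at hzm
    obtain ⟨l, hlz, hl⟩ := exists_lt_forall_le F z
    obtain ⟨n, hn⟩ := ih (F.filter (· ≤ l)).card (by
      rw [← hk]
      refine Finset.card_lt_card (Finset.ssubset_iff_subset_ne.2 ⟨fun t ht => ?_, fun hE => ?_⟩)
      · simp only [Finset.mem_filter] at ht ⊢
        exact ⟨ht.1, (ht.2.trans hlz.le).trans hzm.2⟩
      · have : z ∈ F.filter (· ≤ l) := by rw [hE]; exact Finset.mem_filter.2 hzm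
        simp only [Finset.mem_filter] at this
        linarith [this.2]) l rfl
    obtain ⟨m1, hm1⟩ := hD.w_grid z
    obtain ⟨m2, hm2⟩ := hD.w_grid l
    have e1 : eVariationOn D.w₀ (Set.Iic z) =
        eVariationOn D.w₀ (Set.Iic l) + eVariationOn D.w₀ (Set.Icc l z) := by
      rw [← eVariationOn.union D.w₀ isGreatest_Iic (isLeast_Icc hlz.le),
        Set.Iic_union_Icc_eq_Iic hlz.le]
    have e2 : eVariationOn D.w₀ (Set.Iic x) =
        eVariationOn D.w₀ (Set.Iic z) + eVariationOn D.w₀ (Set.Icc z x) := by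
      rw [← eVariationOn.union D.w₀ isGreatest_Iic (isLeast_Icc hzm.2),
        Set.Iic_union_Icc_eq_Iic hzm.2]
    have e3 : eVariationOn D.w₀ (Set.Icc z x) = 0 := by
      apply eVariationOn.constant_on
      have hc : ∀ y ∈ Set.Icc z x, D.w₀ y = D.w₀ z := by
        intro y hy
        rcases hy.1.eq_or_lt with rfl | h1
        · rfl
        · refine (hF z y h1 fun t ht hty => ?_).symm
          have := (F.filter (· ≤ x)).le_max' t (Finset.mem_filter.2 ⟨ht, hty.2.trans hy.2⟩)
          rw [← hz] at this
          exact absurd hty.1 (not_lt.2 this)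
      rintro _ ⟨a, ha, rfl⟩ _ ⟨b, hb, rfl⟩
      rw [hc a ha, hc b hb]
    refine ⟨n + (m1 - m2).natAbs, ?_⟩
    rw [e2, e1, e3, hn, hF.eVariationOn_Icc hlz hl, add_zero, ← ENNReal.ofReal_add, hm1, hm2]
    · congr 1
      rw [← sub_mul, abs_mul, abs_of_pos hD.ε_pos]
      have : (((m1 - m2).natAbs : ℕ) : ℝ) = |(m1 : ℝ) - m2| := by
        rw [Nat.cast_natAbs]; push_cast; rfl
      push_cast
      rw [this]
      ring
    · have := hD.ε_pos; positivity
    · positivity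

lemma exists_totVar_eq (hD : D.Admissible) (hF : StepOn F D.w₀) (x : ℝ) :
    ∃ n : ℕ, D.totVar x = n * D.ε := by
  obtain ⟨n, hn⟩ := exists_eVariationOn_eq hD hF x
  refine ⟨n, ?_⟩
  have := hD.ε_pos
  rw [totVar, hn, ENNReal.toReal_ofReal (by positivity)]

lemma totVar_mono (hD : D.Admissible) (hF : StepOn F D.w₀) {x y : ℝ} (hxy : x ≤ y) :
    D.totVar x ≤ D.totVar y := by
  obtain ⟨n, hn⟩ := exists_eVariationOn_eq hD hF y
  exact ENNReal.toReal_mono (by rw [hn]; exact ENNReal.ofReal_ne_top)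
    (eVariationOn.mono _ (Set.Iic_subset_Iic.2 hxy))

lemma abs_sub_le_totVar (hD : D.Admissible) (hF : StepOn F D.w₀) {x y : ℝ} (hxy : x ≤ y) :
    |D.w₀ y - D.w₀ x| ≤ D.totVar y - D.totVar x := by
  obtain ⟨n, hn⟩ := exists_eVariationOn_eq hD hF y
  obtain ⟨k, hk⟩ := exists_eVariationOn_eq hD hF x
  have e1 : eVariationOn D.w₀ (Set.Iic y) =
      eVariationOn D.w₀ (Set.Iic x) + eVariationOn D.w₀ (Set.Icc x y) := by
    rw [← eVariationOn.union D.w₀ isGreatest_Iic (isLeast_Icc hxy), Set.Iic_union_Icc_eq_Iic hxy]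
  have h1 : ENNReal.ofReal |D.w₀ y - D.w₀ x| ≤ eVariationOn D.w₀ (Set.Icc x y) := by
    have := eVariationOn.edist_le D.w₀ (Set.right_mem_Icc.2 hxy) (Set.left_mem_Icc.2 hxy)
    rwa [edist_dist, Real.dist_eq] at this
  have h2 : ENNReal.ofReal (D.totVar x) + ENNReal.ofReal |D.w₀ y - D.w₀ x| ≤
      ENNReal.ofReal (D.totVar y) := by
    unfold totVar
    rw [ENNReal.ofReal_toReal (by rw [hk]; exact ENNReal.ofReal_ne_top),
      ENNReal.ofReal_toReal (by rw [hn]; exact ENNReal.ofReal_ne_top), e1]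
    gcongr
  have h3 : ∀ z, 0 ≤ D.totVar z := fun z => ENNReal.toReal_nonneg
  rw [← ENNReal.ofReal_add (h3 x) (abs_nonneg _), ENNReal.ofReal_le_ofReal_iff (h3 y)] at h2
  linarith

lemma totVar_step (hD : D.Admissible) (hF : StepOn F D.w₀) {x y : ℝ} (hxy : x < y)
    (hgap : ∀ z ∈ F, z < y → z ≤ x) : D.totVar y = D.totVar x + |D.w₀ y - D.w₀ x| := by
  obtain ⟨k, hk⟩ := exists_eVariationOn_eq hD hF x
  unfold totVar
  rw [← Set.Iic_union_Icc_eq_Iic hxy.le, eVariationOn.union D.w₀ isGreatest_Iic (isLeast_Icc hxy.le),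
    hF.eVariationOn_Icc hxy hgap, ENNReal.toReal_add (by rw [hk]; exact ENNReal.ofReal_ne_top)
    ENNReal.ofReal_ne_top, ENNReal.toReal_ofReal (abs_nonneg _)]

lemma totVar_stepOn (hD : D.Admissible) (hF : StepOn F D.w₀) : StepOn F D.totVar := by
  intro x y hxy hgap
  rw [totVar_step hD hF hxy, hF x y hxy hgap]
  · simp
  · intro z hz hzy
    by_contra hcon
    exact hgap z hz ⟨not_le.1 hcon, hzy.le⟩

lemma totVar_eq_zero (hD : D.Admissible) (hF : StepOn F D.w₀) {x : ℝ} (hx : ∀ z ∈ F, x < z) :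
    D.totVar x = 0 := by
  unfold totVar
  rw [eVariationOn.constant_on]
  · simp
  · rintro _ ⟨a, ha, rfl⟩ _ ⟨b, hb, rfl⟩
    rw [hF.eq_zero hD.w_support (fun z hz => lt_of_le_of_lt ha (hx z hz)),
      hF.eq_zero hD.w_support (fun z hz => lt_of_le_of_lt hb (hx z hz))]

lemma exists_left_of_finset (F : Finset ℝ) (y : ℝ) : ∃ x ≤ y, ∀ z ∈ F, x < z := by
  obtain ⟨b, hb⟩ := F.bddBelow
  refine ⟨min b y - 1, by have := min_le_right b y; linarith, fun z hz => ?_⟩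
  have := hb hz
  have := min_le_left b y
  linarith

lemma w₀_eq_zero_of_totVar (hD : D.Admissible) (hF : StepOn F D.w₀) {x : ℝ}
    (hx : D.totVar x = 0) : D.w₀ x = 0 := by
  obtain ⟨x', hx'x, hx'⟩ := exists_left_of_finset F x
  have h1 := abs_sub_le_totVar hD hF hx'x
  rw [hx, totVar_eq_zero hD hF hx', hF.eq_zero hD.w_support hx', sub_zero, sub_zero] at h1
  exact abs_nonpos_iff.1 h1

lemma mem_waves_iff (hD : D.Admissible) (hF : StepOn F D.w₀) {s : ℕ} :
    s ∈ D.waves ↔ 1 ≤ s ∧ ∃ x, D.ε * s ≤ D.totVar x := by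
  obtain ⟨b, hb⟩ := F.bddAbove
  have hconst : ∀ y, b ≤ y → D.w₀ y = D.w₀ b := by
    intro y hy
    rcases hy.eq_or_lt with rfl | hy
    · rfl
    · exact (hF b y hy fun z hz hzy => absurd (hb hz) (not_le.2 hzy.1)).symm
  have htot : (eVariationOn D.w₀ Set.univ).toReal = D.totVar b := by
    unfold totVar
    rw [← Set.Iic_union_Ici (a := b), eVariationOn.union D.w₀ isGreatest_Iic isLeast_Ici,
      eVariationOn.constant_on (s := Set.Ici b), add_zero]
    rintro _ ⟨x, hx, rfl⟩ _ ⟨y, hy, rfl⟩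
    rw [hconst x hx, hconst y hy]
  have hε := hD.ε_pos
  have hmax : ∀ x, D.totVar x ≤ D.totVar b := by
    intro x
    rcases le_total x b with h | h
    · exact totVar_mono hD hF h
    · rcases h.eq_or_lt with rfl | h
      · exact le_rfl
      · exact (totVar_stepOn hD hF b x h fun z hz hzy => absurd (hb hz) (not_le.2 hzy.1)).ge
  obtain ⟨N, hN⟩ := exists_totVar_eq hD hF b
  rw [waves, htot, Finset.mem_Icc, hN, mul_div_assoc, div_self hε.ne', mul_one, Nat.floor_natCast]
  refine and_congr_right fun _ => ⟨fun h => ⟨b, ?_⟩, fun ⟨x, hx⟩ => ?_⟩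
  · rw [hN, mul_comm]
    have : (s : ℝ) ≤ N := by exact_mod_cast h
    gcongr
  · have := hx.trans (hmax x)
    rw [hN, mul_comm] at this
    exact_mod_cast le_of_mul_le_mul_right this hε

/-- The infimum is attained because the total variation is a right continuous step function. -/
lemma isLeast_initialPos (hD : D.Admissible) (hF : StepOn F D.w₀) {s : ℕ} (hs : s ∈ D.waves) :
    IsLeast {x : ℝ | D.ε * s ≤ D.totVar x} (D.initialPos s) := by
  obtain ⟨h1, x0, hx0⟩ := (mem_waves_iff hD hF).1 hs
  have hε := hD.ε_pos
  have hs0 : (0 : ℝ) < D.ε * s := by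
    have : (0 : ℝ) < s := by exact_mod_cast h1
    positivity
  set A := {x : ℝ | D.ε * s ≤ D.totVar x} with hA
  have hbdd : BddBelow A := by
    obtain ⟨x', _, hx'⟩ := exists_left_of_finset F 0
    refine ⟨x', fun x hx => ?_⟩
    by_contra hcon
    have h2 := totVar_mono hD hF (not_le.1 hcon).le
    rw [totVar_eq_zero hD hF hx'] at h2
    have : D.ε * s ≤ D.totVar x := hx
    linarith
  refine ⟨?_, fun x hx => csInf_le hbdd hx⟩
  obtain ⟨u, hu, hgap⟩ := exists_gt_forall_le F (D.initialPos s)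
  obtain ⟨x, hxA, hxu⟩ := exists_lt_of_csInf_lt ⟨x0, hx0⟩ (show sInf A < u from hu)
  have hle : D.initialPos s ≤ x := csInf_le hbdd hxA
  rcases hle.eq_or_lt with h | h
  · rw [h]; exact hxA
  · have := totVar_stepOn hD hF _ _ h fun z hz hzx =>
      absurd (hgap z hz hzx.1) (not_lt.2 (hzx.2.trans hxu.le))
    change D.ε * s ≤ D.totVar (D.initialPos s)
    rw [this]
    exact hxA

/-- The jump that carries `s`, seen from a point `x` just before it, where the left limits are
attained; `k` is the number of waves located before the jump. -/
lemma exists_before_initialPos (hD : D.Admissible) (hF : StepOn F D.w₀) {s : ℕ} (hs : s ∈ D.waves) :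
    ∃ x < D.initialPos s, ∃ k : ℕ, k + 1 ≤ s ∧ D.totVar x = k * D.ε ∧
      Function.leftLim D.w₀ (D.initialPos s) = D.w₀ x ∧
      Function.leftLim D.totVar (D.initialPos s) = D.totVar x ∧
      (∀ y < D.initialPos s, D.totVar y ≤ D.totVar x) ∧
      D.totVar (D.initialPos s) = D.totVar x + |D.w₀ (D.initialPos s) - D.w₀ x| ∧
      D.w₀ (D.initialPos s) ≠ D.w₀ x := by
  obtain ⟨x, hx, hgap⟩ := exists_lt_forall_le F (D.initialPos s)
  obtain ⟨k, hk⟩ := exists_totVar_eq hD hF x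
  have hl := isLeast_initialPos hD hF hs
  have hstep := totVar_step hD hF hx hgap
  have hlt : D.totVar x < D.ε * s := by
    by_contra hcon
    exact absurd (hl.2 (not_lt.1 hcon)) (not_le.2 hx)
  refine ⟨x, hx, k, ?_, hk, hF.leftLim_eq hx hgap, (totVar_stepOn hD hF).leftLim_eq hx hgap,
    fun y hy => ?_, hstep, fun heq => ?_⟩
  · rw [hk, mul_comm] at hlt
    have := lt_of_mul_lt_mul_left hlt hD.ε_pos.le
    exact_mod_cast this
  · rcases le_or_gt y x with h | h
    · exact totVar_mono hD hF h
    · refine (totVar_stepOn hD hF x y h fun z hz hzy => ?_).ge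
      exact absurd (hgap z hz (hzy.2.trans_lt hy)) (not_le.2 hzy.1)
  · rw [heq, sub_self, abs_zero, add_zero] at hstep
    have : D.ε * s ≤ D.totVar (D.initialPos s) := hl.1
    linarith

lemma sgn_eq_one_or (hD : D.Admissible) {s : ℕ} (hs : s ∈ D.waves) :
    D.sgn s = 1 ∨ D.sgn s = -1 := by
  obtain ⟨F, hF⟩ := hD.w_step
  obtain ⟨x, -, k, -, -, h1, -, -, -, hne⟩ := exists_before_initialPos hD hF hs
  unfold sgn
  rw [h1]
  rcases lt_or_gt_of_ne (sub_ne_zero.2 hne) with h | h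
  · exact Or.inr (Real.sign_of_neg h)
  · exact Or.inl (Real.sign_of_pos h)

lemma real_sign_mul_abs (x : ℝ) : Real.sign x * |x| = x := by
  rcases lt_trichotomy x 0 with h | rfl | h
  · rw [Real.sign_of_neg h, abs_of_neg h]; ring
  · simp
  · rw [Real.sign_of_pos h, abs_of_pos h]; ring

/-- There is no variation between the position of the wave `n` and `x`, and the last wave of a jump
ends at the right state of the jump. -/
lemma w₀_eq_hatw (hD : D.Admissible) (hF : StepOn F D.w₀) {n : ℕ} (hn : 1 ≤ n) {x : ℝ}
    (hx : D.totVar x = n * D.ε) : n ∈ D.waves ∧ D.w₀ x = D.hatw n := by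
  have hw : n ∈ D.waves := (mem_waves_iff hD hF).2 ⟨hn, x, by rw [hx, mul_comm]⟩
  refine ⟨hw, ?_⟩
  have hl := isLeast_initialPos hD hF hw
  have hyx : D.initialPos n ≤ x := hl.2 (show D.ε * n ≤ D.totVar x by rw [hx, mul_comm])
  have h1 : D.ε * n ≤ D.totVar (D.initialPos n) := hl.1
  have h2 := totVar_mono hD hF hyx
  have h3 : D.totVar (D.initialPos n) = n * D.ε := by linarith
  have h4 := abs_sub_le_totVar hD hF hyx
  rw [hx, h3, sub_self] at h4
  have h5 : D.w₀ x = D.w₀ (D.initialPos n) := sub_eq_zero.1 (abs_nonpos_iff.1 h4)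
  obtain ⟨x', -, k, -, -, e1, e2, -, e3, -⟩ := exists_before_initialPos hD hF hw
  rw [h5, hatw, sgn, e1, e2, mul_comm D.ε, ← h3, e3, add_sub_cancel_left, real_sign_mul_abs]
  ring

/-- Either `s + 1` opens a new jump, whose left state is where the wave `s` ended (`0` if there is
none), or both waves lie in the same jump. -/
lemma hatw_succ (hD : D.Admissible) (hF : StepOn F D.w₀) {s : ℕ} (hs : s + 1 ∈ D.waves) :
    D.hatw (s + 1) = (if s = 0 then 0 else D.hatw s) + D.sgn (s + 1) * D.ε := by
  obtain ⟨x, hx, k, hk, hkx, e1, e2, e3, e4, -⟩ := exists_before_initialPos hD hF hs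
  have hl := isLeast_initialPos hD hF hs
  have hε := hD.ε_pos
  rcases (Nat.le_of_succ_le_succ hk).eq_or_lt with rfl | hlt
  · have h1 : D.w₀ x = if k = 0 then 0 else D.hatw k := by
      split_ifs with h0
      · exact w₀_eq_zero_of_totVar hD hF (by rw [hkx, h0]; simp)
      · exact (w₀_eq_hatw hD hF (by omega) hkx).2
    rw [hatw, e1, e2, hkx, h1]
    push_cast
    ring
  · have hs' : s ∈ D.waves := by
      obtain ⟨h1, y, hy⟩ := (mem_waves_iff hD hF).1 hs
      refine (mem_waves_iff hD hF).2 ⟨by omega, y, le_trans ?_ hy⟩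
      push_cast
      nlinarith
    have hpos : D.initialPos s = D.initialPos (s + 1) := by
      refine (isLeast_initialPos hD hF hs').unique ⟨?_, fun y hy => ?_⟩
      · have : D.ε * ((s + 1 : ℕ) : ℝ) ≤ D.totVar (D.initialPos (s + 1)) := hl.1
        push_cast at this
        change D.ε * s ≤ _
        nlinarith
      · by_contra hcon
        have h1 := e3 y (not_le.1 hcon)
        have h2 : D.ε * s ≤ D.totVar y := hy
        have h3 : (k : ℝ) < s := by exact_mod_cast hlt
        rw [hkx] at h1
        nlinarith
    rw [if_neg (by omega), hatw, hatw, sgn, sgn, hpos]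
    push_cast
    ring

lemma mem_waves_of_le {s s' : ℕ} (hs : s ∈ D.waves) (h1 : 1 ≤ s')
    (h : s' ≤ s) : s' ∈ D.waves := by
  simp only [waves, Finset.mem_Icc] at hs ⊢
  omega

lemma hatw_eq_sum (hD : D.Admissible) (hF : StepOn F D.w₀) {s : ℕ} (hs : s ∈ D.waves) :
    D.hatw s = D.ε * ∑ q ∈ Finset.Icc 1 s, D.sgn q := by
  induction s with
  | zero => simp [waves] at hs
  | succ s ih =>
    rw [hatw_succ hD hF hs, Finset.sum_Icc_succ_top (by omega)]
    rcases Nat.eq_zero_or_pos s with rfl | hpos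
    · simp [mul_comm]
    · rw [if_neg hpos.ne', ih (mem_waves_of_le hs hpos (Nat.le_succ s))]
      ring

lemma waves_filter_le {n : ℕ} (hn : n = 0 ∨ n ∈ D.waves) :
    D.waves.filter (· ≤ n) = Finset.Icc 1 n := by
  ext q
  simp only [Finset.mem_filter, Finset.mem_Icc]
  constructor
  · rintro ⟨h1, h2⟩
    simp only [waves, Finset.mem_Icc] at h1
    exact ⟨h1.1, h2⟩
  · rintro ⟨h1, h2⟩
    rcases hn with rfl | hn
    · omega
    · exact ⟨mem_waves_of_le hn h1 h2, h2⟩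

lemma realWaves_zero : D.realWaves 0 = D.waves := by
  unfold realWaves
  refine Finset.filter_true_of_mem fun s hs => ?_
  simp [wavePos, hs]

lemma wavePos_zero {s : ℕ} (hs : s ∈ D.waves) : D.wavePos 0 s = (D.initialPos s : WithTop ℝ) := by
  simp [wavePos, hs]

lemma initialPos_le_iff (hD : D.Admissible) (hF : StepOn F D.w₀) {s : ℕ} (hs : s ∈ D.waves)
    {x : ℝ} : D.initialPos s ≤ x ↔ D.ε * s ≤ D.totVar x := by
  have hl := isLeast_initialPos hD hF hs
  exact ⟨fun h => le_trans hl.1 (totVar_mono hD hF h), fun h => hl.2 h⟩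

/-- Base of the induction on collisions. If the total variation up to `x` is `n ε`, the waves up to
`x` are `1, …, n`, and their signs add up to `w₀ x / ε`. -/
theorem coherent_zero (hD : D.Admissible) : D.Coherent 0 := by
  obtain ⟨F, hF⟩ := hD.w_step
  have hε := hD.ε_pos
  rw [show (∀ x y : ℝ, x < y → (∀ z ∈ F, z ∉ Set.Ioc x y) → D.w₀ x = D.w₀ y) = StepOn F D.w₀ from rfl]
    at hF
  refine ⟨fun x => ?_, fun r hr r' hr' hle => ?_, fun r hr => ?_, fun r hr r' hr' heq => ?_⟩
  · obtain ⟨n, hn⟩ := exists_totVar_eq hD hF x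
    have h1 : (D.realWaves 0).filter (fun r => D.wavePos 0 r ≤ (x : WithTop ℝ)) =
        D.waves.filter (· ≤ n) := by
      rw [realWaves_zero]
      refine Finset.filter_congr fun s hs => ?_
      rw [wavePos_zero hs, WithTop.coe_le_coe, initialPos_le_iff hD hF hs, hn, mul_comm]
      rw [mul_le_mul_iff_left₀ hε, Nat.cast_le]
    rw [h1]
    change D.w₀ x = _
    rcases Nat.eq_zero_or_pos n with rfl | hpos
    · rw [waves_filter_le (Or.inl rfl), w₀_eq_zero_of_totVar hD hF (by simpa using hn)]
      simp
    · obtain ⟨hw, he⟩ := w₀_eq_hatw hD hF hpos hn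
      rw [waves_filter_le (Or.inr hw), he, hatw_eq_sum hD hF hw]
  · rw [realWaves_zero] at hr hr'
    rw [wavePos_zero hr, wavePos_zero hr', WithTop.coe_le_coe, initialPos_le_iff hD hF hr]
    have h1 : (r : ℝ) ≤ r' := by exact_mod_cast hle
    refine le_trans ?_ (isLeast_initialPos hD hF hr').1
    gcongr
  · rw [realWaves_zero] at hr ⊢
    rw [waves_filter_le (Or.inr hr), hatw_eq_sum hD hF hr]
  · rw [realWaves_zero] at hr hr'
    rw [wavePos_zero hr, wavePos_zero hr', WithTop.coe_inj] at heq
    rw [sgn, sgn, heq]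

/-- The segment of a wave lies between two values of the initial datum. -/
lemma exists_hatw_mem_uIcc (hD : D.Admissible) {s : ℕ} (hs : s ∈ D.waves) :
    ∃ x y, D.hatw s ∈ Set.uIcc (D.w₀ x) (D.w₀ y) ∧
      D.hatw s - D.sgn s * D.ε ∈ Set.uIcc (D.w₀ x) (D.w₀ y) := by
  obtain ⟨F, hF⟩ := hD.w_step
  have hε := hD.ε_pos
  obtain ⟨x, hx, k, hk, hkx, e1, e2, e3, e4, hne⟩ := exists_before_initialPos hD hF hs
  have hl : D.ε * s ≤ D.totVar (D.initialPos s) := (isLeast_initialPos hD hF hs).1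
  have hk' : (k : ℝ) + 1 ≤ s := by exact_mod_cast hk
  refine ⟨x, D.initialPos s, ?_⟩
  rw [hatw, sgn, e1, e2, Set.mem_uIcc, Set.mem_uIcc]
  rw [e4, hkx] at hl
  rw [hkx]
  rcases lt_or_gt_of_ne (sub_ne_zero.2 hne) with h | h
  · rw [Real.sign_of_neg h]
    rw [abs_of_neg h] at hl
    constructor <;> right <;> constructor <;> nlinarith
  · rw [Real.sign_of_pos h]
    rw [abs_of_pos h] at hl
    constructor <;> left <;> constructor <;> nlinarith

lemma exists_hatw_eq (hD : D.Admissible) {s : ℕ} (hs : s ∈ D.waves) : ∃ m : ℤ, D.hatw s = m * D.ε := by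
  obtain ⟨F, hF⟩ := hD.w_step
  rw [hatw_eq_sum hD hF hs]
  have : ∀ n, (n = 0 ∨ n ∈ D.waves) → ∃ m : ℤ, ∑ q ∈ Finset.Icc 1 n, D.sgn q = m := by
    intro n
    induction n with
    | zero => intro _; exact ⟨0, by simp⟩
    | succ n ih =>
      intro hn
      have hn : n + 1 ∈ D.waves := by simpa using hn
      obtain ⟨m, hm⟩ := ih (by
        rcases Nat.eq_zero_or_pos n with h | h
        · exact Or.inl h
        · exact Or.inr (mem_waves_of_le hn h (Nat.le_succ n)))
      rw [Finset.sum_Icc_succ_top (by omega), hm]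
      rcases sgn_eq_one_or hD hn with h | h
      · exact ⟨m + 1, by rw [h]; push_cast; ring⟩
      · exact ⟨m - 1, by rw [h]; push_cast; ring⟩
  obtain ⟨m, hm⟩ := this s (Or.inr hs)
  exact ⟨m, by rw [hm, mul_comm]⟩

end Initial

end WavefrontData

/-! ### Real waves, their positions and the profile at a collision time. -/

lemma IsEnvelope.congr {K : Finset ℕ} {d e e' : ℕ → ℝ} (h : IsEnvelope K d e)
    (he : ∀ p ∈ K, e' p = e p) : IsEnvelope K d e' where
  mono p hp q hq hpq := by rw [he p hp, he q hq]; exact h.mono p hp q hq hpq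
  prefix_nonneg n := by
    rw [Finset.sum_congr rfl fun q hq => by rw [he q (Finset.mem_filter.1 hq).1]]
    exact h.prefix_nonneg n
  level c := by
    rw [Finset.filter_congr fun q hq => by rw [he q hq],
      Finset.sum_congr rfl fun q hq => by rw [he q (Finset.mem_filter.1 hq).1]]
    exact h.level c

namespace WavefrontData

variable {D : WavefrontData}

/-- The position of a real wave, as a real number. -/
def pos (D : WavefrontData) (j r : ℕ) : ℝ := (D.wavePos j r).untopD 0

/-- The value of `v` at the position of a wave. -/
def waveV (D : WavefrontData) (j r : ℕ) : ℝ := D.v (D.time j) (D.pos j r)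

lemma mem_realWaves {j r : ℕ} : r ∈ D.realWaves j ↔ r ∈ D.waves ∧ D.wavePos j r ≠ ⊤ := by
  simp [realWaves]

lemma mem_waves_of_mem_realWaves {j r : ℕ} (h : r ∈ D.realWaves j) : r ∈ D.waves :=
  (mem_realWaves.1 h).1

lemma wavePos_eq_coe {j r : ℕ} (h : r ∈ D.realWaves j) : D.wavePos j r = (D.pos j r : WithTop ℝ) := by
  obtain ⟨x, hx⟩ := WithTop.ne_top_iff_exists.1 (mem_realWaves.1 h).2
  rw [pos, ← hx]
  rfl

lemma pos_eq_of_wavePos_eq {j r : ℕ} {y : ℝ} (h : D.wavePos j r = (y : WithTop ℝ)) :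
    D.pos j r = y := by
  rw [pos, h]; rfl

lemma wavePos_eq_iff {j r r' : ℕ} (h : r ∈ D.realWaves j) (h' : r' ∈ D.realWaves j) :
    D.wavePos j r = D.wavePos j r' ↔ D.pos j r = D.pos j r' := by
  rw [wavePos_eq_coe h, wavePos_eq_coe h', WithTop.coe_inj]

lemma wavesAt_eq (j : ℕ) (y : ℝ) :
    D.wavesAt j (y : WithTop ℝ) = (D.realWaves j).filter (D.pos j · = y) := by
  ext r
  simp only [wavesAt, Finset.mem_filter]
  constructor
  · rintro ⟨h1, h2⟩
    exact ⟨mem_realWaves.2 ⟨h1, by rw [h2]; exact WithTop.coe_ne_top⟩, pos_eq_of_wavePos_eq h2⟩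
  · rintro ⟨h1, h2⟩
    exact ⟨mem_waves_of_mem_realWaves h1, by rw [wavePos_eq_coe h1, h2]⟩

lemma mem_wavesAt {j r : ℕ} {y : ℝ} :
    r ∈ D.wavesAt j (y : WithTop ℝ) ↔ r ∈ D.realWaves j ∧ D.pos j r = y := by
  rw [wavesAt_eq, Finset.mem_filter]

lemma waveSpeed_eq {j r : ℕ} (h : r ∈ D.realWaves j) :
    D.waveSpeed j r = D.entropicSpeed (fun z => D.f z (D.waveV j r))
      (D.wavesAt j (D.pos j r : WithTop ℝ)) r := by
  rw [waveSpeed, speedFrom, ← wavePos_eq_coe h]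
  rfl

namespace Coherent

variable {j : ℕ}

lemma profile_eq_sum (h : D.Coherent j) (x : ℝ) :
    D.profile j x = D.ε * ∑ r ∈ (D.realWaves j).filter (D.pos j · ≤ x), D.sgn r := by
  rw [h.profile_eq]
  congr 1
  refine Finset.sum_congr (Finset.filter_congr fun r hr => ?_) fun _ _ => rfl
  rw [wavePos_eq_coe hr, WithTop.coe_le_coe]

lemma pos_mono (h : D.Coherent j) {r r' : ℕ} (hr : r ∈ D.realWaves j) (hr' : r' ∈ D.realWaves j)
    (hle : r ≤ r') : D.pos j r ≤ D.pos j r' := by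
  have := h.mono r hr r' hr' hle
  rwa [wavePos_eq_coe hr, wavePos_eq_coe hr', WithTop.coe_le_coe] at this

lemma lt_of_pos_lt (h : D.Coherent j) {r r' : ℕ} (hr : r ∈ D.realWaves j)
    (hr' : r' ∈ D.realWaves j) (hlt : D.pos j r < D.pos j r') : r < r' := by
  by_contra hcon
  exact absurd (h.pos_mono hr' hr (not_lt.1 hcon)) (not_le.2 hlt)

lemma leftLim_profile (h : D.Coherent j) (y : ℝ) :
    Function.leftLim (D.profile j) y =
      D.ε * ∑ r ∈ (D.realWaves j).filter (D.pos j · < y), D.sgn r := by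
  obtain ⟨l, hl, hgap⟩ := exists_lt_forall_le ((D.realWaves j).image (D.pos j)) y
  refine leftLim_eq_of_forall hl fun x hlx hxy => ?_
  rw [h.profile_eq_sum]
  congr 1
  refine Finset.sum_congr (Finset.filter_congr fun r hr => ?_) fun _ _ => rfl
  exact ⟨fun hx => hx.trans_lt hxy, fun hy =>
    (hgap _ (Finset.mem_image_of_mem _ hr) hy).trans hlx.le⟩

lemma profile_sub_leftLim (h : D.Coherent j) (y : ℝ) :
    D.profile j y - Function.leftLim (D.profile j) y =
      D.ε * ∑ r ∈ D.wavesAt j (y : WithTop ℝ), D.sgn r := by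
  rw [h.profile_eq_sum, h.leftLim_profile, wavesAt_eq, ← mul_sub]
  congr 1
  rw [sub_eq_iff_eq_add', ← Finset.sum_union]
  · refine Finset.sum_congr ?_ fun _ _ => rfl
    ext r; simp only [Finset.mem_filter, Finset.mem_union, le_iff_lt_or_eq]; tauto
  · rw [Finset.disjoint_left]
    intro r hr hr'
    simp only [Finset.mem_filter] at hr hr'
    exact hr.2.ne hr'.2

lemma sgn_eq_of_pos_eq (h : D.Coherent j) {r r' : ℕ} (hr : r ∈ D.realWaves j)
    (hr' : r' ∈ D.realWaves j) (he : D.pos j r = D.pos j r') : D.sgn r = D.sgn r' :=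
  h.homogeneous r hr r' hr' ((wavePos_eq_iff hr hr').2 he)

/-- Homogeneous intervals of real waves have adjacent segments. -/
lemma isContiguous (hD : D.Admissible) (h : D.Coherent j) {K : Finset ℕ} (hK : K ⊆ D.realWaves j)
    (hconv : ∀ r ∈ D.realWaves j, ∀ a ∈ K, ∀ b ∈ K, a ≤ r → r ≤ b → r ∈ K)
    (hhom : ∀ a ∈ K, ∀ b ∈ K, D.sgn a = D.sgn b) {a : ℕ} (ha : a ∈ K) :
    ∃ m : ℤ, D.IsContiguous K (D.sgn a) m ∧ (m : ℝ) * D.ε =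
      D.ε * ∑ q ∈ (D.realWaves j).filter (fun r => ∀ p ∈ K, r < p), D.sgn q := by
  have hsg := sgn_eq_one_or hD (mem_waves_of_mem_realWaves (hK ha))
  set B := ∑ q ∈ (D.realWaves j).filter (fun r => ∀ p ∈ K, r < p), D.sgn q with hB
  -- The waves up to `p` are those before `K`, which contribute the fixed amount `B`, and the first
  -- ones of `K`.
  have hat : ∀ p ∈ K, D.hatw p = D.ε * (B + D.sgn a * rankIn K p) := by
    intro p hp
    have hset : (D.realWaves j).filter (· ≤ p) =
        (D.realWaves j).filter (fun r => ∀ p ∈ K, r < p) ∪ K.filter (· ≤ p) := by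
      ext r
      simp only [Finset.mem_filter, Finset.mem_union]
      constructor
      · rintro ⟨h1, h2⟩
        by_cases h3 : ∀ p ∈ K, r < p
        · exact Or.inl ⟨h1, h3⟩
        · push Not at h3
          obtain ⟨q, hq, hqr⟩ := h3
          exact Or.inr ⟨hconv r h1 q hq p hp hqr h2, h2⟩
      · rintro (⟨h1, h2⟩ | ⟨h1, h2⟩)
        · exact ⟨h1, (h2 p hp).le⟩
        · exact ⟨hK h1, h2⟩
    rw [h.hatw_eq p (hK hp), hset, Finset.sum_union]
    · congr 1
      rw [← hB, Finset.sum_congr rfl (fun q hq => hhom q (Finset.mem_filter.1 hq).1 a ha),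
        Finset.sum_const, nsmul_eq_mul, mul_comm, rankIn]
    · rw [Finset.disjoint_left]
      intro r hr hr'
      simp only [Finset.mem_filter] at hr hr'
      exact (hr.2 r hr'.1).ne rfl
  obtain ⟨m, hm⟩ := exists_hatw_eq hD (mem_waves_of_mem_realWaves (hK ha))
  have hε := hD.ε_pos
  rw [hat a ha, mul_comm] at hm
  have hm' := mul_right_cancel₀ hε.ne' hm
  -- `B` differs by a rank from the grid index of a wave, so it is an integer.
  have key : ∃ m' : ℤ, (m' : ℝ) = B := by
    rcases hsg with h1 | h1
    · exact ⟨m - rankIn K a, by push_cast; rw [← hm', h1]; ring⟩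
    · exact ⟨m + rankIn K a, by push_cast; rw [← hm', h1]; ring⟩
  obtain ⟨m', hm'⟩ := key
  refine ⟨m', ⟨hsg, fun p hp => hhom p hp a ha, fun p hp => ?_⟩, ?_⟩
  · rw [hat p hp, hm', mul_comm]
  · rw [hm', mul_comm]

/-- Identifies the Riemann problem of the profile at a point with that of the waves sitting there:
same left state, same right state. -/
lemma isContiguous_wavesAt (hD : D.Admissible) (h : D.Coherent j) {a : ℕ}
    (ha : a ∈ D.realWaves j) :
    ∃ m : ℤ, D.IsContiguous (D.wavesAt j (D.pos j a : WithTop ℝ)) (D.sgn a) m ∧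
      Function.leftLim (D.profile j) (D.pos j a) = m * D.ε ∧
      D.profile j (D.pos j a) =
        (m + D.sgn a * (D.wavesAt j (D.pos j a : WithTop ℝ)).card) * D.ε := by
  set K := D.wavesAt j (D.pos j a : WithTop ℝ) with hK
  have haK : a ∈ K := mem_wavesAt.2 ⟨ha, rfl⟩
  have hhom : ∀ p ∈ K, ∀ q ∈ K, D.sgn p = D.sgn q := fun p hp q hq =>
    h.sgn_eq_of_pos_eq (mem_wavesAt.1 hp).1 (mem_wavesAt.1 hq).1
      ((mem_wavesAt.1 hp).2.trans (mem_wavesAt.1 hq).2.symm)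
  obtain ⟨m, hm, hB⟩ := h.isContiguous hD (K := K) (fun p hp => (mem_wavesAt.1 hp).1)
    (fun r hr p hp q hq h1 h2 => by
      rw [mem_wavesAt] at hp hq ⊢
      refine ⟨hr, le_antisymm ?_ ?_⟩
      · rw [← hq.2]; exact h.pos_mono hr hq.1 h2
      · rw [← hp.2]; exact h.pos_mono hp.1 hr h1) hhom haK
  have hleft : Function.leftLim (D.profile j) (D.pos j a) = m * D.ε := by
    rw [hB, h.leftLim_profile]
    congr 1
    refine Finset.sum_congr (Finset.filter_congr fun r hr => ?_) fun _ _ => rfl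
    constructor
    · intro hlt p hp
      rw [mem_wavesAt] at hp
      exact h.lt_of_pos_lt hr hp.1 (by rw [hp.2]; exact hlt)
    · intro hall
      refine lt_of_le_of_ne (h.pos_mono hr ha (hall a haK).le) fun he => ?_
      exact (hall r (mem_wavesAt.2 ⟨hr, he⟩)).ne rfl
  refine ⟨m, hm, hleft, ?_⟩
  have h1 := h.profile_sub_leftLim (D.pos j a)
  rw [hleft, ← hK, Finset.sum_congr rfl (fun q hq => hhom q hq a haK), Finset.sum_const,
    nsmul_eq_mul] at h1
  linarith

/-- The speeds of the waves at a point are the slopes of an envelope. -/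
lemma isEnvelope_waveSpeed (hD : D.Admissible) (h : D.Coherent j) (y : ℝ) :
    IsEnvelope (D.wavesAt j (y : WithTop ℝ)) (D.cellSlope fun z => D.f z (D.v (D.time j) y))
      (D.waveSpeed j) := by
  rcases (D.wavesAt j (y : WithTop ℝ)).eq_empty_or_nonempty with h0 | ⟨a, ha⟩
  · rw [h0]
    exact ⟨fun p hp => by simp at hp, by simp, by simp⟩
  obtain ⟨ha', rfl⟩ := mem_wavesAt.1 ha
  obtain ⟨m, hm, -, -⟩ := h.isContiguous_wavesAt hD ha'
  refine (hm.isEnvelope hD.ε_pos _).congr fun p hp => ?_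
  obtain ⟨hp, hpa⟩ := mem_wavesAt.1 hp
  rw [waveSpeed_eq hp, waveV, hpa]

lemma waveSpeed_mono (hD : D.Admissible) (h : D.Coherent j) {r r' : ℕ} (hr : r ∈ D.realWaves j)
    (hr' : r' ∈ D.realWaves j) (he : D.pos j r = D.pos j r') (hle : r ≤ r') :
    D.waveSpeed j r ≤ D.waveSpeed j r' :=
  (h.isEnvelope_waveSpeed hD (D.pos j r)).mono r (mem_wavesAt.2 ⟨hr, rfl⟩) r'
    (mem_wavesAt.2 ⟨hr', he.symm⟩) hle

end Coherent

/-! ### Separation of the speeds of the two families. -/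

/-- Mean value theorem on the cell, which lies between two values of `w₀` and hence in the order
connected set on which hyperbolicity is assumed. -/
lemma hyperbolic_slope (hD : D.Admissible) {p : ℕ} (hp : p ∈ D.waves) (x : ℝ) :
    -1 < D.cellSlope (fun z => D.f z (D.v₀ x)) p := by
  obtain ⟨U, -, V, -, hU, -, hw, hv, hf⟩ := hD.hyperbolic
  have hε := hD.ε_pos
  have hdiff : Differentiable ℝ (fun z => D.f z (D.v₀ x)) := by
    have h1 := hD.smooth.differentiable (by norm_num)
    exact h1.comp (f := fun z : ℝ => ((z, D.v₀ x) : ℝ × ℝ)) (by fun_prop)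
  obtain ⟨a, b, h1, h2⟩ := exists_hatw_mem_uIcc hD hp
  have hsub := hU.uIcc_subset (hw a) (hw b)
  have main : ∀ lo, lo ∈ U → lo + D.ε ∈ U →
      -1 < (D.f (lo + D.ε) (D.v₀ x) - D.f lo (D.v₀ x)) / D.ε := by
    intro lo hlo hhi
    obtain ⟨c, hc, hc'⟩ := exists_deriv_eq_slope (fun z => D.f z (D.v₀ x))
      (show lo < lo + D.ε by linarith) hdiff.continuous.continuousOn hdiff.differentiableOn
    rw [add_sub_cancel_left] at hc'
    rw [← hc']
    exact hf c (hU.out hlo hhi ⟨hc.1.le, hc.2.le⟩) _ (hv x)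
  rcases sgn_eq_one_or hD hp with hs | hs
  · have := main (D.hatw p - D.ε) (hsub (by rw [hs, one_mul] at h2; exact h2))
      (by rw [sub_add_cancel]; exact hsub h1)
    rw [sub_add_cancel] at this
    rw [cellSlope, hs, one_mul, one_mul]
    exact this
  · have := main (D.hatw p) (hsub h1) (by
      rw [hs] at h2
      have : D.hatw p + D.ε = D.hatw p - -1 * D.ε := by ring
      rw [this]; exact hsub h2)
    rw [cellSlope, hs]
    have e : D.hatw p - -1 * D.ε = D.hatw p + D.ε := by ring
    rw [e]
    have e2 : -1 * (D.f (D.hatw p) (D.v₀ x) - D.f (D.hatw p + D.ε) (D.v₀ x)) / D.ε =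
      (D.f (D.hatw p + D.ε) (D.v₀ x) - D.f (D.hatw p) (D.v₀ x)) / D.ε := by ring
    rw [e2]
    exact this

namespace Coherent

variable {j : ℕ}

/-- The families cannot be confused, and `x + t`, the argument of `v₀`, increases along every wave.
-/
lemma neg_one_lt_waveSpeed (hD : D.Admissible) (h : D.Coherent j) {r : ℕ}
    (hr : r ∈ D.realWaves j) : -1 < D.waveSpeed j r := by
  obtain ⟨q, hq, hle⟩ := (h.isEnvelope_waveSpeed hD (D.pos j r)).exists_le
    (mem_wavesAt.2 ⟨hr, rfl⟩)
  exact (hyperbolic_slope hD (mem_waves_of_mem_realWaves (mem_wavesAt.1 hq).1) _).trans_le hle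

end Coherent

/-! ### Wavefronts and evolution in terms of waves. -/

/-- The grid cell occupied by a wave. -/
lemma IsContiguous.exists_cell (hε : 0 < D.ε) {K : Finset ℕ} {S : ℝ} {m : ℤ}
    (h : D.IsContiguous K S m) {p : ℕ} (hp : p ∈ K) :
    ∃ c : ℤ, D.cellLeft p = c * D.ε ∧ IsCellBetween D.ε (m * D.ε) ((m + S * K.card) * D.ε) c := by
  have h1 : (1 : ℝ) ≤ rankIn K p := by exact_mod_cast rankIn_pos hp
  have h2 : (rankIn K p : ℝ) ≤ K.card := by exact_mod_cast rankIn_le_card K p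
  have hc : (0 : ℝ) ≤ K.card := Nat.cast_nonneg _
  rcases h.sign with rfl | rfl
  · refine ⟨m + rankIn K p - 1, ?_, ?_, ?_⟩
    · rw [cellLeft, h.sgn_eq p hp, if_pos one_pos, h.hatw_eq p hp]; push_cast; ring
    · refine (min_le_left _ _).trans ?_; push_cast; nlinarith
    · refine le_trans ?_ (le_max_right _ _); push_cast; nlinarith
  · have hn : ¬ (0 : ℝ) < -1 := by norm_num
    refine ⟨m - rankIn K p, ?_, ?_, ?_⟩
    · rw [cellLeft, h.sgn_eq p hp, if_neg hn, h.hatw_eq p hp]; push_cast; ring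
    · refine (min_le_right _ _).trans ?_; push_cast; nlinarith
    · refine le_trans ?_ (le_max_left _ _); push_cast; nlinarith

lemma IsContiguous.exists_wave (hε : 0 < D.ε) {K : Finset ℕ} {S : ℝ} {m : ℤ}
    (h : D.IsContiguous K S m) {c : ℤ}
    (hc : IsCellBetween D.ε (m * D.ε) ((m + S * K.card) * D.ε) c) :
    ∃ p ∈ K, D.cellLeft p = c * D.ε := by
  obtain ⟨h1, h2⟩ := hc
  have hK : (0 : ℝ) ≤ K.card := Nat.cast_nonneg _
  rcases h.sign with rfl | rfl
  · rw [one_mul] at h1 h2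
    rw [min_eq_left (by nlinarith)] at h1
    rw [max_eq_right (by nlinarith)] at h2
    have h1' : m ≤ c := by exact_mod_cast le_of_mul_le_mul_right h1 hε
    have h2' : c + 1 ≤ m + K.card := by exact_mod_cast le_of_mul_le_mul_right h2 hε
    obtain ⟨p, hp, hr⟩ := exists_rankIn_eq (K := K) (i := (c + 1 - m).toNat) (by omega) (by omega)
    have hr' : (rankIn K p : ℝ) = c + 1 - m := by
      have : ((rankIn K p : ℕ) : ℤ) = c + 1 - m := by rw [hr]; omega
      exact_mod_cast this
    refine ⟨p, hp, ?_⟩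
    rw [cellLeft, h.sgn_eq p hp, if_pos one_pos, h.hatw_eq p hp, hr']
    ring
  · have hn : ¬ (0 : ℝ) < -1 := by norm_num
    rw [min_eq_right (by nlinarith)] at h1
    rw [max_eq_left (by nlinarith)] at h2
    have h1' : (m : ℝ) + -1 * K.card ≤ c := le_of_mul_le_mul_right h1 hε
    have h1'' : m - K.card ≤ c := by
      have : (m : ℝ) - K.card ≤ c := by linarith
      exact_mod_cast this
    have h2' : c + 1 ≤ m := by exact_mod_cast le_of_mul_le_mul_right h2 hε
    obtain ⟨p, hp, hr⟩ := exists_rankIn_eq (K := K) (i := (m - c).toNat) (by omega) (by omega)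
    have hr' : (rankIn K p : ℝ) = m - c := by
      have : ((rankIn K p : ℕ) : ℤ) = m - c := by rw [hr]; omega
      exact_mod_cast this
    refine ⟨p, hp, ?_⟩
    rw [cellLeft, h.sgn_eq p hp, if_neg hn, h.hatw_eq p hp, hr']
    ring

lemma IsContiguous.cellLeft_injOn (hε : 0 < D.ε) {K : Finset ℕ} {S : ℝ} {m : ℤ}
    (h : D.IsContiguous K S m) : Set.InjOn D.cellLeft K := by
  intro p hp q hq he
  apply rankIn_injOn K hp hq
  simp only [cellLeft, h.sgn_eq p hp, h.sgn_eq q hq, h.hatw_eq p hp, h.hatw_eq q hq] at he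
  rcases h.sign with rfl | rfl
  · simp only [one_pos, if_true, one_mul, sub_left_inj] at he
    have := mul_right_cancel₀ hε.ne' he
    exact_mod_cast add_left_cancel this
  · have hn : ¬ (0 : ℝ) < -1 := by norm_num
    simp only [hn, if_false] at he
    have := mul_right_cancel₀ hε.ne' he
    have : (rankIn K p : ℝ) = rankIn K q := by linarith
    exact_mod_cast this

namespace Coherent

variable {j : ℕ}

lemma riemannSpeed_eq (hD : D.Admissible) (h : D.Coherent j) {r : ℕ} (hr : r ∈ D.realWaves j) :
    riemannSpeed D.ε (fun z => D.f z (D.v (D.time j) (D.pos j r)))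
      (Function.leftLim (D.profile j) (D.pos j r)) (D.profile j (D.pos j r)) (D.cellLeft r) =
      D.waveSpeed j r := by
  obtain ⟨m, hm, h1, h2⟩ := h.isContiguous_wavesAt hD hr
  rw [waveSpeed_eq hr, hm.entropicSpeed_eq hD.ε_pos _ (mem_wavesAt.2 ⟨hr, rfl⟩), h1, h2]
  rfl

lemma wavesAt_nonempty (h : D.Coherent j) {y : ℝ}
    (hy : Function.leftLim (D.profile j) y ≠ D.profile j y) :
    ∃ r ∈ D.realWaves j, D.pos j r = y := by
  by_contra hcon
  push Not at hcon
  have h1 := h.profile_sub_leftLim y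
  have h2 : D.wavesAt j (y : WithTop ℝ) = ∅ := by
    rw [wavesAt_eq]
    exact Finset.filter_false_of_mem hcon
  rw [h2] at h1
  simp only [Finset.sum_empty, mul_zero] at h1
  exact hy (sub_eq_zero.1 h1).symm

lemma leftLim_ne (hD : D.Admissible) (h : D.Coherent j) {r : ℕ} (hr : r ∈ D.realWaves j) :
    Function.leftLim (D.profile j) (D.pos j r) ≠ D.profile j (D.pos j r) := by
  obtain ⟨m, hm, h1, h2⟩ := h.isContiguous_wavesAt hD hr
  have hc : (0 : ℝ) < (D.wavesAt j (D.pos j r : WithTop ℝ)).card := by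
    exact_mod_cast Finset.card_pos.2 ⟨r, mem_wavesAt.2 ⟨hr, rfl⟩⟩
  have hε := hD.ε_pos
  rw [h1, h2]
  intro he
  have := mul_right_cancel₀ hε.ne' he
  rcases hm.sign with h3 | h3 <;> rw [h3] at this <;> linarith

/-- The wavefronts of the second family are those formed by the real waves. -/
lemma second_mem_fronts (hD : D.Admissible) (h : D.Coherent j) {y c : ℝ} :
    (⟨.second, y, c⟩ : Front) ∈ D.fronts (D.time j) (D.profile j) ↔
      ∃ r ∈ D.realWaves j, D.pos j r = y ∧ D.waveSpeed j r = c := by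
  have hε := hD.ε_pos
  simp only [fronts, Set.mem_ofPred_eq]
  constructor
  · rintro ⟨m, hm, hc⟩
    have hne : Function.leftLim (D.profile j) y ≠ D.profile j y := by
      intro he
      rw [he, IsCellBetween, min_self, max_self] at hm
      nlinarith [hm.1, hm.2]
    obtain ⟨a, ha, rfl⟩ := h.wavesAt_nonempty hne
    obtain ⟨m', hm', h1, h2⟩ := h.isContiguous_wavesAt hD ha
    rw [h1, h2] at hm
    obtain ⟨r, hr, hrm⟩ := hm'.exists_wave hε hm
    obtain ⟨hr, hra⟩ := mem_wavesAt.1 hr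
    refine ⟨r, hr, hra, ?_⟩
    rw [hc, ← hrm, ← h.riemannSpeed_eq hD hr, hra]
  · rintro ⟨r, hr, rfl, rfl⟩
    obtain ⟨m', hm', h1, h2⟩ := h.isContiguous_wavesAt hD hr
    obtain ⟨c, hc, hb⟩ := hm'.exists_cell hε (mem_wavesAt.2 ⟨hr, rfl⟩)
    refine ⟨c, by rw [h1, h2]; exact hb, ?_⟩
    rw [← hc, h.riemannSpeed_eq hD hr]

/-- The profile at time `t_j + τ` before the next collision, in terms of the waves. -/
lemma evolve_eq (hD : D.Admissible) (h : D.Coherent j) {τ : ℝ} (hτ : 0 < τ) (x : ℝ) :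
    D.evolve (D.time j) (D.profile j) τ x = D.ε * ∑ r ∈ (D.realWaves j).filter
      (fun r => D.pos j r + D.waveSpeed j r * τ ≤ x), D.sgn r := by
  have hε := hD.ε_pos
  -- The jumps of the profile are the finitely many positions of waves, so `finsum` is a genuine
  -- finite sum, grouped by position.
  have hset : {y | Function.leftLim (D.profile j) y ≠ D.profile j y} =
      (((D.realWaves j).image (D.pos j) : Finset ℝ) : Set ℝ) := by
    ext y
    simp only [Set.mem_ofPred_eq, Finset.coe_image, Set.mem_image, Finset.mem_coe]
    exact ⟨fun hy => h.wavesAt_nonempty hy, fun ⟨r, hr, hy⟩ => hy ▸ h.leftLim_ne hD hr⟩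
  have h1 : D.evolve (D.time j) (D.profile j) τ x =
      ∑ y ∈ (D.realWaves j).image (D.pos j),
        (riemannFan D.ε (fun z => D.f z (D.v (D.time j) y)) (Function.leftLim (D.profile j) y)
          (D.profile j y) ((x - y) / τ) - Function.leftLim (D.profile j) y) := by
    unfold evolve
    rw [← finsum_mem_coe_finset, ← hset]
    rfl
  have hmap : ∀ r ∈ D.realWaves j, D.pos j r ∈ (D.realWaves j).image (D.pos j) := fun r hr =>
    Finset.mem_image_of_mem _ hr
  rw [h1, Finset.sum_filter, ← Finset.sum_fiberwise_of_maps_to hmap, Finset.mul_sum]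
  refine Finset.sum_congr rfl fun y hy => ?_
  obtain ⟨a, ha, rfl⟩ := Finset.mem_image.1 hy
  obtain ⟨m, hm, e1, e2⟩ := h.isContiguous_wavesAt hD ha
  set K := D.wavesAt j (D.pos j a : WithTop ℝ) with hK
  have hKc : (0 : ℝ) < K.card := by
    exact_mod_cast Finset.card_pos.2 ⟨a, mem_wavesAt.2 ⟨ha, rfl⟩⟩
  rw [← wavesAt_eq, ← hK, ← Finset.sum_filter, riemannFan]
  set N := K.filter (fun r => D.pos j r + D.waveSpeed j r * τ ≤ x) with hN
  have hsign : Real.sign (D.profile j (D.pos j a) - Function.leftLim (D.profile j) (D.pos j a)) =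
      D.sgn a := by
    rw [e1, e2]
    rcases hm.sign with h3 | h3 <;> rw [h3]
    · apply Real.sign_of_pos; nlinarith
    · apply Real.sign_of_neg; nlinarith
  -- The elementary jumps already crossed by the fan at `x` correspond to the waves that have
  -- arrived at or before `x`, each through the cell it occupies.
  have hcard : {c : ℤ | IsCellBetween D.ε (Function.leftLim (D.profile j) (D.pos j a))
      (D.profile j (D.pos j a)) c ∧ riemannSpeed D.ε (fun z => D.f z (D.v (D.time j) (D.pos j a)))
        (Function.leftLim (D.profile j) (D.pos j a)) (D.profile j (D.pos j a)) (c * D.ε) ≤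
          (x - D.pos j a) / τ}.ncard = N.card := by
    symm
    rw [← Set.ncard_coe_finset]
    refine Set.ncard_congr (fun r _ => ⌊D.cellLeft r / D.ε⌋) ?_ ?_ ?_
    · intro r hr
      obtain ⟨hr1, hr2⟩ := Finset.mem_filter.1 (Finset.mem_coe.1 hr)
      obtain ⟨c, hc, hb⟩ := hm.exists_cell hε hr1
      obtain ⟨hr1, hra⟩ := mem_wavesAt.1 hr1
      have : ⌊D.cellLeft r / D.ε⌋ = c := by
        rw [hc, mul_div_assoc, div_self hε.ne', mul_one, Int.floor_intCast]
      rw [this]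
      refine ⟨by rw [e1, e2]; exact hb, ?_⟩
      rw [← hc, ← hra, h.riemannSpeed_eq hD hr1, le_div_iff₀ hτ]
      linarith
    · intro r r' hr hr' he
      have hr1 := (Finset.mem_filter.1 (Finset.mem_coe.1 hr)).1
      have hr1' := (Finset.mem_filter.1 (Finset.mem_coe.1 hr')).1
      obtain ⟨c, hc, -⟩ := hm.exists_cell hε hr1
      obtain ⟨c', hc', -⟩ := hm.exists_cell hε hr1'
      rw [hc, hc', mul_div_assoc, mul_div_assoc, div_self hε.ne', mul_one, mul_one,
        Int.floor_intCast, Int.floor_intCast] at he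
      apply hm.cellLeft_injOn hε hr1 hr1'
      rw [hc, hc', he]
    · rintro c ⟨hb, hc⟩
      rw [e1, e2] at hb
      obtain ⟨r, hr, hrc⟩ := hm.exists_wave hε hb
      refine ⟨r, ?_, by rw [hrc, mul_div_assoc, div_self hε.ne', mul_one, Int.floor_intCast]⟩
      obtain ⟨hr1, hra⟩ := mem_wavesAt.1 hr
      rw [← hrc, ← hra, h.riemannSpeed_eq hD hr1, le_div_iff₀ hτ] at hc
      refine Finset.mem_coe.2 (Finset.mem_filter.2 ⟨hr, by linarith⟩)
  rw [hcard, hsign, Finset.sum_congr rfl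
    (fun r hr => hm.sgn_eq r (Finset.mem_filter.1 hr).1), Finset.sum_const, nsmul_eq_mul]
  ring

end Coherent

end WavefrontData

/-! ### Jumps of step functions -/

namespace StepOn

variable {F : Finset ℝ} {u : ℝ → ℝ}

/-- `F` may contain points at which `u` does not jump; they are removed one at a time from the
right. -/
lemma eq_of_no_jump (h : StepOn F u) {a b : ℝ} (hab : a ≤ b)
    (hj : ∀ z, a < z → z ≤ b → Function.leftLim u z = u z) : u a = u b := by
  induction hk : (F.filter (fun z => a < z ∧ z ≤ b)).card using Nat.strong_induction_on
    generalizing b with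
  | _ k ih =>
  rcases (F.filter (fun z => a < z ∧ z ≤ b)).eq_empty_or_nonempty with h0 | hne
  · rcases hab.eq_or_lt with rfl | hab
    · rfl
    · refine h a b hab fun z hz hzab => ?_
      have : z ∈ F.filter (fun z => a < z ∧ z ≤ b) := Finset.mem_filter.2 ⟨hz, hzab⟩
      rw [h0] at this
      simp at this
  · set z := (F.filter (fun z => a < z ∧ z ≤ b)).max' hne with hz
    have hzm := Finset.mem_filter.1 ((F.filter (fun z => a < z ∧ z ≤ b)).max'_mem hne)
    rw [← hz] at hzm
    obtain ⟨hzF, haz, hzb⟩ := hzm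
    have e1 : u z = u b := by
      rcases hzb.eq_or_lt with h1 | h1
      · rw [h1]
      · refine h z b h1 fun t ht htzb => ?_
        have := Finset.le_max' _ t (Finset.mem_filter.2 ⟨ht, haz.trans htzb.1, htzb.2⟩ :
          t ∈ F.filter (fun z => a < z ∧ z ≤ b))
        rw [← hz] at this
        exact absurd htzb.1 (not_lt.2 this)
    obtain ⟨l0, hl0, hgap⟩ := exists_lt_forall_le F z
    have hl : max l0 a < z := max_lt hl0 haz
    have e2 := h.leftLim_eq hl fun t ht htz => (hgap t ht htz).trans (le_max_left _ _)
    rw [hj z haz hzb] at e2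
    rw [← e1, e2]
    refine ih _ ?_ (le_max_right _ _) (fun t h1 h2 => hj t h1 ((h2.trans hl.le).trans hzb)) rfl
    rw [← hk]
    refine Finset.card_lt_card (Finset.ssubset_iff_subset_ne.2 ⟨fun t ht => ?_, fun hE => ?_⟩)
    · simp only [Finset.mem_filter] at ht ⊢
      exact ⟨ht.1, ht.2.1, (ht.2.2.trans hl.le).trans hzb⟩
    · have : z ∈ F.filter (fun z => a < z ∧ z ≤ max l0 a) := by
        rw [hE]; exact Finset.mem_filter.2 ⟨hzF, haz, hzb⟩
      exact absurd (Finset.mem_filter.1 this).2.2 (not_le.2 hl)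

lemma leftLim_eq_of_no_jump (h : StepOn F u) {a b : ℝ} (hab : a < b)
    (hj : ∀ z, a < z → z < b → Function.leftLim u z = u z) : Function.leftLim u b = u a := by
  obtain ⟨l0, hl0, hgap⟩ := exists_lt_forall_le F b
  have hl : max l0 a < b := max_lt hl0 hab
  rw [h.leftLim_eq hl fun t ht htz => (hgap t ht htz).trans (le_max_left _ _)]
  exact (h.eq_of_no_jump (le_max_right _ _) fun z h1 h2 => hj z h1 (h2.trans_lt hl)).symm

lemma leftLim_shift (h : StepOn F u) (t x : ℝ) :
    Function.leftLim (fun y => u (y + t)) x = Function.leftLim u (x + t) := by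
  obtain ⟨l, hl, hgap⟩ := exists_lt_forall_le F (x + t)
  rw [h.leftLim_eq hl hgap]
  refine leftLim_eq_of_forall (l := l - t) (by linarith) fun y h1 h2 => ?_
  exact (h l (y + t) (by linarith) fun z hz hzy =>
    absurd (hgap z hz (by linarith [hzy.2])) (not_le.2 hzy.1)).symm

lemma finite_jumps (h : StepOn F u) : {z | Function.leftLim u z ≠ u z} ⊆ F := by
  intro z hz
  by_contra hzF
  obtain ⟨l, hl, hgap⟩ := exists_lt_forall_le F z
  apply hz
  rw [h.leftLim_eq hl hgap]
  refine h l z hl fun t ht htz => ?_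
  rcases htz.2.eq_or_lt with rfl | h1
  · exact hzF ht
  · exact absurd (hgap t ht h1) (not_le.2 htz.1)

end StepOn

lemma leftLim_sum_filter (W : Finset ℕ) (P σ : ℕ → ℝ) (c y : ℝ) :
    Function.leftLim (fun x => c * ∑ r ∈ W.filter (P · ≤ x), σ r) y =
      c * ∑ r ∈ W.filter (P · < y), σ r := by
  obtain ⟨l, hl, hgap⟩ := exists_lt_forall_le (W.image P) y
  refine leftLim_eq_of_forall hl fun x hlx hxy => ?_
  congr 1
  refine Finset.sum_congr (Finset.filter_congr fun r hr => ?_) fun _ _ => rfl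
  exact ⟨fun hx => hx.trans_lt hxy, fun hy =>
    (hgap _ (Finset.mem_image_of_mem _ hr) hy).trans hlx.le⟩

/-! ### Cancellation in a signed sequence -/

lemma card_filter_rankIn (K : Finset ℕ) (n : ℕ) (P : ℕ → Prop) [DecidablePred P] :
    ((K.filter (· ≤ n)).filter (fun q => P (rankIn K q))).card =
      ((Finset.Icc 1 (rankIn K n)).filter P).card := by
  rw [← image_rankIn, Finset.filter_image, Finset.card_image_of_injOn]
  exact (rankIn_injOn K).mono (by intro x; simp +contextual)

lemma card_filter_rankIn_le (K : Finset ℕ) {k : ℕ} (hk : k ≤ K.card) :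
    (K.filter (fun q => rankIn K q ≤ k)).card = k := by
  have h1 := card_filter_rankIn K (K.sup id) (· ≤ k)
  have h2 : K.filter (· ≤ K.sup id) = K :=
    Finset.filter_true_of_mem fun x hx => Finset.le_sup (f := id) hx
  have h3 : rankIn K (K.sup id) = K.card := by rw [rankIn, h2]
  rw [h2, h3] at h1
  rw [h1, show (Finset.Icc 1 K.card).filter (· ≤ k) = Finset.Icc 1 k by
    ext; simp only [Finset.mem_filter, Finset.mem_Icc]; omega]
  simp

lemma card_filter_lt_rankIn (K : Finset ℕ) (n l : ℕ) :
    ((K.filter (fun q => l + 1 ≤ rankIn K q)).filter (· ≤ n)).card = rankIn K n - l := by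
  have h1 := card_filter_rankIn K n (l + 1 ≤ ·)
  rw [Finset.filter_comm, h1, show (Finset.Icc 1 (rankIn K n)).filter (l + 1 ≤ ·) =
    Finset.Icc (l + 1) (rankIn K n) by
      ext; simp only [Finset.mem_filter, Finset.mem_Icc]; omega]
  simp

/-- The elements of `A` that survive the cancellation of consecutive opposite signs. -/
def survivors (A : Finset ℕ) (σ : ℕ → ℝ) : Finset ℕ :=
  A.filter fun r => 1 ≤ σ r * ∑ q ∈ A.filter (· ≤ r), σ q ∧ 0 ≤ σ r * ∑ q ∈ A.filter (r < ·), σ q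

lemma survivors_subset (A : Finset ℕ) (σ : ℕ → ℝ) : survivors A σ ⊆ A := Finset.filter_subset _ _

lemma sum_const_sign {K : Finset ℕ} {σ : ℕ → ℝ} {S : ℝ} (h : ∀ q ∈ K, σ q = S) :
    ∑ q ∈ K, σ q = S * K.card := by
  rw [Finset.sum_congr rfl h, Finset.sum_const, nsmul_eq_mul, mul_comm]

lemma survivors_eq_self {A : Finset ℕ} {σ : ℕ → ℝ} {S : ℝ} (hS : S = 1 ∨ S = -1)
    (h : ∀ q ∈ A, σ q = S) : survivors A σ = A := by
  have hSS : S * S = 1 := by rcases hS with rfl | rfl <;> norm_num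
  refine Finset.filter_true_of_mem fun r hr => ?_
  rw [sum_const_sign (fun q hq => h q (Finset.mem_filter.1 hq).1),
    sum_const_sign (fun q hq => h q (Finset.mem_filter.1 hq).1), h r hr, ← mul_assoc, ← mul_assoc,
    hSS, one_mul, one_mul]
  exact ⟨by exact_mod_cast rankIn_pos hr, Nat.cast_nonneg _⟩

section Cancellation

variable {L R : Finset ℕ} {σ : ℕ → ℝ} {S : ℝ}

/-- Cancellation starts from the waves that face each other: `r` survives when the waves of `L`
behind it suffice to absorb all of `R`. -/
lemma mem_survivors_left (hS : S * S = 1) (hL : ∀ q ∈ L, σ q = S) (hR : ∀ q ∈ R, σ q = -S)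
    (hLR : ∀ a ∈ L, ∀ b ∈ R, a < b) {r : ℕ} (hr : r ∈ L) :
    r ∈ survivors (L ∪ R) σ ↔ rankIn L r + R.card ≤ L.card := by
  have e1 : (L ∪ R).filter (· ≤ r) = L.filter (· ≤ r) := by
    rw [Finset.filter_union, Finset.filter_false_of_mem (s := R), Finset.union_empty]
    exact fun b hb => not_le.2 (hLR r hr b hb)
  have e2 : (L ∪ R).filter (r < ·) = L.filter (r < ·) ∪ R := by
    rw [Finset.filter_union, Finset.filter_true_of_mem (s := R)]
    exact fun b hb => hLR r hr b hb
  have hd : Disjoint (L.filter (r < ·)) R := Finset.disjoint_left.2 fun a ha hb =>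
    (hLR a (Finset.mem_filter.1 ha).1 a hb).ne rfl
  have e3 : (L.filter (r < ·)).card + rankIn L r = L.card := by
    have := Finset.card_filter_add_card_filter_not (s := L) (· ≤ r)
    simp only [not_le] at this
    rw [rankIn]; omega
  have e3' : ((L.filter (r < ·)).card : ℝ) = L.card - rankIn L r := by
    rw [← e3]; push_cast; ring
  rw [survivors, Finset.mem_filter, e1, e2, Finset.sum_union hd,
    sum_const_sign (fun q hq => hL q (Finset.mem_filter.1 hq).1),
    sum_const_sign (fun q hq => hL q (Finset.mem_filter.1 hq).1), sum_const_sign hR, hL r hr]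
  rw [← mul_assoc, hS, show S * (S * ((L.filter (r < ·)).card : ℝ) + -S * R.card) =
    (S * S) * (((L.filter (r < ·)).card : ℝ) - R.card) by ring, hS, e3']
  have h1 : (1 : ℝ) ≤ (L.filter (· ≤ r)).card := by exact_mod_cast rankIn_pos hr
  constructor
  · rintro ⟨-, -, h⟩
    have : (rankIn L r : ℝ) + R.card ≤ L.card := by linarith
    exact_mod_cast this
  · intro h
    have : (rankIn L r : ℝ) + R.card ≤ L.card := by exact_mod_cast h
    exact ⟨Finset.mem_union_left _ hr, by linarith, by linarith⟩

lemma mem_survivors_right (hS : S * S = 1) (hL : ∀ q ∈ L, σ q = S) (hR : ∀ q ∈ R, σ q = -S)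
    (hLR : ∀ a ∈ L, ∀ b ∈ R, a < b) {r : ℕ} (hr : r ∈ R) :
    r ∈ survivors (L ∪ R) σ ↔ L.card + 1 ≤ rankIn R r := by
  have e1 : (L ∪ R).filter (· ≤ r) = L ∪ R.filter (· ≤ r) := by
    rw [Finset.filter_union, Finset.filter_true_of_mem (s := L)]
    exact fun a ha => (hLR a ha r hr).le
  have e2 : (L ∪ R).filter (r < ·) = R.filter (r < ·) := by
    rw [Finset.filter_union, Finset.filter_false_of_mem (s := L), Finset.empty_union]
    exact fun a ha => not_lt.2 (hLR a ha r hr).le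
  have hd : Disjoint L (R.filter (· ≤ r)) := Finset.disjoint_left.2 fun a ha hb =>
    (hLR a ha a (Finset.mem_filter.1 hb).1).ne rfl
  rw [survivors, Finset.mem_filter, e1, e2, Finset.sum_union hd,
    sum_const_sign (fun q hq => hR q (Finset.mem_filter.1 hq).1),
    sum_const_sign (fun q hq => hR q (Finset.mem_filter.1 hq).1), sum_const_sign hL, hR r hr]
  rw [show -S * (S * (L.card : ℝ) + -S * ((R.filter (· ≤ r)).card : ℝ)) =
    (S * S) * (((R.filter (· ≤ r)).card : ℝ) - L.card) by ring,
    show -S * (-S * ((R.filter (r < ·)).card : ℝ)) = (S * S) * ((R.filter (r < ·)).card : ℝ) by ring,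
    hS, ← rankIn, one_mul, one_mul]
  constructor
  · rintro ⟨-, h, -⟩
    have : (L.card : ℝ) + 1 ≤ rankIn R r := by linarith
    exact_mod_cast this
  · intro h
    have : (L.card : ℝ) + 1 ≤ rankIn R r := by exact_mod_cast h
    exact ⟨Finset.mem_union_right _ hr, by linarith, Nat.cast_nonneg _⟩

/-- After the cancellation of two groups of opposite signs the survivors have the same sign and
the same signed sums. -/
lemma survivors_opposite (hS : S * S = 1) (hL : ∀ q ∈ L, σ q = S) (hR : ∀ q ∈ R, σ q = -S)
    (hLR : ∀ a ∈ L, ∀ b ∈ R, a < b) :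
    (∀ r ∈ survivors (L ∪ R) σ, ∑ q ∈ (survivors (L ∪ R) σ).filter (· ≤ r), σ q =
        ∑ q ∈ (L ∪ R).filter (· ≤ r), σ q) ∧
      ∑ q ∈ survivors (L ∪ R) σ, σ q = ∑ q ∈ L ∪ R, σ q ∧
      ∀ r ∈ survivors (L ∪ R) σ, ∀ r' ∈ survivors (L ∪ R) σ, σ r = σ r' := by
  have hd : Disjoint L R := Finset.disjoint_left.2 fun a ha hb => (hLR a ha a hb).ne rfl
  have hsub := survivors_subset (L ∪ R) σ
  -- The smaller group disappears and a block of the larger one remains, its beginning or its end;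
  -- with equal sizes the second case leaves nothing.
  rcases lt_or_ge R.card L.card with hlt | hge
  · have hB : survivors (L ∪ R) σ = L.filter (fun q => rankIn L q ≤ L.card - R.card) := by
      ext r
      rw [Finset.mem_filter]
      constructor
      · intro hr
        rcases Finset.mem_union.1 (hsub hr) with h | h
        · have := (mem_survivors_left hS hL hR hLR h).1 hr
          exact ⟨h, by omega⟩
        · have := (mem_survivors_right hS hL hR hLR h).1 hr
          have := rankIn_le_card R r
          omega
      · rintro ⟨h, h1⟩
        exact (mem_survivors_left hS hL hR hLR h).2 (by omega)
    rw [hB]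
    refine ⟨fun r hr => ?_, ?_, fun r hr r' hr' => ?_⟩
    · obtain ⟨hr1, hr2⟩ := Finset.mem_filter.1 hr
      refine Finset.sum_congr ?_ fun _ _ => rfl
      ext q
      simp only [Finset.mem_filter, Finset.mem_union]
      constructor
      · rintro ⟨⟨h1, h2⟩, h3⟩
        exact ⟨Or.inl h1, h3⟩
      · rintro ⟨h1 | h1, h3⟩
        · exact ⟨⟨h1, (rankIn_mono L h3).trans hr2⟩, h3⟩
        · exact absurd (hLR r hr1 q h1) (not_lt.2 h3)
    · rw [sum_const_sign (fun q hq => hL q (Finset.mem_filter.1 hq).1),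
        card_filter_rankIn_le L (Nat.sub_le _ _), Finset.sum_union hd, sum_const_sign hL,
        sum_const_sign hR, Nat.cast_sub hlt.le]
      ring
    · rw [hL r (Finset.mem_filter.1 hr).1, hL r' (Finset.mem_filter.1 hr').1]
  · have hB : survivors (L ∪ R) σ = R.filter (fun q => L.card + 1 ≤ rankIn R q) := by
      ext r
      rw [Finset.mem_filter]
      constructor
      · intro hr
        rcases Finset.mem_union.1 (hsub hr) with h | h
        · have := (mem_survivors_left hS hL hR hLR h).1 hr
          have := rankIn_pos h
          omega
        · exact ⟨h, (mem_survivors_right hS hL hR hLR h).1 hr⟩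
      · rintro ⟨h, h1⟩
        exact (mem_survivors_right hS hL hR hLR h).2 h1
    rw [hB]
    refine ⟨fun r hr => ?_, ?_, fun r hr r' hr' => ?_⟩
    · obtain ⟨hr1, hr2⟩ := Finset.mem_filter.1 hr
      have e1 : (L ∪ R).filter (· ≤ r) = L ∪ R.filter (· ≤ r) := by
        rw [Finset.filter_union, Finset.filter_true_of_mem (s := L)]
        exact fun a ha => (hLR a ha r hr1).le
      have hd' : Disjoint L (R.filter (· ≤ r)) := Finset.disjoint_left.2 fun a ha hb =>
        (hLR a ha a (Finset.mem_filter.1 hb).1).ne rfl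
      rw [e1, Finset.sum_union hd', sum_const_sign hL,
        sum_const_sign (K := R.filter (· ≤ r)) (fun q hq => hR q (Finset.mem_filter.1 hq).1),
        sum_const_sign (fun q hq => hR q (Finset.mem_filter.1 (Finset.mem_filter.1 hq).1).1),
        card_filter_lt_rankIn, Nat.cast_sub (by omega), rankIn]
      ring
    · have h1 := card_filter_lt_rankIn R (R.sup id) L.card
      have h2 : R.filter (· ≤ R.sup id) = R :=
        Finset.filter_true_of_mem fun x hx => Finset.le_sup (f := id) hx
      rw [Finset.filter_comm, h2, rankIn, h2] at h1
      rw [sum_const_sign (fun q hq => hR q (Finset.mem_filter.1 hq).1), h1, Nat.cast_sub hge,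
        Finset.sum_union hd, sum_const_sign hL, sum_const_sign hR]
      ring
    · rw [hR r (Finset.mem_filter.1 hr).1, hR r' (Finset.mem_filter.1 hr').1]

end Cancellation

namespace WavefrontData

variable {D : WavefrontData} {j : ℕ}

/-! ### The next collision -/

/-- The wavefront that contains the wave `r`. -/
def frontOf (D : WavefrontData) (j r : ℕ) : Front := ⟨.second, D.pos j r, D.waveSpeed j r⟩

/-- The time between two collisions. -/
def delay (D : WavefrontData) (j : ℕ) : ℝ := D.time (j + 1) - D.time j

/-- The position of a wave at the next collision time. -/
def arrival (D : WavefrontData) (j r : ℕ) : ℝ := D.pos j r + D.waveSpeed j r * D.delay j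

lemma frontOf_mem (hD : D.Admissible) (h : D.Coherent j) {r : ℕ} (hr : r ∈ D.realWaves j) :
    D.frontOf j r ∈ D.fronts (D.time j) (D.profile j) :=
  (h.second_mem_fronts hD).2 ⟨r, hr, rfl, rfl⟩

lemma exists_frontOf (hD : D.Admissible) (h : D.Coherent j) {φ : Front}
    (hφ : φ ∈ D.fronts (D.time j) (D.profile j)) (hf : φ.family = .second) :
    ∃ r ∈ D.realWaves j, φ = D.frontOf j r := by
  obtain ⟨fam, y, c⟩ := φ
  obtain rfl : fam = .second := hf
  obtain ⟨r, hr, rfl, rfl⟩ := (h.second_mem_fronts hD).1 hφ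
  exact ⟨r, hr, rfl⟩

lemma first_mem_fronts {t y c : ℝ} {u : ℝ → ℝ} :
    (⟨.first, y, c⟩ : Front) ∈ D.fronts t u ↔ Function.leftLim (D.v t) y ≠ D.v t y ∧ c = -1 :=
  Iff.rfl

/-- A front of the first family has speed `-1` and one of the second strictly more, so start and
speed determine the family. -/
lemma eq_of_start_speed (hD : D.Admissible) (h : D.Coherent j) {φ ψ : Front}
    (hφ : φ ∈ D.fronts (D.time j) (D.profile j)) (hψ : ψ ∈ D.fronts (D.time j) (D.profile j))
    (h1 : φ.start = ψ.start) (h2 : φ.speed = ψ.speed) : φ = ψ := by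
  obtain ⟨f1, y1, c1⟩ := φ
  obtain ⟨f2, y2, c2⟩ := ψ
  obtain rfl : y1 = y2 := h1
  obtain rfl : c1 = c2 := h2
  have key : ∀ c y, (⟨.second, y, c⟩ : Front) ∈ D.fronts (D.time j) (D.profile j) → -1 < c := by
    intro c y hm
    obtain ⟨r, hr, -, rfl⟩ := (h.second_mem_fronts hD).1 hm
    exact h.neg_one_lt_waveSpeed hD hr
  cases f1 <;> cases f2
  · rfl
  · have := key _ _ hψ; have := (first_mem_fronts.1 hφ).2; linarith
  · have := key _ _ hφ; have := (first_mem_fronts.1 hψ).2; linarith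
  · rfl

lemma finite_fronts (hD : D.Admissible) (h : D.Coherent j) :
    (D.fronts (D.time j) (D.profile j)).Finite := by
  obtain ⟨F, hF⟩ := hD.v_step
  replace hF : StepOn F D.v₀ := hF
  refine Set.Finite.subset (s := ((fun z : ℝ => (⟨.first, z - D.time j, -1⟩ : Front)) '' F) ∪
    (D.frontOf j '' (D.realWaves j))) ?_ fun φ hφ => ?_
  · exact (F.finite_toSet.image _).union ((D.realWaves j).finite_toSet.image _)
  · by_cases hf : φ.family = .second
    · obtain ⟨r, hr, rfl⟩ := exists_frontOf hD h hφ hf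
      exact Or.inr ⟨r, hr, rfl⟩
    · obtain ⟨fam, y, c⟩ := φ
      obtain rfl : fam = .first := by cases fam <;> simp_all
      obtain ⟨h1, rfl⟩ := first_mem_fronts.1 hφ
      refine Or.inl ⟨y + D.time j, hF.finite_jumps ?_, by simp⟩
      change Function.leftLim D.v₀ _ ≠ _
      rw [← hF.leftLim_shift]
      exact h1

/-- Distinct wavefronts that meet have different speeds, so each pair has one meeting time.
Finiteness makes the infimum in `state` an attained, positive minimum. -/
lemma finite_collisionDelays (hD : D.Admissible) (h : D.Coherent j) :
    (D.collisionDelays (D.time j) (D.profile j)).Finite := by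
  have hfin := finite_fronts hD h
  refine ((hfin.prod hfin).image
    (fun p : Front × Front => (p.2.start - p.1.start) / (p.1.speed - p.2.speed))).subset ?_
  rintro τ ⟨hτ, φ, ψ, x, hφ, hψ, hne, h1, h2⟩
  refine ⟨(φ, ψ), ⟨hφ, hψ⟩, ?_⟩
  have hs : φ.speed ≠ ψ.speed := fun hs => hne (eq_of_start_speed hD h hφ hψ
    (by rw [hs] at h1; linarith) hs)
  change (ψ.start - φ.start) / (φ.speed - ψ.speed) = τ
  rw [div_eq_iff (sub_ne_zero.2 hs)]
  linarith

lemma delay_eq (hR : D.Reached (j + 1)) :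
    D.delay j = sInf (D.collisionDelays (D.time j) (D.profile j)) := by
  have : D.time (j + 1) = D.time j + sInf (D.collisionDelays (D.time j) (D.profile j)) := by
    rw [time, state]
    exact congrArg Prod.fst (if_pos hR)
  rw [delay, this]
  ring

lemma delay_isLeast (hD : D.Admissible) (h : D.Coherent j) (hR : D.Reached (j + 1)) :
    IsLeast (D.collisionDelays (D.time j) (D.profile j)) (D.delay j) := by
  have hfin := finite_collisionDelays hD h
  rw [delay_eq hR]
  exact ⟨Set.Nonempty.csInf_mem hR hfin, fun τ hτ => csInf_le hfin.bddBelow hτ⟩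

lemma delay_pos (hD : D.Admissible) (h : D.Coherent j) (hR : D.Reached (j + 1)) :
    0 < D.delay j := (delay_isLeast hD h hR).1.1

lemma profile_succ (hD : D.Admissible) (h : D.Coherent j) (hR : D.Reached (j + 1)) (x : ℝ) :
    D.profile (j + 1) x =
      D.ε * ∑ r ∈ (D.realWaves j).filter (D.arrival j · ≤ x), D.sgn r := by
  have h1 : D.profile (j + 1) = D.evolve (D.time j) (D.profile j) (D.delay j) := by
    rw [delay_eq hR, profile, state]
    exact congrArg Prod.snd (if_pos hR)
  rw [h1, h.evolve_eq hD (delay_pos hD h hR)]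
  rfl

/-- Wavefronts do not cross before the next collision. -/
lemma fronts_lt (hD : D.Admissible) (h : D.Coherent j) (hR : D.Reached (j + 1)) {φ ψ : Front}
    (hφ : φ ∈ D.fronts (D.time j) (D.profile j)) (hψ : ψ ∈ D.fronts (D.time j) (D.profile j))
    (hlt : φ.start < ψ.start) {θ : ℝ} (h0 : 0 ≤ θ) (hθ : θ < D.delay j) :
    φ.start + φ.speed * θ < ψ.start + ψ.speed * θ := by
  by_contra hcon
  push Not at hcon
  have hs : 0 < (φ.speed - ψ.speed) := by
    by_contra hs
    push Not at hs
    nlinarith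
  set τ := (ψ.start - φ.start) / (φ.speed - ψ.speed) with hτ
  have hτ0 : 0 < τ := div_pos (by linarith) hs
  have hτθ : τ ≤ θ := by rw [hτ, div_le_iff₀ hs]; nlinarith
  have hmul : τ * (φ.speed - ψ.speed) = ψ.start - φ.start := div_mul_cancel₀ _ hs.ne'
  have := (delay_isLeast hD h hR).2 (show τ ∈ D.collisionDelays (D.time j) (D.profile j) from
    ⟨hτ0, φ, ψ, φ.start + φ.speed * τ, hφ, hψ, fun he => hlt.ne (by rw [he]), rfl, by linarith⟩)
  linarith

/-- Fronts in reversed order at the collision time would have met strictly before it. -/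
lemma fronts_le (hD : D.Admissible) (h : D.Coherent j) (hR : D.Reached (j + 1)) {φ ψ : Front}
    (hφ : φ ∈ D.fronts (D.time j) (D.profile j)) (hψ : ψ ∈ D.fronts (D.time j) (D.profile j))
    (hlt : φ.start < ψ.start) :
    φ.start + φ.speed * D.delay j ≤ ψ.start + ψ.speed * D.delay j := by
  by_contra hcon
  push Not at hcon
  have hd := delay_pos hD h hR
  have hs : 0 < (φ.speed - ψ.speed) := by
    by_contra hs
    push Not at hs
    nlinarith
  set τ := (ψ.start - φ.start) / (φ.speed - ψ.speed) with hτ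
  have hτ0 : 0 < τ := div_pos (by linarith) hs
  have hτθ : τ < D.delay j := by rw [hτ, div_lt_iff₀ hs]; nlinarith
  have hmul : τ * (φ.speed - ψ.speed) = ψ.start - φ.start := div_mul_cancel₀ _ hs.ne'
  have := fronts_lt hD h hR hφ hψ hlt hτ0.le hτθ
  linarith

lemma collideAt_of_eq (hR : D.Reached (j + 1)) {φ ψ : Front}
    (hφ : φ ∈ D.fronts (D.time j) (D.profile j)) (hψ : ψ ∈ D.fronts (D.time j) (D.profile j))
    (hne : φ ≠ ψ) (he : φ.start + φ.speed * D.delay j = ψ.start + ψ.speed * D.delay j) :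
    D.CollideAt (j + 1) φ ψ (ψ.start + ψ.speed * D.delay j) :=
  ⟨hR, hφ, hψ, hne, he, rfl⟩

/-- Only one pair of wavefronts collides at a given time, so the `sInf` is taken over a singleton.
-/
lemma CollideAt.collisionPoint_eq (hD : D.Admissible) {φ ψ : Front} {x : ℝ}
    (h : D.CollideAt (j + 1) φ ψ x) : D.collisionPoint (j + 1) = x := by
  have : {x | ∃ φ ψ, D.CollideAt (j + 1) φ ψ x} = {x} := by
    ext x'
    simp only [Set.mem_ofPred_eq, Set.mem_singleton_iff]
    refine ⟨?_, fun hx => ⟨φ, ψ, hx ▸ h⟩⟩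
    rintro ⟨φ', ψ', h'⟩
    have hset := hD.binary _ _ _ _ _ _ _ h h'
    have hm : φ' ∈ ({φ, ψ} : Set Front) := by rw [hset]; simp
    obtain ⟨-, -, -, -, e1, e2⟩ := h
    obtain ⟨-, -, -, -, e3, -⟩ := h'
    rcases hm with rfl | hm
    · rw [← e1, ← e3]
    · rw [Set.mem_singleton_iff] at hm
      rw [← e3, hm, e2]
  rw [collisionPoint, this, csInf_singleton]

lemma arrival_mono (hD : D.Admissible) (h : D.Coherent j) (hR : D.Reached (j + 1)) {r r' : ℕ}
    (hr : r ∈ D.realWaves j) (hr' : r' ∈ D.realWaves j) (hle : r ≤ r') :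
    D.arrival j r ≤ D.arrival j r' := by
  rcases (h.pos_mono hr hr' hle).eq_or_lt with he | hlt
  · have h1 := h.waveSpeed_mono hD hr hr' he hle
    have := delay_pos hD h hR
    unfold arrival
    rw [he]
    gcongr
  · exact fronts_le hD h hR (frontOf_mem hD h hr) (frontOf_mem hD h hr') hlt

lemma frontOf_eq_iff {r r' : ℕ} : D.frontOf j r = D.frontOf j r' ↔
    D.pos j r = D.pos j r' ∧ D.waveSpeed j r = D.waveSpeed j r' := by
  simp [frontOf]

lemma collideAt_frontOf (hD : D.Admissible) (h : D.Coherent j) (hR : D.Reached (j + 1)) {r r' : ℕ}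
    (hr : r ∈ D.realWaves j) (hr' : r' ∈ D.realWaves j) (he : D.arrival j r = D.arrival j r')
    (hne : D.frontOf j r ≠ D.frontOf j r') :
    D.CollideAt (j + 1) (D.frontOf j r) (D.frontOf j r') (D.arrival j r') :=
  collideAt_of_eq hR (frontOf_mem hD h hr) (frontOf_mem hD h hr') hne he

/-- The waves arriving at the next collision point. -/
def arriving (D : WavefrontData) (j : ℕ) : Finset ℕ :=
  (D.realWaves j).filter fun r => D.arrival j r = D.collisionPoint (j + 1)

lemma frontOf_eq_of_arrival_eq (hD : D.Admissible) (h : D.Coherent j) (hR : D.Reached (j + 1))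
    {r r' : ℕ} (hr : r ∈ D.realWaves j) (hr' : r' ∈ D.realWaves j)
    (he : D.arrival j r = D.arrival j r') (hne : D.arrival j r' ≠ D.collisionPoint (j + 1)) :
    D.frontOf j r = D.frontOf j r' := by
  by_contra hcon
  exact hne (((collideAt_frontOf hD h hR hr hr' he hcon).collisionPoint_eq hD).symm)

lemma sgn_eq_of_frontOf_eq (h : D.Coherent j) {r r' : ℕ} (hr : r ∈ D.realWaves j)
    (hr' : r' ∈ D.realWaves j) (he : D.frontOf j r = D.frontOf j r') : D.sgn r = D.sgn r' :=
  h.sgn_eq_of_pos_eq hr hr' (frontOf_eq_iff.1 he).1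

lemma lt_of_frontOf_lt (hD : D.Admissible) (h : D.Coherent j) (hR : D.Reached (j + 1)) {a b c : ℕ}
    (ha : a ∈ D.realWaves j) (hb : b ∈ D.realWaves j) (hc : c ∈ D.realWaves j) (hle : a ≤ c)
    (hab : D.frontOf j a = D.frontOf j b) (hne : D.frontOf j a ≠ D.frontOf j c)
    (harr : D.arrival j a = D.arrival j c) : b < c := by
  obtain ⟨e1, e2⟩ := frontOf_eq_iff.1 hab
  apply h.lt_of_pos_lt hb hc
  rw [← e1]
  refine lt_of_le_of_ne (h.pos_mono ha hc hle) fun he => hne ?_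
  rw [frontOf_eq_iff]
  refine ⟨he, ?_⟩
  unfold arrival at harr
  rw [he] at harr
  exact mul_right_cancel₀ (delay_pos hD h hR).ne' (add_left_cancel harr)

/-- The waves arriving at a collision point belong to at most two wavefronts. -/
lemma exists_arriving_eq (hD : D.Admissible) (h : D.Coherent j) (hR : D.Reached (j + 1)) :
    ∃ L R : Finset ℕ, D.arriving j = L ∪ R ∧ (∀ a ∈ L, ∀ b ∈ R, a < b) ∧
      (∀ a ∈ L, ∀ b ∈ L, D.frontOf j a = D.frontOf j b) ∧
      (∀ a ∈ R, ∀ b ∈ R, D.frontOf j a = D.frontOf j b) ∧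
      (∀ a ∈ L, ∀ b ∈ R, D.frontOf j a ≠ D.frontOf j b) := by
  rcases (D.arriving j).eq_empty_or_nonempty with h0 | hne
  · exact ⟨∅, ∅, by simp [h0], by simp, by simp, by simp, by simp⟩
  set a0 := (D.arriving j).min' hne with ha0
  have ha0m := (D.arriving j).min'_mem hne
  have hmin : ∀ b ∈ D.arriving j, a0 ≤ b := fun b hb => (D.arriving j).min'_le b hb
  rw [← ha0] at ha0m
  have hmem : ∀ r ∈ D.arriving j, r ∈ D.realWaves j ∧ D.arrival j r = D.collisionPoint (j + 1) :=
    fun r hr => Finset.mem_filter.1 hr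
  refine ⟨(D.arriving j).filter (fun r => D.frontOf j a0 = D.frontOf j r),
    (D.arriving j).filter (fun r => ¬ D.frontOf j a0 = D.frontOf j r),
    (Finset.filter_union_filter_not_eq _ _).symm, ?_, ?_, ?_, ?_⟩
  · intro a ha b hb
    obtain ⟨ha1, ha2⟩ := Finset.mem_filter.1 ha
    obtain ⟨hb1, hb2⟩ := Finset.mem_filter.1 hb
    exact lt_of_frontOf_lt hD h hR (hmem _ ha0m).1 (hmem _ ha1).1 (hmem _ hb1).1 (hmin b hb1) ha2
      hb2 ((hmem _ ha0m).2.trans (hmem _ hb1).2.symm)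
  · intro a ha b hb
    exact (Finset.mem_filter.1 ha).2.symm.trans (Finset.mem_filter.1 hb).2
  · intro a ha b hb
    obtain ⟨ha1, ha2⟩ := Finset.mem_filter.1 ha
    obtain ⟨hb1, hb2⟩ := Finset.mem_filter.1 hb
    -- Waves outside the front of `a0` all collide with it, and since only two fronts collide they
    -- belong to a single one.
    have c1 := collideAt_frontOf hD h hR (hmem _ ha0m).1 (hmem _ ha1).1
      ((hmem _ ha0m).2.trans (hmem _ ha1).2.symm) ha2
    have c2 := collideAt_frontOf hD h hR (hmem _ ha0m).1 (hmem _ hb1).1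
      ((hmem _ ha0m).2.trans (hmem _ hb1).2.symm) hb2
    have hset := hD.binary _ _ _ _ _ _ _ c1 c2
    have hm : D.frontOf j a ∈ ({D.frontOf j a0, D.frontOf j b} : Set Front) := by
      rw [← hset]; simp
    rcases hm with hm | hm
    · exact absurd hm.symm ha2
    · exact hm
  · intro a ha b hb he
    exact (Finset.mem_filter.1 hb).2 ((Finset.mem_filter.1 ha).2.trans he)

/-! ### The survivors -/

lemma leftLim_profile_succ (hD : D.Admissible) (h : D.Coherent j) (hR : D.Reached (j + 1)) (x : ℝ) :
    Function.leftLim (D.profile (j + 1)) x =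
      D.ε * ∑ r ∈ (D.realWaves j).filter (D.arrival j · < x), D.sgn r := by
  rw [show D.profile (j + 1) = fun x => D.ε * ∑ r ∈ (D.realWaves j).filter (D.arrival j · ≤ x),
    D.sgn r from funext (profile_succ hD h hR)]
  exact leftLim_sum_filter _ _ _ _ _

/-- The left state, the state of `r` and the right state are `ε` times `B`, `B` plus the signs of
the arriving waves up to `r`, and `B` plus the signs of all of them. So `B` drops out of both
conditions. -/
lemma survives_iff (hD : D.Admissible) (h : D.Coherent j) (hR : D.Reached (j + 1)) {r : ℕ}
    (hr : r ∈ D.arriving j) : D.Survives (j + 1) r ↔ r ∈ survivors (D.arriving j) D.sgn := by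
  obtain ⟨hr1, hr2⟩ := Finset.mem_filter.1 hr
  have hε := hD.ε_pos
  set A := D.arriving j with hA
  set x := D.collisionPoint (j + 1) with hx
  set B := ∑ r ∈ (D.realWaves j).filter (D.arrival j · < x), D.sgn r with hB
  have e1 : D.hatw r = D.ε * (B + ∑ q ∈ A.filter (· ≤ r), D.sgn q) := by
    rw [h.hatw_eq r hr1, hB, ← Finset.sum_union]
    · congr 1
      refine Finset.sum_congr ?_ fun _ _ => rfl
      ext q
      simp only [Finset.mem_filter, Finset.mem_union, hA, arriving]
      constructor
      · rintro ⟨h1, h2⟩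
        rcases (arrival_mono hD h hR h1 hr1 h2).lt_or_eq with h3 | h3
        · exact Or.inl ⟨h1, by rw [← hr2]; exact h3⟩
        · exact Or.inr ⟨⟨h1, h3.trans hr2⟩, h2⟩
      · rintro (⟨h1, h2⟩ | ⟨⟨h1, h2⟩, h3⟩)
        · refine ⟨h1, ?_⟩
          by_contra hcon
          have := arrival_mono hD h hR hr1 h1 (not_le.1 hcon).le
          rw [hr2] at this
          linarith
        · exact ⟨h1, h3⟩
    · rw [Finset.disjoint_left]
      intro q hq hq'
      simp only [Finset.mem_filter, hA, arriving] at hq hq'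
      exact hq.2.ne hq'.1.2
  have e2 : D.profile (j + 1) x = D.ε * (B + ∑ q ∈ A, D.sgn q) := by
    rw [profile_succ hD h hR, hB, ← Finset.sum_union]
    · congr 1
      refine Finset.sum_congr ?_ fun _ _ => rfl
      ext q
      simp only [Finset.mem_filter, Finset.mem_union, hA, arriving, le_iff_lt_or_eq]
      tauto
    · rw [Finset.disjoint_left]
      intro q hq hq'
      simp only [Finset.mem_filter, hA, arriving] at hq hq'
      exact hq.2.ne hq'.2
  have e3 := Finset.sum_filter_add_sum_filter_not A (· ≤ r) D.sgn
  simp only [not_le] at e3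
  rw [Survives, leftLim_profile_succ hD h hR, ← hx, ← hB, e1, e2, survivors, Finset.mem_filter,
    ← e3]
  set s := D.sgn r
  set P := ∑ q ∈ A.filter (· ≤ r), D.sgn q
  set T := ∑ q ∈ A.filter (r < ·), D.sgn q
  constructor
  · rintro ⟨h1, h2⟩
    refine ⟨hr, ?_, ?_⟩
    · have : D.ε * 1 ≤ D.ε * (s * P) := by linarith
      exact le_of_mul_le_mul_left this hε
    · have : D.ε * 0 ≤ D.ε * (s * T) := by linarith
      exact le_of_mul_le_mul_left this hε
  · rintro ⟨-, h1, h2⟩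
    constructor <;> nlinarith

lemma wavePos_succ {r : ℕ} (hr : r ∈ D.realWaves j) : D.wavePos (j + 1) r =
    if D.arrival j r ≠ D.collisionPoint (j + 1) ∨ D.Survives (j + 1) r then
      (D.arrival j r : WithTop ℝ) else ⊤ := by
  rw [wavePos]
  exact if_neg (mem_realWaves.1 hr).2

lemma realWaves_succ_subset (D : WavefrontData) (j : ℕ) : D.realWaves (j + 1) ⊆ D.realWaves j := by
  intro r hr
  obtain ⟨h1, h2⟩ := mem_realWaves.1 hr
  refine mem_realWaves.2 ⟨h1, fun h3 => h2 ?_⟩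
  rw [wavePos]
  exact if_pos h3

lemma realWaves_subset (D : WavefrontData) {i j : ℕ} (h : i ≤ j) :
    D.realWaves j ⊆ D.realWaves i := by
  induction j, h using Nat.le_induction with
  | base => exact Finset.Subset.refl _
  | succ j _ ih => exact (D.realWaves_succ_subset j).trans ih

lemma pos_succ {r : ℕ} (hr : r ∈ D.realWaves (j + 1)) : D.pos (j + 1) r = D.arrival j r := by
  have h1 := wavePos_succ (D.realWaves_succ_subset j hr)
  have h2 := (mem_realWaves.1 hr).2
  rw [h1] at h2
  apply pos_eq_of_wavePos_eq
  rw [h1]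
  split_ifs at h2 ⊢ with h3
  · rfl
  · exact absurd rfl h2

lemma mem_realWaves_succ (hD : D.Admissible) (h : D.Coherent j) (hR : D.Reached (j + 1)) {r : ℕ} :
    r ∈ D.realWaves (j + 1) ↔ r ∈ D.realWaves j ∧
      (r ∈ D.arriving j → r ∈ survivors (D.arriving j) D.sgn) := by
  constructor
  · intro hr
    have hr' := D.realWaves_succ_subset j hr
    refine ⟨hr', fun hA => ?_⟩
    have h2 := (mem_realWaves.1 hr).2
    rw [wavePos_succ hr'] at h2
    rw [← survives_iff hD h hR hA]
    by_contra hcon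
    rw [if_neg] at h2
    · exact h2 rfl
    · push Not
      exact ⟨(Finset.mem_filter.1 hA).2, hcon⟩
  · rintro ⟨hr, himp⟩
    refine mem_realWaves.2 ⟨mem_waves_of_mem_realWaves hr, ?_⟩
    rw [wavePos_succ hr, if_pos]
    · exact WithTop.coe_ne_top
    · by_cases hA : r ∈ D.arriving j
      · exact Or.inr ((survives_iff hD h hR hA).2 (himp hA))
      · exact Or.inl fun he => hA (Finset.mem_filter.2 ⟨hr, he⟩)

lemma survivors_arriving (hD : D.Admissible) (h : D.Coherent j) (hR : D.Reached (j + 1)) :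
    (∀ r ∈ survivors (D.arriving j) D.sgn,
      ∑ q ∈ (survivors (D.arriving j) D.sgn).filter (· ≤ r), D.sgn q =
        ∑ q ∈ (D.arriving j).filter (· ≤ r), D.sgn q) ∧
      ∑ q ∈ survivors (D.arriving j) D.sgn, D.sgn q = ∑ q ∈ D.arriving j, D.sgn q ∧
      ∀ r ∈ survivors (D.arriving j) D.sgn, ∀ r' ∈ survivors (D.arriving j) D.sgn,
        D.sgn r = D.sgn r' := by
  obtain ⟨L, R, hA, hLR, hL, hR', -⟩ := exists_arriving_eq hD h hR
  have hmem : ∀ r ∈ D.arriving j, r ∈ D.realWaves j := fun r hr => (Finset.mem_filter.1 hr).1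
  -- With a common sign nothing is canceled; the only other configuration is two wavefronts of
  -- opposite signs.
  by_cases hom : ∃ S : ℝ, (S = 1 ∨ S = -1) ∧ ∀ q ∈ D.arriving j, D.sgn q = S
  · obtain ⟨S, hS, hq⟩ := hom
    rw [survivors_eq_self hS hq]
    exact ⟨fun _ _ => rfl, rfl, fun r hr r' hr' => (hq r hr).trans (hq r' hr').symm⟩
  have hLm : ∀ a ∈ L, a ∈ D.realWaves j := fun a ha =>
    hmem a (by rw [hA]; exact Finset.mem_union_left _ ha)
  have hRm : ∀ a ∈ R, a ∈ D.realWaves j := fun a ha =>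
    hmem a (by rw [hA]; exact Finset.mem_union_right _ ha)
  have hsL : ∀ a ∈ L, ∀ b ∈ L, D.sgn a = D.sgn b := fun a ha b hb =>
    sgn_eq_of_frontOf_eq h (hLm a ha) (hLm b hb) (hL a ha b hb)
  have hsR : ∀ a ∈ R, ∀ b ∈ R, D.sgn a = D.sgn b := fun a ha b hb =>
    sgn_eq_of_frontOf_eq h (hRm a ha) (hRm b hb) (hR' a ha b hb)
  have hpm : ∀ a ∈ D.arriving j, D.sgn a = 1 ∨ D.sgn a = -1 := fun a ha =>
    sgn_eq_one_or hD (mem_waves_of_mem_realWaves (hmem a ha))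
  rcases L.eq_empty_or_nonempty with rfl | ⟨a, ha⟩
  · rw [Finset.empty_union] at hA
    rcases R.eq_empty_or_nonempty with rfl | ⟨b, hb⟩
    · exact absurd ⟨1, Or.inl rfl, by rw [hA]; simp⟩ hom
    · exact absurd ⟨D.sgn b, hpm b (hA ▸ hb), fun q hq => hsR q (hA ▸ hq) b hb⟩ hom
  · have haA : a ∈ D.arriving j := by rw [hA]; exact Finset.mem_union_left _ ha
    rcases R.eq_empty_or_nonempty with rfl | ⟨b, hb⟩
    · rw [Finset.union_empty] at hA
      exact absurd ⟨D.sgn a, hpm a haA, fun q hq => hsL q (hA ▸ hq) a ha⟩ hom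
    · have hbA : b ∈ D.arriving j := by rw [hA]; exact Finset.mem_union_right _ hb
      by_cases hs : D.sgn b = D.sgn a
      · refine absurd ⟨D.sgn a, hpm a haA, fun q hq => ?_⟩ hom
        rw [hA] at hq
        rcases Finset.mem_union.1 hq with hq | hq
        · exact hsL q hq a ha
        · exact (hsR q hq b hb).trans hs
      · have hs' : D.sgn b = -D.sgn a := by
          rcases hpm a haA with h1 | h1 <;> rcases hpm b hbA with h2 | h2 <;>
            first
            | exact absurd (h2.trans h1.symm) hs
            | simp [h1, h2]
        have hSS : D.sgn a * D.sgn a = 1 := by rcases hpm a haA with h1 | h1 <;> rw [h1] <;> norm_num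
        rw [hA]
        exact survivors_opposite hSS (fun q hq => hsL q hq a ha)
          (fun q hq => (hsR q hq b hb).trans hs') hLR

/-- Splitting a sum over the real waves at the next collision point. -/
lemma sum_realWaves_succ (hD : D.Admissible) (h : D.Coherent j) (hR : D.Reached (j + 1))
    (P : ℕ → Prop) [DecidablePred P]
    (hP : ∑ q ∈ (survivors (D.arriving j) D.sgn).filter P, D.sgn q =
      ∑ q ∈ (D.arriving j).filter P, D.sgn q) :
    ∑ q ∈ (D.realWaves (j + 1)).filter P, D.sgn q = ∑ q ∈ (D.realWaves j).filter P, D.sgn q := by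
  have hA : D.arriving j ⊆ D.realWaves j := Finset.filter_subset _ _
  have hB := survivors_subset (D.arriving j) D.sgn
  have e1 : D.realWaves (j + 1) = (D.realWaves j \ D.arriving j) ∪ survivors (D.arriving j) D.sgn := by
    ext r
    rw [mem_realWaves_succ hD h hR, Finset.mem_union, Finset.mem_sdiff]
    constructor
    · rintro ⟨h1, h2⟩
      by_cases h3 : r ∈ D.arriving j
      · exact Or.inr (h2 h3)
      · exact Or.inl ⟨h1, h3⟩
    · rintro (⟨h1, h2⟩ | h1)
      · exact ⟨h1, fun h3 => absurd h3 h2⟩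
      · exact ⟨hA (hB h1), fun _ => h1⟩
  have e2 : D.realWaves j = (D.realWaves j \ D.arriving j) ∪ D.arriving j :=
    (Finset.sdiff_union_of_subset hA).symm
  have d1 : Disjoint (D.realWaves j \ D.arriving j) (survivors (D.arriving j) D.sgn) :=
    Finset.disjoint_left.2 fun r hr hr' => (Finset.mem_sdiff.1 hr).2 (hB hr')
  have d2 : Disjoint (D.realWaves j \ D.arriving j) (D.arriving j) := Finset.sdiff_disjoint
  rw [e1, Finset.filter_union, Finset.sum_union (Finset.disjoint_filter_filter d1), hP]
  conv_rhs => rw [e2]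
  rw [Finset.filter_union, Finset.sum_union (Finset.disjoint_filter_filter d2)]

theorem coherent_succ (hD : D.Admissible) (h : D.Coherent j) (hR : D.Reached (j + 1)) :
    D.Coherent (j + 1) := by
  obtain ⟨s1, s2, s3⟩ := survivors_arriving hD h hR
  have hsub := D.realWaves_succ_subset j
  set B := survivors (D.arriving j) D.sgn with hB
  have hBA : B ⊆ D.arriving j := survivors_subset _ _
  have arrA : ∀ r ∈ D.arriving j, D.arrival j r = D.collisionPoint (j + 1) := fun r hr =>
    (Finset.mem_filter.1 hr).2
  -- A condition that does not separate the arriving waves holds for all or none of them, and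
  -- cancellation preserves their total sign.
  have dich : ∀ (P : ℕ → Prop) [DecidablePred P], (∀ a ∈ D.arriving j, ∀ b ∈ D.arriving j, P a → P b) →
      ∑ q ∈ B.filter P, D.sgn q = ∑ q ∈ (D.arriving j).filter P, D.sgn q := by
    intro P _ hP
    by_cases hex : ∃ a ∈ D.arriving j, P a
    · obtain ⟨a, ha, hPa⟩ := hex
      rw [Finset.filter_true_of_mem (s := B) (fun b hb => hP a ha b (hBA hb) hPa),
        Finset.filter_true_of_mem (s := D.arriving j) (fun b hb => hP a ha b hb hPa), s2]
    · push Not at hex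
      rw [Finset.filter_false_of_mem (s := B) (fun b hb => hex b (hBA hb)),
        Finset.filter_false_of_mem (s := D.arriving j) hex]
  refine ⟨fun x => ?_, fun r hr r' hr' hle => ?_, fun r hr => ?_, fun r hr r' hr' he => ?_⟩
  · have e1 : (D.realWaves (j + 1)).filter (fun r => D.wavePos (j + 1) r ≤ (x : WithTop ℝ)) =
        (D.realWaves (j + 1)).filter (D.arrival j · ≤ x) := by
      refine Finset.filter_congr fun r hr => ?_
      rw [wavePos_eq_coe hr, WithTop.coe_le_coe, pos_succ hr]
    rw [e1, profile_succ hD h hR, sum_realWaves_succ hD h hR]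
    exact dich _ fun a ha b hb hPa => by rw [arrA b hb, ← arrA a ha]; exact hPa
  · rw [wavePos_eq_coe hr, wavePos_eq_coe hr', WithTop.coe_le_coe, pos_succ hr, pos_succ hr']
    exact arrival_mono hD h hR (hsub hr) (hsub hr') hle
  · rw [h.hatw_eq r (hsub hr), sum_realWaves_succ hD h hR]
    by_cases hrA : r ∈ D.arriving j
    · exact s1 r (((mem_realWaves_succ hD h hR).1 hr).2 hrA)
    · refine dich _ fun a ha b hb hPa => ?_
      have ha' := (Finset.mem_filter.1 ha).1
      have hb' := (Finset.mem_filter.1 hb).1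
      by_contra hcon
      have h1 := arrival_mono hD h hR ha' (hsub hr) hPa
      have h2 := arrival_mono hD h hR (hsub hr) hb' (not_le.1 hcon).le
      rw [arrA a ha] at h1
      rw [arrA b hb] at h2
      exact hrA (Finset.mem_filter.2 ⟨hsub hr, le_antisymm h2 h1⟩)
  · rw [wavePos_eq_iff hr hr', pos_succ hr, pos_succ hr'] at he
    by_cases hx : D.arrival j r' = D.collisionPoint (j + 1)
    · have hrA : r ∈ D.arriving j := Finset.mem_filter.2 ⟨hsub hr, he.trans hx⟩
      have hrA' : r' ∈ D.arriving j := Finset.mem_filter.2 ⟨hsub hr', hx⟩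
      exact s3 r (((mem_realWaves_succ hD h hR).1 hr).2 hrA) r'
        (((mem_realWaves_succ hD h hR).1 hr').2 hrA')
    · exact sgn_eq_of_frontOf_eq h (hsub hr) (hsub hr')
        (frontOf_eq_of_arrival_eq hD h hR (hsub hr) (hsub hr') he hx)

/-- When there are no more collisions the state is repeated, so a missing collision cannot be
followed by an actual one. -/
lemma reached_of_succ (h : D.Reached (j + 1)) : D.Reached j := by
  cases j with
  | zero => trivial
  | succ i =>
    by_contra hcon
    apply hcon
    change (D.collisionDelays (D.time i) (D.profile i)).Nonempty
    have h1 : ¬ (D.collisionDelays (D.state i).1 (D.state i).2).Nonempty := hcon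
    have hst : D.state (i + 1) = D.state i := by rw [state, if_neg h1]
    have h2 : (D.collisionDelays (D.time (i + 1)) (D.profile (i + 1))).Nonempty := h
    rwa [time, profile, hst] at h2

lemma reached_of_le {i : ℕ} (h : D.Reached j) (hij : i ≤ j) : D.Reached i := by
  induction j, hij using Nat.le_induction with
  | base => exact h
  | succ j _ ih => exact ih (reached_of_succ h)

theorem coherent (hD : D.Admissible) (hR : D.Reached j) : D.Coherent j := by
  induction j with
  | zero => exact coherent_zero hD
  | succ j ih => exact coherent_succ hD (ih (reached_of_succ hR)) hR

/-! ### The values of `v` along the waves -/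

lemma v_leftLim (hD : D.Admissible) (t x : ℝ) :
    Function.leftLim (D.v t) x = Function.leftLim D.v₀ (x + t) := by
  obtain ⟨F, hF⟩ := hD.v_step
  exact StepOn.leftLim_shift (F := F) hF t x

lemma time_succ_eq : D.time (j + 1) = D.time j + D.delay j := by rw [delay]; ring

/-- As `x + t` grows along the wave, a jump of `v₀` passed before the next collision time would be a
front of the first family crossed too early. Waves arriving at one point therefore carry the same
value of `v`. -/
lemma waveV_eq_leftLim (hD : D.Admissible) (h : D.Coherent j) (hR : D.Reached (j + 1)) {r : ℕ}
    (hr : r ∈ D.realWaves j) :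
    D.waveV j r = Function.leftLim D.v₀ (D.arrival j r + D.time (j + 1)) := by
  obtain ⟨F, hF⟩ := hD.v_step
  have hτ := delay_pos hD h hR
  have hc := h.neg_one_lt_waveSpeed hD hr
  symm
  refine StepOn.leftLim_eq_of_no_jump (F := F) hF (a := D.pos j r + D.time j) ?_ fun z h1 h2 => ?_
  · rw [time_succ_eq, arrival]; nlinarith
  · by_contra hne
    have hm : (⟨.first, z - D.time j, -1⟩ : Front) ∈ D.fronts (D.time j) (D.profile j) := by
      refine first_mem_fronts.2 ⟨?_, rfl⟩
      rw [v_leftLim hD, v, sub_add_cancel]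
      exact hne
    have := fronts_le hD h hR (frontOf_mem hD h hr) hm (show D.pos j r < z - D.time j by linarith)
    change D.arrival j r ≤ z - D.time j + -1 * D.delay j at this
    rw [time_succ_eq] at h2
    linarith

/-- The value of `v` along a wave changes only at a transversal interaction. -/
lemma transversal_of_waveV_ne (hD : D.Admissible) (h : D.Coherent j) (hR : D.Reached (j + 1))
    {r : ℕ} (hr : r ∈ D.realWaves (j + 1)) (hne : D.waveV (j + 1) r ≠ D.waveV j r) :
    D.IsTransversal (j + 1) ∧ D.pos (j + 1) r = D.collisionPoint (j + 1) ∧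
      |D.waveV (j + 1) r - D.waveV j r| = D.firstStrength (j + 1) := by
  have hr' := D.realWaves_succ_subset j hr
  have h1 := waveV_eq_leftLim hD h hR hr'
  have h2 : D.waveV (j + 1) r = D.v₀ (D.arrival j r + D.time (j + 1)) := by
    rw [waveV, pos_succ hr, v]
  rw [h1, h2] at hne
  have hm : (⟨.first, D.arrival j r + D.delay j, -1⟩ : Front) ∈
      D.fronts (D.time j) (D.profile j) := by
    refine first_mem_fronts.2 ⟨?_, rfl⟩
    rw [v_leftLim hD, v, add_assoc, add_comm (D.delay j), ← time_succ_eq]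
    exact hne.symm
  have hcol := collideAt_of_eq hR hm (frontOf_mem hD h hr') (by simp [frontOf])
    (by change _ + -1 * _ = D.arrival j r; ring)
  have hx : D.collisionPoint (j + 1) = D.arrival j r := hcol.collisionPoint_eq hD
  refine ⟨⟨_, _, _, hcol, rfl, rfl⟩, by rw [pos_succ hr, hx], ?_⟩
  rw [firstStrength, v_leftLim hD, hx, h1, h2, v]

/-- One of the two colliding fronts belongs to the first family, which leaves room for a single
front of waves. -/
lemma frontOf_eq_of_transversal (hD : D.Admissible) (h : D.Coherent j) (hR : D.Reached (j + 1))
    (hT : D.IsTransversal (j + 1)) {r r' : ℕ} (hr : r ∈ D.arriving j) (hr' : r' ∈ D.arriving j) :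
    D.frontOf j r = D.frontOf j r' := by
  by_contra hne
  obtain ⟨φ, ψ, x, hcol, hφ, -⟩ := hT
  obtain ⟨hr1, hr2⟩ := Finset.mem_filter.1 hr
  obtain ⟨hr1', hr2'⟩ := Finset.mem_filter.1 hr'
  have hset := hD.binary _ _ _ _ _ _ _ hcol
    (collideAt_frontOf hD h hR hr1 hr1' (hr2.trans hr2'.symm) hne)
  have hm : φ ∈ ({D.frontOf j r, D.frontOf j r'} : Set Front) := by rw [← hset]; simp
  rcases hm with rfl | hm
  · simp [frontOf] at hφ
  · rw [Set.mem_singleton_iff] at hm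
    rw [hm] at hφ
    simp [frontOf] at hφ

lemma realWaves_succ_of_homogeneous (hD : D.Admissible) (h : D.Coherent j) (hR : D.Reached (j + 1))
    (hom : ∀ r ∈ D.arriving j, ∀ r' ∈ D.arriving j, D.sgn r = D.sgn r') :
    D.realWaves (j + 1) = D.realWaves j := by
  refine Finset.Subset.antisymm (D.realWaves_succ_subset j) fun r hr => ?_
  refine (mem_realWaves_succ hD h hR).2 ⟨hr, fun hA => ?_⟩
  rw [survivors_eq_self (sgn_eq_one_or hD (mem_waves_of_mem_realWaves hr))
    (fun q hq => hom q hq r hA)]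
  exact hA

lemma realWaves_succ_of_transversal (hD : D.Admissible) (h : D.Coherent j) (hR : D.Reached (j + 1))
    (hT : D.IsTransversal (j + 1)) : D.realWaves (j + 1) = D.realWaves j :=
  realWaves_succ_of_homogeneous hD h hR fun _ hr _ hr' =>
    sgn_eq_of_frontOf_eq h (Finset.mem_filter.1 hr).1 (Finset.mem_filter.1 hr').1
      (frontOf_eq_of_transversal hD h hR hT hr hr')

lemma joined_iff {r r' : ℕ} (hr : r ∈ D.realWaves j) (hr' : r' ∈ D.realWaves j) :
    D.Joined j r r' ↔ D.frontOf j r = D.frontOf j r' := by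
  rw [Joined, frontOf_eq_iff, wavePos_eq_iff hr hr']

lemma arrival_eq_of_frontOf_eq {r r' : ℕ} (h : D.frontOf j r = D.frontOf j r') :
    D.arrival j r = D.arrival j r' := by
  obtain ⟨h1, h2⟩ := frontOf_eq_iff.1 h
  rw [arrival, arrival, h1, h2]

lemma frontOf_eq_of_pos_eq (hD : D.Admissible) (h : D.Coherent j) (hR : D.Reached (j + 1))
    {r r' : ℕ} (h1 : D.pos j r = D.pos j r') (h2 : D.arrival j r = D.arrival j r') :
    D.frontOf j r = D.frontOf j r' := by
  refine frontOf_eq_iff.2 ⟨h1, ?_⟩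
  unfold arrival at h2
  rw [h1] at h2
  exact mul_right_cancel₀ (delay_pos hD h hR).ne' (add_left_cancel h2)

/-! ### Wavefronts as shocks -/

lemma filter_frontOf_eq (a : ℕ) : (D.realWaves j).filter (fun r => D.frontOf j r = D.frontOf j a) =
    (D.wavesAt j (D.pos j a : WithTop ℝ)).filter (fun r => D.waveSpeed j r = D.waveSpeed j a) := by
  ext r
  simp only [Finset.mem_filter, mem_wavesAt, frontOf_eq_iff, and_assoc]

/-- Each wavefront is a shock, and moves with the average speed. -/
lemma isShock_front (hD : D.Admissible) (h : D.Coherent j) {a : ℕ} (ha : a ∈ D.realWaves j) :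
    IsShock ((D.realWaves j).filter fun r => D.frontOf j r = D.frontOf j a)
        (D.cellSlope fun z => D.f z (D.waveV j a)) ∧
      average ((D.realWaves j).filter fun r => D.frontOf j r = D.frontOf j a)
        (D.cellSlope fun z => D.f z (D.waveV j a)) = D.waveSpeed j a := by
  have henv := h.isEnvelope_waveSpeed hD (D.pos j a)
  rw [filter_frontOf_eq]
  exact ⟨henv.isShock_level _, henv.average_level
    ⟨a, Finset.mem_filter.2 ⟨mem_wavesAt.2 ⟨ha, rfl⟩, rfl⟩⟩⟩

/-- The speed of a wave does not change if its wavefront does not meet another one. -/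
lemma waveSpeed_succ_of_not_arriving (hD : D.Admissible) (h : D.Coherent j)
    (hR : D.Reached (j + 1)) {r : ℕ} (hr : r ∈ D.realWaves j) (hA : r ∉ D.arriving j) :
    D.waveSpeed (j + 1) r = D.waveSpeed j r := by
  have h' := coherent_succ hD h hR
  have hx : D.arrival j r ≠ D.collisionPoint (j + 1) := fun he =>
    hA (Finset.mem_filter.2 ⟨hr, he⟩)
  have hmem : ∀ q ∈ D.realWaves j, D.arrival j q = D.arrival j r → q ∈ D.realWaves (j + 1) := by
    intro q hq he
    refine (mem_realWaves_succ hD h hR).2 ⟨hq, fun hqA => ?_⟩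
    exact absurd (he.symm.trans (Finset.mem_filter.1 hqA).2) hx
  have hr1 := hmem r hr rfl
  -- The waves at the new position form exactly the old wavefront of `r`, with the same `v`. Being a
  -- shock, it keeps its average speed.
  have hset : D.wavesAt (j + 1) (D.pos (j + 1) r : WithTop ℝ) =
      (D.realWaves j).filter (fun q => D.frontOf j q = D.frontOf j r) := by
    ext q
    rw [mem_wavesAt, Finset.mem_filter]
    constructor
    · rintro ⟨h1, h2⟩
      rw [pos_succ h1, pos_succ hr1] at h2
      have h3 := D.realWaves_succ_subset j h1
      exact ⟨h3, frontOf_eq_of_arrival_eq hD h hR h3 hr h2 hx⟩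
    · rintro ⟨h1, h2⟩
      have h3 := arrival_eq_of_frontOf_eq h2
      have h4 := hmem q h1 h3
      exact ⟨h4, by rw [pos_succ h4, pos_succ hr1, h3]⟩
  have hV : D.waveV (j + 1) r = D.waveV j r := by
    by_contra hne
    have := (transversal_of_waveV_ne hD h hR hr1 hne).2.1
    rw [pos_succ hr1] at this
    exact hx this
  have henv := h'.isEnvelope_waveSpeed hD (D.pos (j + 1) r)
  obtain ⟨hs, havg⟩ := isShock_front hD h hr
  change IsEnvelope _ (D.cellSlope fun z => D.f z (D.waveV (j + 1) r)) _ at henv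
  rw [hset, hV] at henv
  rw [henv.eq_average hs (Finset.mem_filter.2 ⟨hr, rfl⟩), havg]

/-! ### Times and positions -/

lemma time_lt_succ (hD : D.Admissible) (hR : D.Reached (j + 1)) : D.time j < D.time (j + 1) := by
  have := delay_pos hD (coherent hD (reached_of_succ hR)) hR
  rw [time_succ_eq]; linarith

lemma time_mono (hD : D.Admissible) {i : ℕ} (hR : D.Reached j) (hij : i ≤ j) :
    D.time i ≤ D.time j := by
  induction j, hij using Nat.le_induction with
  | base => exact le_rfl
  | succ j _ ih => exact (ih (reached_of_succ hR)).trans (time_lt_succ hD hR).le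

lemma time_nonneg (hD : D.Admissible) (hR : D.Reached j) : 0 ≤ D.time j :=
  time_mono hD hR (Nat.zero_le j)

lemma stage_eq (hD : D.Admissible) {t : ℝ} (hR : D.Reached j) (h1 : D.time j ≤ t)
    (h2 : D.Reached (j + 1) → t < D.time (j + 1)) : D.stage t = j := by
  refine IsGreatest.csSup_eq ⟨⟨hR, h1⟩, fun k ⟨hk, hkt⟩ => ?_⟩
  by_contra hcon
  push Not at hcon
  have h3 := h2 (reached_of_le hk hcon)
  have h4 := time_mono hD hk hcon
  linarith

lemma stage_time (hD : D.Admissible) (hR : D.Reached j) : D.stage (D.time j) = j :=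
  stage_eq hD hR le_rfl fun h => time_lt_succ hD h

lemma posAt_time (hD : D.Admissible) (hR : D.Reached j) (p : ℕ) :
    D.posAt (D.time j) p = D.wavePos j p := by
  rw [posAt, stage_time hD hR]
  simp only [sub_self, mul_zero, add_zero]
  cases D.wavePos j p <;> rfl

lemma exists_stage (hD : D.Admissible) (hR : D.Reached j) {t : ℝ} (h0 : 0 ≤ t) (ht : t ≤ D.time j) :
    ∃ i ≤ j, D.time i ≤ t ∧ D.stage t = i ∧ (i < j → t < D.time (i + 1)) := by
  induction j with
  | zero =>
    have : t = D.time 0 := le_antisymm ht h0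
    exact ⟨0, le_rfl, this.ge, by rw [this]; exact stage_time hD hR, fun h => absurd h (lt_irrefl _)⟩
  | succ j ih =>
    rcases ht.eq_or_lt with rfl | hlt
    · exact ⟨j + 1, le_rfl, le_rfl, stage_time hD hR, fun h => absurd h (lt_irrefl _)⟩
    rcases le_or_gt t (D.time j) with h1 | h1
    · obtain ⟨i, hi, h2, h3, h4⟩ := ih (reached_of_succ hR) h1
      refine ⟨i, by omega, h2, h3, fun _ => ?_⟩
      rcases hi.eq_or_lt with rfl | hi
      · exact hlt
      · exact h4 hi
    · exact ⟨j, by omega, h1.le, stage_eq hD (reached_of_succ hR) h1.le fun _ => hlt, fun _ => hlt⟩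

lemma posAt_eq {i p : ℕ} {t : ℝ} (ht : D.stage t = i) (hp : p ∈ D.realWaves i) :
    D.posAt t p = ((D.pos i p + D.waveSpeed i p * (t - D.time i) : ℝ) : WithTop ℝ) := by
  rw [posAt, ht, wavePos_eq_coe hp]
  rfl

/-- Different positions stay different until the next collision. So real times can be replaced by
collision indices in `Interacted` and `lastTime`. -/
lemma pos_eq_of_posAt_eq (hD : D.Admissible) {i s s' : ℕ} {t : ℝ} (hR : D.Reached i)
    (ht : D.stage t = i) (h1 : D.time i ≤ t) (h2 : t = D.time i ∨ D.Reached (i + 1) ∧ t < D.time (i + 1))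
    (hs : s ∈ D.realWaves i) (hs' : s' ∈ D.realWaves i) (he : D.posAt t s = D.posAt t s') :
    D.pos i s = D.pos i s' := by
  have h := coherent hD hR
  rw [posAt_eq ht hs, posAt_eq ht hs', WithTop.coe_inj] at he
  rcases h2 with rfl | ⟨hR', h2⟩
  · simpa using he
  · have hθ : t - D.time i < D.delay i := by rw [delay]; linarith
    rcases lt_trichotomy (D.pos i s) (D.pos i s') with hlt | heq | hlt
    · have := fronts_lt hD h hR' (frontOf_mem hD h hs) (frontOf_mem hD h hs') hlt
        (sub_nonneg.2 h1) hθ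
      exact absurd he this.ne
    · exact heq
    · have := fronts_lt hD h hR' (frontOf_mem hD h hs') (frontOf_mem hD h hs) hlt
        (sub_nonneg.2 h1) hθ
      exact absurd he this.ne'

lemma interacted_iff (hD : D.Admissible) (hR : D.Reached j) {s s' : ℕ} (hs : s ∈ D.realWaves j)
    (hs' : s' ∈ D.realWaves j) : D.Interacted j s s' ↔ ∃ i ≤ j, D.pos i s = D.pos i s' := by
  constructor
  · rintro ⟨t, h0, ht, he⟩
    obtain ⟨i, hi, h1, h2, h3⟩ := exists_stage hD hR h0 ht
    refine ⟨i, hi, pos_eq_of_posAt_eq hD (reached_of_le hR hi) h2 h1 ?_ (D.realWaves_subset hi hs)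
      (D.realWaves_subset hi hs') he⟩
    rcases hi.eq_or_lt with rfl | hlt
    · exact Or.inl (le_antisymm ht h1)
    · exact Or.inr ⟨reached_of_le hR hlt, h3 hlt⟩
  · rintro ⟨i, hi, he⟩
    have hRi := reached_of_le hR hi
    refine ⟨D.time i, time_nonneg hD hRi, time_mono hD hR hi, ?_⟩
    rw [posAt_time hD hRi, posAt_time hD hRi]
    exact (wavePos_eq_iff (D.realWaves_subset hi hs) (D.realWaves_subset hi hs')).2 he

/-- `k` is the index of the last time at which `s` and `s'` have the same position. -/
structure LastMeeting (D : WavefrontData) (k j s s' : ℕ) : Prop where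
  le : k ≤ j
  left_mem : s ∈ D.realWaves j
  right_mem : s' ∈ D.realWaves j
  eq : D.pos k s = D.pos k s'
  ne : ∀ i, k < i → i ≤ j → D.pos i s ≠ D.pos i s'

lemma exists_lastMeeting {s s' : ℕ} (hs : s ∈ D.realWaves j) (hs' : s' ∈ D.realWaves j)
    (h : ∃ i ≤ j, D.pos i s = D.pos i s') : ∃ k, D.LastMeeting k j s s' := by
  obtain ⟨i, hi, he⟩ := h
  set k := Nat.findGreatest (fun i => D.pos i s = D.pos i s') j with hk
  refine ⟨k, Nat.findGreatest_le j, hs, hs',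
    Nat.findGreatest_spec (P := fun i => D.pos i s = D.pos i s') hi he, fun i h1 h2 => ?_⟩
  exact Nat.findGreatest_is_greatest h1 h2

lemma LastMeeting.of_le {k i s s' : ℕ} (h : D.LastMeeting k j s s') (h1 : k ≤ i) (h2 : i ≤ j) :
    D.LastMeeting k i s s' :=
  ⟨h1, D.realWaves_subset h2 h.left_mem, D.realWaves_subset h2 h.right_mem, h.eq,
    fun i' h3 h4 => h.ne i' h3 (h4.trans h2)⟩

lemma LastMeeting.lastTime_eq (hD : D.Admissible) (hR : D.Reached j) {k s s' : ℕ}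
    (h : D.LastMeeting k j s s') : D.lastTime j s s' = D.time k := by
  have hRk := reached_of_le hR h.le
  have hsk := D.realWaves_subset h.le h.left_mem
  have hsk' := D.realWaves_subset h.le h.right_mem
  refine IsGreatest.csSup_eq ⟨⟨time_nonneg hD hRk, time_mono hD hR h.le, ?_⟩, ?_⟩
  · rw [posAt_time hD hRk, posAt_time hD hRk]
    exact (wavePos_eq_iff hsk hsk').2 h.eq
  · rintro t ⟨h0, ht, he⟩
    obtain ⟨i, hi, h1, h2, h3⟩ := exists_stage hD hR h0 ht
    have hpos : D.pos i s = D.pos i s' := by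
      refine pos_eq_of_posAt_eq hD (reached_of_le hR hi) h2 h1 ?_
        (D.realWaves_subset hi h.left_mem) (D.realWaves_subset hi h.right_mem) he
      rcases hi.eq_or_lt with rfl | hlt
      · exact Or.inl (le_antisymm ht h1)
      · exact Or.inr ⟨reached_of_le hR hlt, h3 hlt⟩
    rcases lt_trichotomy i k with hik | rfl | hik
    · exact (h3 (hik.trans_le h.le)).le.trans (time_mono hD hRk hik)
    · rcases hi.eq_or_lt with rfl | hlt
      · exact ht
      -- Coinciding again later in the stage `k` would mean equal speeds, hence equal positions at
      -- the next collision, against the choice of `k`.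
      · by_contra hcon
        push Not at hcon
        rw [posAt_eq h2 hsk, posAt_eq h2 hsk', WithTop.coe_inj, hpos] at he
        have hc := mul_right_cancel₀ (sub_pos.2 hcon).ne' (add_left_cancel he)
        refine h.ne (i + 1) (Nat.lt_succ_self i) hlt ?_
        rw [pos_succ (D.realWaves_subset hlt h.left_mem), pos_succ (D.realWaves_subset hlt h.right_mem)]
        exact arrival_eq_of_frontOf_eq (frontOf_eq_iff.2 ⟨hpos, hc⟩)
    · exact absurd hpos (h.ne i hik hi)

lemma LastMeeting.commonInterval_eq (hD : D.Admissible) (hR : D.Reached j) {k s s' : ℕ}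
    (h : D.LastMeeting k j s s') : D.commonInterval j s s' =
      (D.realWaves j).filter (fun p => D.pos k p = D.pos k s) := by
  have hRk := reached_of_le hR h.le
  unfold commonInterval
  rw [h.lastTime_eq hD hR]
  refine Finset.filter_congr fun p hp => ?_
  rw [posAt_time hD hRk, posAt_time hD hRk]
  exact wavePos_eq_iff (D.realWaves_subset h.le hp) (D.realWaves_subset h.le h.left_mem)

/-! ### Interactions -/

/-- The wavefronts `L` and `R`, of the same sign, interact at the time `t_{j+1}`, in a region where
`v` takes the value `v`. -/
structure Interaction (D : WavefrontData) (j : ℕ) (L R : Finset ℕ) (v : ℝ) : Prop where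
  left_nonempty : L.Nonempty
  right_nonempty : R.Nonempty
  arriving_eq : D.arriving j = L ∪ R
  lt : ∀ a ∈ L, ∀ b ∈ R, a < b
  pos_lt : ∀ a ∈ L, ∀ b ∈ R, D.pos j a < D.pos j b
  sgn_eq : ∀ a ∈ L ∪ R, ∀ b ∈ L ∪ R, D.sgn a = D.sgn b
  waveV_eq : ∀ a ∈ L ∪ R, D.waveV j a = v
  not_transversal : ¬ D.IsTransversal (j + 1)
  realWaves_eq : D.realWaves (j + 1) = D.realWaves j
  speed_left : ∀ a ∈ L, D.waveSpeed j a = average L (D.cellSlope fun z => D.f z v)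
  speed_right : ∀ a ∈ R, D.waveSpeed j a = average R (D.cellSlope fun z => D.f z v)
  average_lt : average R (D.cellSlope fun z => D.f z v) < average L (D.cellSlope fun z => D.f z v)
  speed_succ : ∀ a ∈ L ∪ R, D.waveSpeed (j + 1) a =
    average (L ∪ R) (D.cellSlope fun z => D.f z v)

lemma jump_mul_pos (hD : D.Admissible) (h : D.Coherent j) {a b : ℕ} (ha : a ∈ D.realWaves j)
    (hb : b ∈ D.realWaves j) (hpos : 0 < D.jump j (D.pos j a) * D.jump j (D.pos j b)) :
    D.sgn a = D.sgn b := by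
  have key : ∀ c ∈ D.realWaves j, ∃ n : ℝ, 0 ≤ n ∧ D.jump j (D.pos j c) = D.sgn c * n := by
    intro c hc
    refine ⟨D.ε * (D.wavesAt j (D.pos j c : WithTop ℝ)).card, ?_, ?_⟩
    · have := hD.ε_pos; positivity
    · rw [jump, h.profile_sub_leftLim, sum_const_sign (S := D.sgn c) fun q hq =>
        h.sgn_eq_of_pos_eq (mem_wavesAt.1 hq).1 hc (mem_wavesAt.1 hq).2]
      ring
  obtain ⟨n, hn, e1⟩ := key a ha
  obtain ⟨m, hm, e2⟩ := key b hb
  rw [e1, e2] at hpos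
  have hnm := mul_nonneg hn hm
  rcases sgn_eq_one_or hD (mem_waves_of_mem_realWaves ha) with h1 | h1 <;>
    rcases sgn_eq_one_or hD (mem_waves_of_mem_realWaves hb) with h2 | h2 <;>
    rw [h1, h2] <;> rw [h1, h2] at hpos <;> nlinarith

theorem exists_interaction (hD : D.Admissible) (hI : D.IsInteraction (j + 1)) :
    ∃ L R v, D.Interaction j L R v := by
  obtain ⟨φ, ψ, x, hcol, hφ, hψ, hpos⟩ := hI
  have hR : D.Reached (j + 1) := hcol.1
  have h := coherent hD (reached_of_succ hR)
  have h' := coherent hD hR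
  have hτ := delay_pos hD h hR
  have hx := hcol.collisionPoint_eq hD
  obtain ⟨-, hφm, hψm, hne, e1, e2⟩ := hcol
  obtain ⟨a, ha, rfl⟩ := exists_frontOf hD h hφm hφ
  obtain ⟨b, hb, rfl⟩ := exists_frontOf hD h hψm hψ
  have haA : a ∈ D.arriving j := Finset.mem_filter.2 ⟨ha, e1.trans hx.symm⟩
  have hbA : b ∈ D.arriving j := Finset.mem_filter.2 ⟨hb, e2.trans hx.symm⟩
  have hsab := jump_mul_pos hD h ha hb hpos
  obtain ⟨L, R, hA, hLR, hL, hR', hLR'⟩ := exists_arriving_eq hD h hR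
  have harr : ∀ q ∈ L ∪ R, q ∈ D.realWaves j ∧ D.arrival j q = D.collisionPoint (j + 1) :=
    fun q hq => Finset.mem_filter.1 (hA ▸ hq)
  have hLm : ∀ q ∈ L, q ∈ D.realWaves j := fun q hq => (harr q (Finset.mem_union_left _ hq)).1
  have hRm : ∀ q ∈ R, q ∈ D.realWaves j := fun q hq => (harr q (Finset.mem_union_right _ hq)).1
  have hsL : ∀ a ∈ L, ∀ b ∈ L, D.sgn a = D.sgn b := fun a ha b hb =>
    sgn_eq_of_frontOf_eq h (hLm a ha) (hLm b hb) (hL a ha b hb)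
  have hsR : ∀ a ∈ R, ∀ b ∈ R, D.sgn a = D.sgn b := fun a ha b hb =>
    sgn_eq_of_frontOf_eq h (hRm a ha) (hRm b hb) (hR' a ha b hb)
  have hne' : D.frontOf j a ≠ D.frontOf j b := hne
  have hrep : ∃ a' ∈ L, ∃ b' ∈ R, D.sgn a' = D.sgn b' := by
    rw [hA] at haA hbA
    rcases Finset.mem_union.1 haA with h1 | h1 <;> rcases Finset.mem_union.1 hbA with h2 | h2
    · exact absurd (hL a h1 b h2) hne'
    · exact ⟨a, h1, b, h2, hsab⟩
    · exact ⟨b, h2, a, h1, hsab.symm⟩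
    · exact absurd (hR' a h1 b h2) hne'
  obtain ⟨a', ha', b', hb', hs⟩ := hrep
  have hsgn : ∀ p ∈ L ∪ R, ∀ q ∈ L ∪ R, D.sgn p = D.sgn q := by
    have key : ∀ p ∈ L ∪ R, D.sgn p = D.sgn a' := by
      intro p hp
      rcases Finset.mem_union.1 hp with hp | hp
      · exact hsL p hp a' ha'
      · exact (hsR p hp b' hb').trans hs.symm
    exact fun p hp q hq => (key p hp).trans (key q hq).symm
  have hrw : D.realWaves (j + 1) = D.realWaves j :=
    realWaves_succ_of_homogeneous hD h hR (by rw [hA]; exact hsgn)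
  have hnT : ¬ D.IsTransversal (j + 1) := fun hT =>
    hne' (frontOf_eq_of_transversal hD h hR hT haA hbA)
  -- Both fronts see the left limit of `v` at the collision point, so one flux serves both.
  have hV : ∀ q ∈ L ∪ R, D.waveV j q =
      Function.leftLim D.v₀ (D.collisionPoint (j + 1) + D.time (j + 1)) := by
    intro q hq
    rw [waveV_eq_leftLim hD h hR (harr q hq).1, (harr q hq).2]
  set v := Function.leftLim D.v₀ (D.collisionPoint (j + 1) + D.time (j + 1)) with hv
  have hfrontset : ∀ (C C' : Finset ℕ) (c : ℕ), C ∪ C' = L ∪ R → c ∈ C →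
      (∀ p ∈ C, ∀ q ∈ C, D.frontOf j p = D.frontOf j q) →
      (∀ p ∈ C, ∀ q ∈ C', D.frontOf j p ≠ D.frontOf j q) →
      (D.realWaves j).filter (fun r => D.frontOf j r = D.frontOf j c) = C := by
    intro C C' c hU hc h1 h2
    ext r
    rw [Finset.mem_filter]
    constructor
    · rintro ⟨hr, he⟩
      have hrA : r ∈ D.arriving j := Finset.mem_filter.2 ⟨hr,
        (arrival_eq_of_frontOf_eq he).trans (harr c (hU ▸ Finset.mem_union_left _ hc)).2⟩
      rw [hA, ← hU] at hrA
      rcases Finset.mem_union.1 hrA with hr | hr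
      · exact hr
      · exact absurd he.symm (h2 c hc r hr)
    · intro hr
      exact ⟨(harr r (hU ▸ Finset.mem_union_left _ hr)).1, h1 r hr c hc⟩
  have shock : ∀ (C C' : Finset ℕ) (c : ℕ), C ∪ C' = L ∪ R → c ∈ C →
      (∀ p ∈ C, ∀ q ∈ C, D.frontOf j p = D.frontOf j q) →
      (∀ p ∈ C, ∀ q ∈ C', D.frontOf j p ≠ D.frontOf j q) →
      IsShock C (D.cellSlope fun z => D.f z v) ∧
        ∀ q ∈ C, D.waveSpeed j q = average C (D.cellSlope fun z => D.f z v) := by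
    intro C C' c hU hc h1 h2
    have hc' : c ∈ L ∪ R := hU ▸ Finset.mem_union_left _ hc
    obtain ⟨k1, k2⟩ := isShock_front hD h (harr c hc').1
    rw [hfrontset C C' c hU hc h1 h2, hV c hc'] at k1 k2
    exact ⟨k1, fun q hq => by rw [k2]; exact (frontOf_eq_iff.1 (h1 q hq c hc)).2⟩
  obtain ⟨shL, spL⟩ := shock L R a' rfl ha' hL hLR'
  obtain ⟨shR, spR⟩ := shock R L b' (Finset.union_comm _ _) hb' hR'
    (fun p hp q hq he => hLR' q hq p hp he.symm)
  have hplt : ∀ p ∈ L, ∀ q ∈ R, D.pos j p < D.pos j q := by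
    intro p hp q hq
    refine lt_of_le_of_ne (h.pos_mono (hLm p hp) (hRm q hq) (hLR p hp q hq).le) fun he => ?_
    exact hLR' p hp q hq (frontOf_eq_of_pos_eq hD h hR he
      ((harr p (Finset.mem_union_left _ hp)).2.trans (harr q (Finset.mem_union_right _ hq)).2.symm))
  -- `L` starts further left and arrives at the same point, so it is faster.
  have havg : average R (D.cellSlope fun z => D.f z v) <
      average L (D.cellSlope fun z => D.f z v) := by
    rw [← spL a' ha', ← spR b' hb']
    have e3 := (harr a' (Finset.mem_union_left _ ha')).2.trans
      (harr b' (Finset.mem_union_right _ hb')).2.symm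
    have e4 := hplt a' ha' b' hb'
    unfold arrival at e3
    by_contra hcon
    push Not at hcon
    nlinarith
  refine ⟨L, R, v, ⟨a', ha'⟩, ⟨b', hb'⟩, hA, hLR, hplt, hsgn, hV, hnT, hrw, spL, spR, havg, fun q hq => ?_⟩
  have hset : D.wavesAt (j + 1) (D.collisionPoint (j + 1) : WithTop ℝ) = L ∪ R := by
    ext r
    rw [mem_wavesAt, ← hA, arriving, Finset.mem_filter, hrw]
    refine and_congr_right fun hr => ?_
    rw [pos_succ (hrw ▸ hr)]
  have hq1 : q ∈ D.realWaves (j + 1) := hrw ▸ (harr q hq).1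
  have hVq : D.v (D.time (j + 1)) (D.collisionPoint (j + 1)) = v := by
    have h1 : D.waveV (j + 1) q = D.waveV j q := by
      by_contra hcon
      exact hnT (transversal_of_waveV_ne hD h hR hq1 hcon).1
    rw [waveV, pos_succ hq1, (harr q hq).2, hV q hq] at h1
    exact h1
  have henv := h'.isEnvelope_waveSpeed hD (D.collisionPoint (j + 1))
  rw [hset, hVq] at henv
  exact henv.eq_average (shL.union shR hLR havg.le) hq

end WavefrontData

open MeasureTheory

/-! ### Second differences -/

/-- The difference of the increments of `g` on the cells `[c, c + ε]` and `[a, a + ε]`. -/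
def secondDiff (ε : ℝ) (g : ℝ → ℝ) (a c : ℝ) : ℝ := (g (c + ε) - g c) - (g (a + ε) - g a)

/-- The kernel that expresses the second difference of a function by its second derivative. -/
def diffKernel (ε a c z : ℝ) : ℝ := (c + ε - z) - max (c - z) 0 - max (a + ε - z) 0

lemma continuous_diffKernel (ε a c : ℝ) : Continuous (diffKernel ε a c) := by
  unfold diffKernel
  fun_prop

/-- The kernel is a trapezoid that vanishes at `a` and at `c + ε` and has height at most `ε`. -/
lemma abs_diffKernel_le {ε a c z : ℝ} (hε : 0 ≤ ε) (hac : a ≤ c) (h1 : a ≤ z) (h2 : z ≤ c + ε) :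
    |diffKernel ε a c z| ≤ ε := by
  unfold diffKernel
  rw [abs_le]
  rcases max_cases (c - z) 0 with ⟨e1, h3⟩ | ⟨e1, h3⟩ <;>
    rcases max_cases (a + ε - z) 0 with ⟨e2, h4⟩ | ⟨e2, h4⟩ <;> rw [e1, e2] <;>
    constructor <;> linarith

/-- The second primitive of `κ`. -/
def secondPrimitive (κ : ℝ → ℝ) (w : ℝ) : ℝ := ∫ z in (0 : ℝ)..w, (w - z) * κ z

lemma integral_max_mul {κ : ℝ → ℝ} (hκ : ∀ a b, IntervalIntegrable κ volume a b) {a w b : ℝ}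
    (h1 : a ≤ w) (h2 : w ≤ b) :
    ∫ z in a..b, max (w - z) 0 * κ z = ∫ z in a..w, (w - z) * κ z := by
  have hi : ∀ a b, IntervalIntegrable (fun z => max (w - z) 0 * κ z) volume a b := fun a b =>
    (hκ a b).continuousOn_mul (by fun_prop)
  rw [← intervalIntegral.integral_add_adjacent_intervals (hi a w) (hi w b)]
  have e1 : ∫ z in a..w, max (w - z) 0 * κ z = ∫ z in a..w, (w - z) * κ z := by
    refine intervalIntegral.integral_congr fun z hz => ?_
    rw [Set.uIcc_of_le h1] at hz
    rw [max_eq_left (by linarith [hz.2])]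
  have e2 : ∫ z in w..b, max (w - z) 0 * κ z = ∫ z in w..b, (0 : ℝ) := by
    refine intervalIntegral.integral_congr fun z hz => ?_
    rw [Set.uIcc_of_le h2] at hz
    rw [max_eq_right (by linarith [hz.1]), zero_mul]
  rw [e1, e2]
  simp

/-- Expand the four values at the base point `a`: the affine parts cancel, and positive parts extend
the remaining integrals to one common interval. Only integrability is required, since the effective
curvature is discontinuous. -/
lemma secondDiff_secondPrimitive {κ : ℝ → ℝ} (hκ : ∀ a b, IntervalIntegrable κ volume a b)
    {ε a c : ℝ} (hε : 0 ≤ ε) (hac : a ≤ c) :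
    secondDiff ε (secondPrimitive κ) a c = ∫ z in a..(c + ε), diffKernel ε a c z * κ z := by
  have hi : ∀ (w a b : ℝ), IntervalIntegrable (fun z => (w - z) * κ z) volume a b := fun w a b =>
    (hκ a b).continuousOn_mul (by fun_prop)
  have hzi : ∀ a b, IntervalIntegrable (fun z => z * κ z) volume a b := fun a b =>
    (hκ a b).continuousOn_mul (by fun_prop)
  have hm : ∀ (w a b : ℝ), IntervalIntegrable (fun z => max (w - z) 0 * κ z) volume a b :=
    fun w a b => (hκ a b).continuousOn_mul (by fun_prop)
  have base : ∀ w, secondPrimitive κ w =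
      (w * (∫ z in (0 : ℝ)..a, κ z) - ∫ z in (0 : ℝ)..a, z * κ z) + ∫ z in a..w, (w - z) * κ z := by
    intro w
    rw [secondPrimitive, ← intervalIntegral.integral_add_adjacent_intervals (hi w 0 a) (hi w a w)]
    congr 1
    rw [← intervalIntegral.integral_const_mul, ← intervalIntegral.integral_sub
      ((hκ 0 a).const_mul w) (hzi 0 a)]
    exact intervalIntegral.integral_congr fun z _ => by ring
  have h1 := integral_max_mul hκ (a := a) (w := c) (b := c + ε) hac (by linarith)
  have h2 := integral_max_mul hκ (a := a) (w := a + ε) (b := c + ε) (by linarith) (by linarith)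
  have h3 : ∫ z in a..(c + ε), diffKernel ε a c z * κ z =
      (∫ z in a..(c + ε), (c + ε - z) * κ z) - (∫ z in a..(c + ε), max (c - z) 0 * κ z) -
        ∫ z in a..(c + ε), max (a + ε - z) 0 * κ z := by
    rw [← intervalIntegral.integral_sub (hi _ _ _) (hm _ _ _),
      ← intervalIntegral.integral_sub ((hi _ _ _).sub (hm _ _ _)) (hm _ _ _)]
    refine intervalIntegral.integral_congr fun z _ => ?_
    simp only [diffKernel]
    ring
  rw [h3, h1, h2, secondDiff, base, base, base, base, intervalIntegral.integral_same]
  ring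

/-- `g` and the second primitive of `g''` differ by an affine function, which second differences do
not see. -/
lemma secondDiff_of_deriv {g g' g'' : ℝ → ℝ} (h1 : ∀ z, HasDerivAt g (g' z) z)
    (h2 : ∀ z, HasDerivAt g' (g'' z) z) (hc : Continuous g'') {ε a c : ℝ} (hε : 0 ≤ ε)
    (hac : a ≤ c) : secondDiff ε g a c = ∫ z in a..(c + ε), diffKernel ε a c z * g'' z := by
  rw [← secondDiff_secondPrimitive (fun a b => hc.intervalIntegrable a b) hε hac]
  have hc' : Continuous g' := continuous_iff_continuousAt.2 fun z => (h2 z).continuousAt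
  have key : ∀ w, secondPrimitive g'' w = g w - g 0 - w * g' 0 := by
    intro w
    have e1 := intervalIntegral.integral_mul_deriv_eq_deriv_mul (a := (0 : ℝ)) (b := w)
      (u := fun z => w - z) (v := g') (u' := fun _ => -1) (v' := g'')
      (fun z _ => by simpa using (hasDerivAt_id z).const_sub w) (fun z _ => h2 z)
      (continuous_const.intervalIntegrable _ _) (hc.intervalIntegrable _ _)
    have e2 := intervalIntegral.integral_eq_sub_of_hasDerivAt (a := (0 : ℝ)) (b := w)
      (fun z _ => h1 z) (hc'.intervalIntegrable _ _)
    rw [secondPrimitive, e1]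
    simp only [neg_one_mul, intervalIntegral.integral_neg, e2]
    ring
  rw [secondDiff, secondDiff, key, key, key, key]
  ring

namespace WavefrontData

variable {D : WavefrontData} {j : ℕ}

/-! ### Smoothness of the flux -/

/-- The flux, as a function on the plane. -/
def flux (D : WavefrontData) (p : ℝ × ℝ) : ℝ := D.f p.1 p.2

lemma hasDerivAt_slice_left {G : Type*} [NormedAddCommGroup G] [NormedSpace ℝ G] {H : ℝ × ℝ → G}
    (hH : Differentiable ℝ H) (w y : ℝ) :
    HasDerivAt (fun z => H (z, y)) (fderiv ℝ H (w, y) (1, 0)) w :=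
  (hH (w, y)).hasFDerivAt.comp_hasDerivAt w ((hasDerivAt_id w).prodMk (hasDerivAt_const w y))

lemma hasDerivAt_slice_right {G : Type*} [NormedAddCommGroup G] [NormedSpace ℝ G] {H : ℝ × ℝ → G}
    (hH : Differentiable ℝ H) (w y : ℝ) :
    HasDerivAt (fun z => H (w, z)) (fderiv ℝ H (w, y) (0, 1)) y :=
  (hH (w, y)).hasFDerivAt.comp_hasDerivAt y ((hasDerivAt_const y w).prodMk (hasDerivAt_id y))

lemma flux_smooth (hD : D.Admissible) : ContDiff ℝ 3 D.flux := hD.smooth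

lemma fderiv_flux_smooth (hD : D.Admissible) : ContDiff ℝ 2 (fderiv ℝ D.flux) :=
  (flux_smooth hD).fderiv_right (by norm_num)

lemma fderiv_fderiv_flux_smooth (hD : D.Admissible) :
    ContDiff ℝ 1 (fderiv ℝ (fderiv ℝ D.flux)) :=
  (fderiv_flux_smooth hD).fderiv_right (by norm_num)

lemma hasDerivAt_f (hD : D.Admissible) (w y : ℝ) :
    HasDerivAt (fun z => D.f z y) (fderiv ℝ D.flux (w, y) (1, 0)) w :=
  hasDerivAt_slice_left ((flux_smooth hD).differentiable (by norm_num)) w y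

lemma hasDerivAt_fw (hD : D.Admissible) (w y : ℝ) :
    HasDerivAt (fun z => fderiv ℝ D.flux (z, y) (1, 0))
      (fderiv ℝ (fderiv ℝ D.flux) (w, y) (1, 0) (1, 0)) w :=
  (hasDerivAt_slice_left ((fderiv_flux_smooth hD).differentiable (by norm_num)) w y).clm_apply
    (hasDerivAt_const w _) |>.congr_deriv (by simp)

lemma fww_eq (hD : D.Admissible) (w y : ℝ) :
    D.fww w y = fderiv ℝ (fderiv ℝ D.flux) (w, y) (1, 0) (1, 0) := by
  have h1 : deriv (fun z => D.f z y) = fun z => fderiv ℝ D.flux (z, y) (1, 0) :=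
    funext fun z => (hasDerivAt_f hD z y).deriv
  rw [fww, iteratedDeriv_succ, iteratedDeriv_one, h1, (hasDerivAt_fw hD w y).deriv]

lemma continuous_fww (hD : D.Admissible) (y : ℝ) : Continuous fun z => D.fww z y := by
  simp_rw [fww_eq hD]
  have := (fderiv_fderiv_flux_smooth hD).continuous
  fun_prop

lemma hasDerivAt_fww (hD : D.Admissible) (w y : ℝ) :
    HasDerivAt (fun z => D.fww w z)
      (fderiv ℝ (fderiv ℝ (fderiv ℝ D.flux)) (w, y) (0, 1) (1, 0) (1, 0)) y := by
  simp_rw [fww_eq hD]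
  have h1 := hasDerivAt_slice_right
    ((fderiv_fderiv_flux_smooth hD).differentiable (by norm_num)) w y
  have h2 := h1.clm_apply (hasDerivAt_const y ((1, 0) : ℝ × ℝ))
  have h3 := h2.clm_apply (hasDerivAt_const y ((1, 0) : ℝ × ℝ))
  exact h3.congr_deriv (by simp)

lemma norm_apply_le {G : Type*} [NormedAddCommGroup G] [NormedSpace ℝ G] (B : (ℝ × ℝ) →L[ℝ] G)
    {u : ℝ × ℝ} (hu : ‖u‖ ≤ 1) : ‖B u‖ ≤ ‖B‖ := B.unit_le_opNorm u hu

lemma abs_apply_apply_le {B : (ℝ × ℝ) →L[ℝ] (ℝ × ℝ) →L[ℝ] ℝ} {u v : ℝ × ℝ} (hu : ‖u‖ ≤ 1)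
    (hv : ‖v‖ ≤ 1) : |B u v| ≤ ‖B‖ := by
  have h1 := (B u).unit_le_opNorm v hv
  have h2 := B.unit_le_opNorm u hu
  exact h1.trans h2

lemma norm_e₁ : ‖((1, 0) : ℝ × ℝ)‖ ≤ 1 := by simp [Prod.norm_def]

lemma norm_e₂ : ‖((0, 1) : ℝ × ℝ)‖ ≤ 1 := by simp [Prod.norm_def]

lemma abs_fww_le_normww (hD : D.Admissible) (w y : ℝ) : |D.fww w y| ≤ D.normww := by
  obtain ⟨C, hC⟩ := hD.bounded 2 (by norm_num)
  refine le_ciSup (f := fun p : ℝ × ℝ => |D.fww p.1 p.2|) ⟨C, ?_⟩ (w, y)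
  rintro _ ⟨p, rfl⟩
  have h1 := hC p
  change ‖iteratedFDeriv ℝ 2 D.flux p‖ ≤ C at h1
  rw [← norm_iteratedFDeriv_fderiv, ← norm_iteratedFDeriv_fderiv, norm_iteratedFDeriv_zero] at h1
  change |D.fww p.1 p.2| ≤ C
  rw [fww_eq hD]
  exact (abs_apply_apply_le norm_e₁ norm_e₁).trans h1

lemma abs_fwwv_le_normwwv (hD : D.Admissible) (w y : ℝ) : |D.fwwv w y| ≤ D.normwwv := by
  obtain ⟨C, hC⟩ := hD.bounded 3 le_rfl
  refine le_ciSup (f := fun p : ℝ × ℝ => |D.fwwv p.1 p.2|) ⟨C, ?_⟩ (w, y)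
  rintro _ ⟨p, rfl⟩
  have h1 := hC p
  change ‖iteratedFDeriv ℝ 3 D.flux p‖ ≤ C at h1
  rw [← norm_iteratedFDeriv_fderiv, ← norm_iteratedFDeriv_fderiv, ← norm_iteratedFDeriv_fderiv,
    norm_iteratedFDeriv_zero] at h1
  change |D.fwwv p.1 p.2| ≤ C
  rw [fwwv, (hasDerivAt_fww hD p.1 p.2).deriv]
  refine (abs_apply_apply_le norm_e₁ norm_e₁).trans (le_trans ?_ h1)
  exact norm_apply_le (G := (ℝ × ℝ) →L[ℝ] (ℝ × ℝ) →L[ℝ] ℝ)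
    (fderiv ℝ (fderiv ℝ (fderiv ℝ D.flux)) (p.1, p.2)) norm_e₂

lemma normww_nonneg (hD : D.Admissible) : 0 ≤ D.normww :=
  (abs_nonneg _).trans (abs_fww_le_normww hD 0 0)

lemma normwwv_nonneg (hD : D.Admissible) : 0 ≤ D.normwwv :=
  (abs_nonneg _).trans (abs_fwwv_le_normwwv hD 0 0)

lemma abs_fww_sub_le (hD : D.Admissible) (w y y' : ℝ) :
    |D.fww w y - D.fww w y'| ≤ D.normwwv * |y - y'| := by
  have := Convex.norm_image_sub_le_of_norm_deriv_le (f := fun z => D.fww w z) (s := Set.univ)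
    (C := D.normwwv) (x := y') (y := y) (fun z _ => (hasDerivAt_fww hD w z).differentiableAt)
    (fun z _ => abs_fwwv_le_normwwv hD w z) convex_univ (Set.mem_univ _) (Set.mem_univ _)
  simpa [Real.norm_eq_abs] using this

/-! ### Cells -/

/-- The slope on a cell does not depend on the direction in which the wave crosses it. -/
lemma cellSlope_eq (hD : D.Admissible) (g : ℝ → ℝ) {p : ℕ} (hp : p ∈ D.waves) :
    D.cellSlope g p = (g (D.cellLeft p + D.ε) - g (D.cellLeft p)) / D.ε := by
  rcases sgn_eq_one_or hD hp with h | h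
  · rw [cellSlope, cellLeft, h, if_pos one_pos]
    simp
  · have hn : ¬ (0 : ℝ) < -1 := by norm_num
    rw [cellSlope, cellLeft, h, if_neg hn]
    ring_nf

lemma cellSlope_sub (hD : D.Admissible) (g : ℝ → ℝ) {p q : ℕ} (hp : p ∈ D.waves)
    (hq : q ∈ D.waves) : D.cellSlope g q - D.cellSlope g p =
      secondDiff D.ε g (D.cellLeft p) (D.cellLeft q) / D.ε := by
  rw [cellSlope_eq hD g hp, cellSlope_eq hD g hq, secondDiff]
  ring

lemma measurableSet_segment (r : ℕ) : MeasurableSet (D.segment r) := by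
  unfold segment
  split_ifs
  · exact measurableSet_Ioc
  · exact measurableSet_Ico

lemma segment_subset (r : ℕ) :
    D.segment r ⊆ Set.Icc (D.cellLeft r) (D.cellLeft r + D.ε) := by
  intro x hx
  unfold segment at hx
  unfold cellLeft
  split_ifs at hx ⊢ with h
  · exact ⟨hx.1.le, by linarith [hx.2]⟩
  · exact ⟨hx.1, hx.2.le⟩

lemma volume_segment (hε : 0 < D.ε) (r : ℕ) : volume.real (D.segment r) = D.ε := by
  unfold segment
  split_ifs
  · rw [Real.volume_real_Ioc_of_le (by linarith)]; ring
  · rw [Real.volume_real_Ico_of_le (by linarith)]; ring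

/-- The curvature of the flux on the segment of `r`, when `v` takes the value `y` there. -/
def cellCurvature (D : WavefrontData) (r : ℕ) (y : ℝ) : ℝ → ℝ :=
  (D.segment r).indicator fun z => D.fww z y

/-- The contribution of the wave `r` to the difference of the slopes on two cells. -/
def cellKernel (D : WavefrontData) (a c : ℝ) (r : ℕ) (y : ℝ) : ℝ :=
  ∫ z in a..(c + D.ε), diffKernel D.ε a c z * D.cellCurvature r y z

lemma cellCurvature_integrable (hD : D.Admissible) (r : ℕ) (y a b : ℝ) :
    IntervalIntegrable (D.cellCurvature r y) volume a b :=
  ⟨((continuous_fww hD y).intervalIntegrable a b).1.indicator (measurableSet_segment r),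
    ((continuous_fww hD y).intervalIntegrable a b).2.indicator (measurableSet_segment r)⟩

lemma kernel_mul_integrable (hD : D.Admissible) (r : ℕ) (y a c a' b' : ℝ) :
    IntervalIntegrable (fun z => diffKernel D.ε a c z * D.cellCurvature r y z) volume a' b' :=
  (cellCurvature_integrable hD r y a' b').continuousOn_mul
    (continuous_diffKernel _ _ _).continuousOn

lemma intervalIntegral_congr_Ioo {f g : ℝ → ℝ} {a b : ℝ} (hab : a ≤ b)
    (h : ∀ z ∈ Set.Ioo a b, f z = g z) : ∫ z in a..b, f z = ∫ z in a..b, g z := by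
  rw [intervalIntegral.integral_of_le hab, intervalIntegral.integral_of_le hab,
    integral_Ioc_eq_integral_Ioo, integral_Ioc_eq_integral_Ioo]
  exact setIntegral_congr_fun measurableSet_Ioo h

lemma cellKernel_eq_zero (hD : D.Admissible) {a c : ℝ} (hac : a ≤ c) {r : ℕ} (y : ℝ)
    (h : D.cellLeft r + D.ε ≤ a ∨ c + D.ε ≤ D.cellLeft r) : D.cellKernel a c r y = 0 := by
  have hε := hD.ε_pos
  unfold cellKernel
  rw [intervalIntegral_congr_Ioo (g := fun _ => 0) (by linarith) fun z hz => ?_]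
  · simp
  · have : z ∉ D.segment r := fun hzr => by
      have := segment_subset r hzr
      rcases h with h | h
      · linarith [this.2, hz.1]
      · linarith [this.1, hz.2]
    rw [cellCurvature, Set.indicator_of_notMem this, mul_zero]

/-- One factor `ε` bounds the kernel, the other is the length of the segment. -/
lemma abs_cellKernel_sub_le (hD : D.Admissible) {a c : ℝ} (hac : a ≤ c) (r : ℕ) (y y' : ℝ) :
    |D.cellKernel a c r y - D.cellKernel a c r y'| ≤ D.ε * (D.normwwv * |y - y'|) * D.ε := by
  have hε := hD.ε_pos
  have hN := mul_nonneg (normwwv_nonneg hD) (abs_nonneg (y - y'))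
  have hle : a ≤ c + D.ε := by linarith
  unfold cellKernel
  rw [← intervalIntegral.integral_sub (kernel_mul_integrable hD r y a c _ _)
    (kernel_mul_integrable hD r y' a c _ _)]
  refine (intervalIntegral.abs_integral_le_integral_abs hle).trans ?_
  set C := D.ε * (D.normwwv * |y - y'|) with hC
  have hC0 : 0 ≤ C := mul_nonneg hε.le hN
  have hind : Integrable ((D.segment r).indicator fun _ => C) volume := by
    refine (integrable_indicator_iff (measurableSet_segment r)).2 ?_
    refine integrableOn_const ?_
    exact ((measure_mono (segment_subset r)).trans_lt measure_Icc_lt_top).ne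
  refine (intervalIntegral.integral_mono_on (g := (D.segment r).indicator fun _ => C) hle
    ((kernel_mul_integrable hD r y a c _ _).sub (kernel_mul_integrable hD r y' a c _ _)).abs
    hind.intervalIntegrable fun z hz => ?_).trans ?_
  · rw [← mul_sub, abs_mul]
    by_cases hzr : z ∈ D.segment r
    · rw [cellCurvature, cellCurvature, Set.indicator_of_mem hzr, Set.indicator_of_mem hzr,
        Set.indicator_of_mem hzr]
      exact mul_le_mul (abs_diffKernel_le hε.le hac hz.1 hz.2) (abs_fww_sub_le hD z y y') (abs_nonneg _)
        hε.le
    · rw [cellCurvature, cellCurvature, Set.indicator_of_notMem hzr, Set.indicator_of_notMem hzr,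
        Set.indicator_of_notMem hzr]
      simp
  · rw [intervalIntegral.integral_of_le hle]
    refine (setIntegral_le_integral hind (Filter.Eventually.of_forall fun z =>
      Set.indicator_nonneg (fun _ _ => hC0) z)).trans (le_of_eq ?_)
    rw [integral_indicator_const _ (measurableSet_segment r), volume_segment hε, smul_eq_mul,
      mul_comm]

lemma secondDiff_effFlux (hD : D.Admissible) (s : ℕ) {a c : ℝ} (hac : a ≤ c) :
    secondDiff D.ε (D.effFlux j s) a c =
      ∑ r ∈ D.maxHomogeneous j s, D.cellKernel a c r (D.waveV j r) := by
  have hε := hD.ε_pos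
  have hcurv : D.effCurvature j s =
      fun z => ∑ r ∈ D.maxHomogeneous j s, D.cellCurvature r (D.waveV j r) z := rfl
  have hint : ∀ a b, IntervalIntegrable (D.effCurvature j s) volume a b := fun a b => by
    rw [hcurv]
    have := IntervalIntegrable.sum (μ := volume) (a := a) (b := b) (D.maxHomogeneous j s)
      (f := fun r => D.cellCurvature r (D.waveV j r)) fun r _ => cellCurvature_integrable hD r _ a b
    have e : (fun z => ∑ r ∈ D.maxHomogeneous j s, D.cellCurvature r (D.waveV j r) z) =
        ∑ r ∈ D.maxHomogeneous j s, D.cellCurvature r (D.waveV j r) := by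
      funext z
      rw [Finset.sum_apply]
    rw [e]
    exact this
  change secondDiff D.ε (secondPrimitive (D.effCurvature j s)) a c = _
  rw [secondDiff_secondPrimitive hint hε.le hac]
  unfold cellKernel
  rw [← intervalIntegral.integral_finsetSum fun r _ => kernel_mul_integrable hD r _ a c _ _]
  refine intervalIntegral.integral_congr fun z _ => ?_
  simp only [hcurv, Finset.mul_sum]

lemma secondDiff_flux (hD : D.Admissible) (y : ℝ) {a c : ℝ} (hac : a ≤ c) :
    secondDiff D.ε (fun z => D.f z y) a c =
      ∫ z in a..(c + D.ε), diffKernel D.ε a c z * D.fww z y :=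
  secondDiff_of_deriv (fun z => hasDerivAt_f hD z y)
    (fun z => by rw [fww_eq hD]; exact hasDerivAt_fw hD z y) (continuous_fww hD y)
    hD.ε_pos.le hac

lemma abs_secondDiff_flux_le (hD : D.Admissible) (y : ℝ) {a c : ℝ} (hac : a ≤ c) :
    |secondDiff D.ε (fun z => D.f z y) a c| ≤ D.ε * D.normww * (c + D.ε - a) := by
  have hε := hD.ε_pos
  rw [secondDiff_flux hD y hac]
  have := intervalIntegral.norm_integral_le_of_norm_le_const (a := a) (b := c + D.ε)
    (f := fun z => diffKernel D.ε a c z * D.fww z y) (C := D.ε * D.normww) fun z hz => by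
      rw [Set.uIoc_of_le (by linarith)] at hz
      rw [Real.norm_eq_abs, abs_mul]
      exact mul_le_mul (abs_diffKernel_le hε.le hac hz.1.le hz.2) (abs_fww_le_normww hD z y)
        (abs_nonneg _) hε.le
  rwa [Real.norm_eq_abs, abs_of_nonneg (by linarith : (0 : ℝ) ≤ c + D.ε - a)] at this

/-! ### Differences of slopes along homogeneous intervals -/

lemma IsContiguous.pairwiseDisjoint_segment (hε : 0 < D.ε) {K : Finset ℕ} {S : ℝ} {m : ℤ}
    (h : D.IsContiguous K S m) : (K : Set ℕ).PairwiseDisjoint D.segment := by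
  have key : ∀ p ∈ K, ∀ q ∈ K, p < q → Disjoint (D.segment p) (D.segment q) := by
    intro p hp q hq hlt
    have h1 : (rankIn K p : ℝ) + 1 ≤ rankIn K q := by exact_mod_cast rankIn_lt hq hlt
    rw [Set.disjoint_left]
    intro x hx hx'
    rcases h.sign with rfl | rfl
    · rw [segment, h.sgn_eq p hp, if_pos one_pos, h.hatw_eq p hp] at hx
      rw [segment, h.sgn_eq q hq, if_pos one_pos, h.hatw_eq q hq] at hx'
      nlinarith [hx.2, hx'.1]
    · have hn : ¬ (0 : ℝ) < -1 := by norm_num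
      rw [segment, h.sgn_eq p hp, if_neg hn, h.hatw_eq p hp] at hx
      rw [segment, h.sgn_eq q hq, if_neg hn, h.hatw_eq q hq] at hx'
      nlinarith [hx.1, hx'.2]
  intro p hp q hq hne
  rcases lt_or_gt_of_ne hne with hlt | hlt
  · exact key p hp q hq hlt
  · exact (key q hq p hp hlt).symm

lemma IsContiguous.cellLeft_eq {K : Finset ℕ} {S : ℝ} {m : ℤ}
    (h : D.IsContiguous K S m) {p : ℕ} (hp : p ∈ K) :
    D.cellLeft p = (m + S * rankIn K p - (if 0 < S then 1 else 0)) * D.ε := by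
  rw [cellLeft, h.sgn_eq p hp, h.hatw_eq p hp]
  split_ifs <;> ring

lemma IsContiguous.mem_iUnion_segment (hε : 0 < D.ε) {K : Finset ℕ} {S : ℝ} {m : ℤ}
    (h : D.IsContiguous K S m) {p q : ℕ} (hp : p ∈ K) (hq : q ∈ K) {z : ℝ}
    (h1 : D.cellLeft p < z) (h2 : z < D.cellLeft q + D.ε) : z ∈ ⋃ r ∈ K, D.segment r := by
  have a1 : (1 : ℝ) ≤ rankIn K p := by exact_mod_cast rankIn_pos hp
  have a2 : (1 : ℝ) ≤ rankIn K q := by exact_mod_cast rankIn_pos hq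
  have b1 : (rankIn K p : ℝ) ≤ K.card := by exact_mod_cast rankIn_le_card K p
  have b2 : (rankIn K q : ℝ) ≤ K.card := by exact_mod_cast rankIn_le_card K q
  rw [h.cellLeft_eq hp] at h1
  rw [h.cellLeft_eq hq] at h2
  rcases h.sign with rfl | rfl
  · rw [h.iUnion_segment_pos hε]
    rw [if_pos one_pos] at h1 h2
    constructor <;> nlinarith
  · have hn : ¬ (0 : ℝ) < -1 := by norm_num
    rw [h.iUnion_segment_neg hε]
    rw [if_neg hn] at h1 h2
    constructor <;> nlinarith

/-- The disjoint segments of `K` cover the interval of integration up to its end points, so the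
curvature splits into contributions of single waves. -/
lemma IsContiguous.secondDiff_flux (hD : D.Admissible) {K : Finset ℕ} {S : ℝ} {m : ℤ}
    (h : D.IsContiguous K S m) (y : ℝ) {p q : ℕ} (hp : p ∈ K) (hq : q ∈ K)
    (hpq : D.cellLeft p ≤ D.cellLeft q) :
    secondDiff D.ε (fun z => D.f z y) (D.cellLeft p) (D.cellLeft q) =
      ∑ r ∈ K, D.cellKernel (D.cellLeft p) (D.cellLeft q) r y := by
  have hε := hD.ε_pos
  rw [WavefrontData.secondDiff_flux hD y hpq]
  unfold cellKernel
  rw [← intervalIntegral.integral_finsetSum fun r _ => kernel_mul_integrable hD r _ _ _ _ _]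
  refine intervalIntegral_congr_Ioo (by linarith) fun z hz => ?_
  rw [← Finset.mul_sum]
  congr 1
  have h1 := Finset.indicator_biUnion K D.segment (f := fun z => D.fww z y)
    (h.pairwiseDisjoint_segment hε)
  have h2 := congrFun h1 z
  rw [Set.indicator_of_mem (h.mem_iUnion_segment hε hp hq hz.1 hz.2)] at h2
  exact h2

lemma IsContiguous.cellKernel_eq_zero (hD : D.Admissible) {K : Finset ℕ} {S : ℝ} {m : ℤ}
    (h : D.IsContiguous K S m) (y : ℝ) {p q r : ℕ} (hp : p ∈ K) (hq : q ∈ K) (hr : r ∈ K)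
    (hpq : D.cellLeft p ≤ D.cellLeft q) (hout : (r < p ∧ r < q) ∨ (p < r ∧ q < r)) :
    D.cellKernel (D.cellLeft p) (D.cellLeft q) r y = 0 := by
  have hε := hD.ε_pos
  apply WavefrontData.cellKernel_eq_zero hD hpq
  have key : ∀ a ∈ K, ∀ b ∈ K, a < b → (rankIn K a : ℝ) + 1 ≤ rankIn K b := fun a _ b hb hab => by
    exact_mod_cast rankIn_lt hb hab
  rw [h.cellLeft_eq hp, h.cellLeft_eq hq, h.cellLeft_eq hr]
  rcases h.sign with rfl | rfl
  · simp only [one_pos, if_true, one_mul]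
    rcases hout with ⟨h1, -⟩ | ⟨-, h1⟩
    · left; nlinarith [key r hr p hp h1]
    · right; nlinarith [key q hq r hr h1]
  · have hn : ¬ (0 : ℝ) < -1 := by norm_num
    simp only [hn, if_false]
    rcases hout with ⟨-, h1⟩ | ⟨h1, -⟩
    · right; nlinarith [key r hr q hq h1]
    · left; nlinarith [key p hp r hr h1]

/-- The contribution of the wave `r`, at which `v` takes the value `y`, to the difference between
the slopes of the effective flux on the segments of `q` and `p`. -/
def slopeKernel (D : WavefrontData) (p q r : ℕ) (y : ℝ) : ℝ :=
  (if D.cellLeft p ≤ D.cellLeft q then D.cellKernel (D.cellLeft p) (D.cellLeft q) r y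
    else -D.cellKernel (D.cellLeft q) (D.cellLeft p) r y) / D.ε

lemma abs_slopeKernel_sub_le (hD : D.Admissible) (p q r : ℕ) (y y' : ℝ) :
    |D.slopeKernel p q r y - D.slopeKernel p q r y'| ≤ D.normwwv * |y - y'| * D.ε := by
  have hε := hD.ε_pos
  unfold slopeKernel
  split_ifs with h
  · rw [← sub_div, abs_div, abs_of_pos hε, div_le_iff₀ hε]
    linarith [abs_cellKernel_sub_le hD h r y y']
  · rw [← sub_div, abs_div, abs_of_pos hε, div_le_iff₀ hε, neg_sub_neg, abs_sub_comm]
    linarith [abs_cellKernel_sub_le hD (not_le.1 h).le r y y']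

lemma secondDiff_swap (ε : ℝ) (g : ℝ → ℝ) (a c : ℝ) :
    secondDiff ε g a c = -secondDiff ε g c a := by
  unfold secondDiff; ring

lemma maxHomogeneous_subset (j s : ℕ) : D.maxHomogeneous j s ⊆ D.realWaves j :=
  Finset.filter_subset _ _

lemma mem_maxHomogeneous {s p : ℕ} : p ∈ D.maxHomogeneous j s ↔ p ∈ D.realWaves j ∧
    ∀ q ∈ D.realWaves j, q ∈ Set.uIcc p s → D.sgn q = D.sgn s := by
  simp [maxHomogeneous]

lemma sgn_eq_of_mem_maxHomogeneous {s p : ℕ} (hp : p ∈ D.maxHomogeneous j s) :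
    D.sgn p = D.sgn s :=
  (mem_maxHomogeneous.1 hp).2 p (mem_maxHomogeneous.1 hp).1 Set.left_mem_uIcc

lemma maxHomogeneous_convex {s r a b : ℕ} (hr : r ∈ D.realWaves j)
    (ha : a ∈ D.maxHomogeneous j s) (hb : b ∈ D.maxHomogeneous j s) (h1 : a ≤ r) (h2 : r ≤ b) :
    r ∈ D.maxHomogeneous j s := by
  rw [mem_maxHomogeneous] at ha hb ⊢
  refine ⟨hr, fun q hq hqr => ?_⟩
  rw [Set.mem_uIcc] at hqr
  rcases hqr with ⟨h3, h4⟩ | ⟨h3, h4⟩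
  · exact ha.2 q hq (Set.mem_uIcc.2 (Or.inl ⟨h1.trans h3, h4⟩))
  · exact hb.2 q hq (Set.mem_uIcc.2 (Or.inr ⟨h3, h4.trans h2⟩))

lemma Coherent.maxHomogeneous_contiguous (hD : D.Admissible) (h : D.Coherent j) {s p : ℕ}
    (hp : p ∈ D.maxHomogeneous j s) :
    ∃ m : ℤ, D.IsContiguous (D.maxHomogeneous j s) (D.sgn p) m := by
  obtain ⟨m, hm, -⟩ := h.isContiguous hD (maxHomogeneous_subset j s)
    (fun r hr a ha b hb => maxHomogeneous_convex hr ha hb)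
    (fun a ha b hb => (sgn_eq_of_mem_maxHomogeneous ha).trans (sgn_eq_of_mem_maxHomogeneous hb).symm)
    hp
  exact ⟨m, hm⟩

/-- The kernel integral runs over the cells from `p` to `q` only, so the other waves contribute
nothing. -/
lemma sum_maxHomogeneous (hD : D.Admissible) (h : D.Coherent j) {s p q : ℕ}
    (hp : p ∈ D.maxHomogeneous j s) (hq : q ∈ D.maxHomogeneous j s) (hle : p ≤ q) (V : ℕ → ℝ) :
    ∑ r ∈ D.maxHomogeneous j s, D.slopeKernel p q r (V r) =
      ∑ r ∈ (D.realWaves j).filter (fun r => p ≤ r ∧ r ≤ q), D.slopeKernel p q r (V r) := by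
  obtain ⟨m, hm⟩ := h.maxHomogeneous_contiguous hD hp
  symm
  refine Finset.sum_subset (fun r hr => ?_) fun r hr hnr => ?_
  · obtain ⟨h1, h2, h3⟩ := Finset.mem_filter.1 hr
    exact maxHomogeneous_convex h1 hp hq h2 h3
  · have hout : (r < p ∧ r < q) ∨ (p < r ∧ q < r) := by
      by_contra hcon
      exact hnr (Finset.mem_filter.2 ⟨maxHomogeneous_subset j s hr, by omega, by omega⟩)
    unfold slopeKernel
    split_ifs with h1
    · rw [hm.cellKernel_eq_zero hD _ hp hq hr h1 hout, zero_div]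
    · rw [hm.cellKernel_eq_zero hD _ hq hp hr (not_le.1 h1).le (by omega), neg_zero, zero_div]

/-- The difference of two slopes of the effective flux. -/
lemma effFlux_slope_sub (hD : D.Admissible) (h : D.Coherent j) {s p q : ℕ}
    (hp : p ∈ D.maxHomogeneous j s) (hq : q ∈ D.maxHomogeneous j s) (hle : p ≤ q) :
    D.cellSlope (D.effFlux j s) q - D.cellSlope (D.effFlux j s) p =
      ∑ r ∈ (D.realWaves j).filter (fun r => p ≤ r ∧ r ≤ q), D.slopeKernel p q r (D.waveV j r) := by
  rw [← sum_maxHomogeneous hD h hp hq hle, cellSlope_sub hD _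
    (mem_waves_of_mem_realWaves (maxHomogeneous_subset j s hp))
    (mem_waves_of_mem_realWaves (maxHomogeneous_subset j s hq))]
  unfold slopeKernel
  rw [← Finset.sum_div]
  congr 1
  split_ifs with h1
  · exact secondDiff_effFlux hD s h1
  · rw [secondDiff_swap, secondDiff_effFlux hD s (not_le.1 h1).le, Finset.sum_neg_distrib]

/-- The difference of two slopes of the flux at a fixed value of `v`. -/
lemma flux_slope_sub (hD : D.Admissible) (h : D.Coherent j) {s p q : ℕ} (y : ℝ)
    (hp : p ∈ D.maxHomogeneous j s) (hq : q ∈ D.maxHomogeneous j s) (hle : p ≤ q) :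
    D.cellSlope (fun z => D.f z y) q - D.cellSlope (fun z => D.f z y) p =
      ∑ r ∈ (D.realWaves j).filter (fun r => p ≤ r ∧ r ≤ q), D.slopeKernel p q r y := by
  obtain ⟨m, hm⟩ := h.maxHomogeneous_contiguous hD hp
  rw [← sum_maxHomogeneous hD h hp hq hle (fun _ => y), cellSlope_sub hD _
    (mem_waves_of_mem_realWaves (maxHomogeneous_subset j s hp))
    (mem_waves_of_mem_realWaves (maxHomogeneous_subset j s hq))]
  unfold slopeKernel
  rw [← Finset.sum_div]
  congr 1
  split_ifs with h1
  · exact hm.secondDiff_flux hD y hp hq h1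
  · rw [secondDiff_swap, hm.secondDiff_flux hD y hq hp (not_le.1 h1).le, Finset.sum_neg_distrib]

lemma effFlux_slope_sub_eq (hD : D.Admissible) (h : D.Coherent j) {s p q : ℕ} {y : ℝ}
    (hp : p ∈ D.maxHomogeneous j s) (hq : q ∈ D.maxHomogeneous j s) (hle : p ≤ q)
    (hV : ∀ r ∈ D.realWaves j, p ≤ r → r ≤ q → D.waveV j r = y) :
    D.cellSlope (D.effFlux j s) q - D.cellSlope (D.effFlux j s) p =
      D.cellSlope (fun z => D.f z y) q - D.cellSlope (fun z => D.f z y) p := by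
  rw [effFlux_slope_sub hD h hp hq hle, flux_slope_sub hD h y hp hq hle]
  refine Finset.sum_congr rfl fun r hr => ?_
  obtain ⟨h1, h2, h3⟩ := Finset.mem_filter.1 hr
  rw [hV r h1 h2 h3]

/-- The change of the difference of two slopes of the effective flux between two collisions. -/
lemma abs_effFlux_slope_change (hD : D.Admissible) (h : D.Coherent j) (h' : D.Coherent (j + 1))
    {s p q : ℕ} (hp : p ∈ D.maxHomogeneous j s) (hq : q ∈ D.maxHomogeneous j s)
    (hp' : p ∈ D.maxHomogeneous (j + 1) s) (hq' : q ∈ D.maxHomogeneous (j + 1) s) (hle : p ≤ q)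
    (hW : ∀ r ∈ D.realWaves j, p ≤ r → r ≤ q → r ∈ D.realWaves (j + 1)) :
    |(D.cellSlope (D.effFlux (j + 1) s) q - D.cellSlope (D.effFlux (j + 1) s) p) -
      (D.cellSlope (D.effFlux j s) q - D.cellSlope (D.effFlux j s) p)| ≤
      ∑ r ∈ (D.realWaves (j + 1)).filter (fun r => p ≤ r ∧ r ≤ q),
        D.normwwv * |D.waveV (j + 1) r - D.waveV j r| * D.ε := by
  have hset : (D.realWaves j).filter (fun r => p ≤ r ∧ r ≤ q) =
      (D.realWaves (j + 1)).filter (fun r => p ≤ r ∧ r ≤ q) := by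
    ext r
    simp only [Finset.mem_filter]
    exact ⟨fun ⟨h1, h2, h3⟩ => ⟨hW r h1 h2 h3, h2, h3⟩,
      fun ⟨h1, h2⟩ => ⟨D.realWaves_succ_subset j h1, h2⟩⟩
  rw [effFlux_slope_sub hD h hp hq hle, effFlux_slope_sub hD h' hp' hq' hle, hset,
    ← Finset.sum_sub_distrib]
  exact (Finset.abs_sum_le_sum_abs _ _).trans
    (Finset.sum_le_sum fun r _ => abs_slopeKernel_sub_le hD p q r _ _)

lemma sgn_ne_zero (hD : D.Admissible) {s : ℕ} (hs : s ∈ D.waves) : D.sgn s ≠ 0 := by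
  rcases sgn_eq_one_or hD hs with h | h <;> rw [h] <;> norm_num

/-! ### Common intervals of pairs of waves -/

lemma maxHomogeneous_eq {s p : ℕ} (hp : p ∈ D.maxHomogeneous j s) :
    D.maxHomogeneous j p = D.maxHomogeneous j s := by
  have hsg := sgn_eq_of_mem_maxHomogeneous hp
  ext q
  rw [mem_maxHomogeneous, mem_maxHomogeneous]
  rw [mem_maxHomogeneous] at hp
  refine and_congr_right fun _ => ⟨fun h r hr hqs => ?_, fun h r hr hqp => ?_⟩
  · rcases Set.mem_union _ _ _ |>.1 (Set.uIcc_subset_uIcc_union_uIcc (b := p) hqs) with h1 | h1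
    · exact (h r hr h1).trans hsg
    · exact hp.2 r hr h1
  · rw [hsg]
    rcases Set.mem_union _ _ _ |>.1 (Set.uIcc_subset_uIcc_union_uIcc (b := s) hqp) with h1 | h1
    · exact h r hr h1
    · exact hp.2 r hr (by rwa [Set.uIcc_comm])

/-- The normalization at `0` gives equality, not just equality up to affine functions, so the base
wave can be changed freely. -/
lemma effFlux_eq {s p : ℕ} (hp : p ∈ D.maxHomogeneous j s) :
    D.effFlux j p = D.effFlux j s := by
  funext w
  unfold effFlux effCurvature
  rw [maxHomogeneous_eq hp]

/-- A homogeneous interval of real waves that are neighbours of the same sign loses no inner wave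
as long as its end points are real. -/
lemma mem_realWaves_succ_of_between (hD : D.Admissible) (h : D.Coherent j)
    (h' : D.Coherent (j + 1)) {a b r : ℕ} (ha : a ∈ D.realWaves (j + 1))
    (hb : b ∈ D.realWaves (j + 1)) (hr : r ∈ D.realWaves j) (har : a ≤ r) (hrb : r ≤ b)
    (hom : ∀ q ∈ D.realWaves j, a ≤ q → q ≤ b → D.sgn q = D.sgn a) : r ∈ D.realWaves (j + 1) := by
  have hε := hD.ε_pos
  have hab := har.trans hrb
  -- The states `hatw` do not depend on time. With equal signs between `a` and `b` they count the
  -- real waves there, so this number is the same at both times.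
  have key : ∀ i, D.Coherent i → a ∈ D.realWaves i → b ∈ D.realWaves i →
      D.realWaves i ⊆ D.realWaves j → D.hatw b - D.hatw a =
        D.ε * (((D.realWaves i).filter fun q => a < q ∧ q ≤ b).card * D.sgn a) := by
    intro i hi hai hbi hsub
    rw [hi.hatw_eq a hai, hi.hatw_eq b hbi, ← mul_sub]
    congr 1
    rw [sub_eq_iff_eq_add', ← nsmul_eq_mul, ← Finset.sum_const]
    rw [← Finset.sum_congr rfl fun q hq => hom q (hsub (Finset.mem_filter.1 hq).1)
      (Finset.mem_filter.1 hq).2.1.le (Finset.mem_filter.1 hq).2.2, ← Finset.sum_union]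
    · refine Finset.sum_congr ?_ fun _ _ => rfl
      ext q; simp only [Finset.mem_filter, Finset.mem_union]
      constructor
      · rintro ⟨h1, h2⟩
        rcases le_or_gt q a with h3 | h3
        · exact Or.inl ⟨h1, h3⟩
        · exact Or.inr ⟨h1, h3, h2⟩
      · rintro (⟨h1, h2⟩ | ⟨h1, -, h2⟩)
        · exact ⟨h1, h2.trans hab⟩
        · exact ⟨h1, h2⟩
    · rw [Finset.disjoint_left]
      intro q hq hq'
      exact absurd (Finset.mem_filter.1 hq).2 (not_le.2 (Finset.mem_filter.1 hq').2.1)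
  have hsub := D.realWaves_succ_subset j
  have e := (key j h (hsub ha) (hsub hb) (Finset.Subset.refl _)).symm.trans
    (key (j + 1) h' ha hb hsub)
  have e1 := mul_right_cancel₀ (sgn_ne_zero hD (mem_waves_of_mem_realWaves ha))
    (mul_left_cancel₀ hε.ne' e)
  have e2 := Finset.eq_of_subset_of_card_le
    (Finset.filter_subset_filter (fun q => a < q ∧ q ≤ b) hsub) (by exact_mod_cast e1.le)
  rcases har.eq_or_lt with rfl | hlt
  · exact ha
  · have : r ∈ (D.realWaves j).filter fun q => a < q ∧ q ≤ b :=
      Finset.mem_filter.2 ⟨hr, hlt, hrb⟩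
    rw [← e2] at this
    exact (Finset.mem_filter.1 this).1

/-- On a set of waves along which `v` has a constant value the slopes of the effective flux are
those of the flux, up to a constant. -/
lemma exists_effFlux_add_const (hD : D.Admissible) (h : D.Coherent j) {s : ℕ} {y : ℝ}
    {T : Finset ℕ} (hT : T ⊆ D.maxHomogeneous j s)
    (hV : ∀ r ∈ D.realWaves j, ∀ a ∈ T, ∀ b ∈ T, a ≤ r → r ≤ b → D.waveV j r = y) :
    ∃ c, ∀ a ∈ T, D.cellSlope (fun z => D.f z y) a = D.cellSlope (D.effFlux j s) a + c := by
  rcases T.eq_empty_or_nonempty with rfl | ⟨a0, ha0⟩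
  · exact ⟨0, by simp⟩
  refine ⟨D.cellSlope (fun z => D.f z y) a0 - D.cellSlope (D.effFlux j s) a0, fun a ha => ?_⟩
  rcases le_total a a0 with hle | hle
  · linarith [effFlux_slope_sub_eq hD h (hT ha) (hT ha0) hle fun r hr => hV r hr a ha a0 ha0]
  · linarith [effFlux_slope_sub_eq hD h (hT ha0) (hT ha) hle fun r hr => hV r hr a0 ha0 a ha]

lemma waveV_eq_of_pos_eq {r r' : ℕ} (h : D.pos j r = D.pos j r') : D.waveV j r = D.waveV j r' := by
  rw [waveV, waveV, h]

namespace LastMeeting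

variable {k s s' : ℕ}

lemma mem_commonInterval (hD : D.Admissible) (hR : D.Reached j) (h : D.LastMeeting k j s s')
    {p : ℕ} : p ∈ D.commonInterval j s s' ↔ p ∈ D.realWaves j ∧ D.pos k p = D.pos k s := by
  rw [h.commonInterval_eq hD hR, Finset.mem_filter]

lemma left_mem_commonInterval (hD : D.Admissible) (hR : D.Reached j)
    (h : D.LastMeeting k j s s') : s ∈ D.commonInterval j s s' :=
  (h.mem_commonInterval hD hR).2 ⟨h.left_mem, rfl⟩

lemma right_mem_commonInterval (hD : D.Admissible) (hR : D.Reached j)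
    (h : D.LastMeeting k j s s') : s' ∈ D.commonInterval j s s' :=
  (h.mem_commonInterval hD hR).2 ⟨h.right_mem, h.eq.symm⟩

lemma sgn_eq (hD : D.Admissible) (hR : D.Reached j) (h : D.LastMeeting k j s s') {p : ℕ}
    (hp : p ∈ D.commonInterval j s s') : D.sgn p = D.sgn s := by
  obtain ⟨h1, h2⟩ := (h.mem_commonInterval hD hR).1 hp
  exact (coherent hD (reached_of_le hR h.le)).sgn_eq_of_pos_eq (D.realWaves_subset h.le h1)
    (D.realWaves_subset h.le h.left_mem) h2

lemma commonInterval_convex (hD : D.Admissible) (hR : D.Reached j) (h : D.LastMeeting k j s s')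
    {a b r : ℕ} (ha : a ∈ D.commonInterval j s s') (hb : b ∈ D.commonInterval j s s')
    (hr : r ∈ D.realWaves j) (har : a ≤ r) (hrb : r ≤ b) : r ∈ D.commonInterval j s s' := by
  rw [h.mem_commonInterval hD hR] at ha hb ⊢
  have hc := coherent hD (reached_of_le hR h.le)
  have hr' := D.realWaves_subset h.le hr
  refine ⟨hr, le_antisymm ?_ ?_⟩
  · rw [← hb.2]
    exact hc.pos_mono hr' (D.realWaves_subset h.le hb.1) hrb
  · rw [← ha.2]
    exact hc.pos_mono (D.realWaves_subset h.le ha.1) hr' har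

/-- Waves that sat at one point have one sign, and real waves between them sat there too. -/
lemma commonInterval_subset (hD : D.Admissible) (hR : D.Reached j) (h : D.LastMeeting k j s s') :
    D.commonInterval j s s' ⊆ D.maxHomogeneous j s := by
  intro p hp
  refine mem_maxHomogeneous.2 ⟨((h.mem_commonInterval hD hR).1 hp).1, fun q hq hqp => ?_⟩
  refine h.sgn_eq hD hR ?_
  have hs := h.left_mem_commonInterval hD hR
  rcases Set.mem_uIcc.1 hqp with ⟨h1, h2⟩ | ⟨h1, h2⟩
  · exact h.commonInterval_convex hD hR hp hs hq h1 h2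
  · exact h.commonInterval_convex hD hR hs hp hq h1 h2

lemma commonInterval_succ_subset (hD : D.Admissible) (hR : D.Reached (j + 1))
    (h : D.LastMeeting k (j + 1) s s') (hk : k ≤ j) :
    D.commonInterval (j + 1) s s' ⊆ D.commonInterval j s s' := by
  intro p hp
  rw [h.mem_commonInterval hD hR] at hp
  exact ((h.of_le hk j.le_succ).mem_commonInterval hD (reached_of_succ hR)).2
    ⟨D.realWaves_succ_subset j hp.1, hp.2⟩

/-- The wave `r` of `W(t_j)` survives if it lies between two surviving waves of a common interval. -/
lemma mem_realWaves_succ (hD : D.Admissible) (hR : D.Reached (j + 1))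
    (h : D.LastMeeting k (j + 1) s s') (hk : k ≤ j) {a b r : ℕ}
    (ha : a ∈ D.commonInterval (j + 1) s s') (hb : b ∈ D.commonInterval (j + 1) s s')
    (hr : r ∈ D.realWaves j) (har : a ≤ r) (hrb : r ≤ b) : r ∈ D.realWaves (j + 1) := by
  have hR' := reached_of_succ hR
  have h' := h.of_le hk j.le_succ
  have hsub := h.commonInterval_succ_subset hD hR hk
  refine mem_realWaves_succ_of_between hD (coherent hD hR') (coherent hD hR)
    ((h.mem_commonInterval hD hR).1 ha).1 ((h.mem_commonInterval hD hR).1 hb).1 hr har hrb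
    fun q hq h1 h2 => ?_
  rw [h'.sgn_eq hD hR' (hsub ha), h'.sgn_eq hD hR'
    (h'.commonInterval_convex hD hR' (hsub ha) (hsub hb) hq h1 h2)]

/-! ### The partitions -/

lemma samePart_self (h : D.LastMeeting k k s s') {p q : ℕ} : D.SamePart k s s' p q ↔
    p ∈ D.commonInterval k s s' ∧ q ∈ D.commonInterval k s s' ∧ D.Joined k p q := by
  cases k with
  | zero => rfl
  | succ k =>
    rw [SamePart, if_pos ((wavePos_eq_iff h.left_mem h.right_mem).2 h.eq)]

lemma samePart_succ (hD : D.Admissible) (hR : D.Reached (j + 1))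
    (h : D.LastMeeting k (j + 1) s s') (hk : k ≤ j) {p q : ℕ} :
    D.SamePart (j + 1) s s' p q ↔
      p ∈ D.commonInterval (j + 1) s s' ∧ q ∈ D.commonInterval (j + 1) s s' ∧
        D.SamePart j s s' p q ∧
        D.entropicSpeed (D.effFlux (j + 1) s)
            ((D.realWaves (j + 1)).filter fun r => D.SamePart j s s' p r) p =
          D.entropicSpeed (D.effFlux (j + 1) s)
            ((D.realWaves (j + 1)).filter fun r => D.SamePart j s s' p r) q := by
  rw [SamePart, if_neg fun he => h.ne (j + 1) (Nat.lt_succ_of_le hk) le_rfl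
    ((wavePos_eq_iff h.left_mem h.right_mem).1 he)]
  refine and_congr_right fun hp => ?_
  rw [effFlux_eq (h.commonInterval_subset hD hR hp)]

end LastMeeting

lemma firstStrength_nonneg : 0 ≤ D.firstStrength j := abs_nonneg _

lemma transversalLength_nonneg (hD : D.Admissible) (s s' p p' : ℕ) :
    0 ≤ D.transversalLength j s s' p p' :=
  Finset.sum_nonneg fun _ _ => mul_nonneg hD.ε_pos.le (Nat.cast_nonneg _)

lemma pairGap_nonneg (hD : D.Admissible) (s s' p p' : ℕ) : 0 ≤ D.pairGap j s s' p p' := by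
  induction j with
  | zero => exact le_rfl
  | succ j ih =>
    rw [pairGap]
    have h1 := normwwv_nonneg hD
    have h2 := D.firstStrength_nonneg (j := j + 1)
    have h3 := transversalLength_nonneg hD (j := j) s s' p p'
    split_ifs
    · exact le_rfl
    · positivity
    · exact ih

/-- The properties of the partition of the common interval of two waves `s`, `s'`: its elements
are intervals and shocks for the effective flux, and the pair gap controls the differences of
their speeds. -/
structure PartInvariant (D : WavefrontData) (j s s' : ℕ) : Prop where
  mem : ∀ {p q}, D.SamePart j s s' p q → p ∈ D.commonInterval j s s' ∧ q ∈ D.commonInterval j s s'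
  refl : ∀ {p}, p ∈ D.commonInterval j s s' → D.SamePart j s s' p p
  symm : ∀ {p q}, D.SamePart j s s' p q → D.SamePart j s s' q p
  trans : ∀ {p q r}, D.SamePart j s s' p q → D.SamePart j s s' q r → D.SamePart j s s' p r
  convex : ∀ {p q r}, D.SamePart j s s' p q → r ∈ D.realWaves j → p ≤ r → r ≤ q →
    D.SamePart j s s' p r
  frontOf_eq : ∀ {p q}, D.SamePart j s s' p q → D.frontOf j p = D.frontOf j q
  shock : ∀ {p}, p ∈ D.commonInterval j s s' →
    IsShock (D.part j s s' p) (D.cellSlope (D.effFlux j s))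
  gap : ∀ {p q}, p ∈ D.commonInterval j s s' → q ∈ D.commonInterval j s s' → p < q →
    average (D.part j s s' p) (D.cellSlope (D.effFlux j s)) -
      average (D.part j s s' q) (D.cellSlope (D.effFlux j s)) ≤ D.pairGap j s s' p q

/-- At the last meeting the elements of the partition are the wavefronts leaving the point. Their
speeds do not decrease from left to right, so nonnegativity of the gap is enough. -/
lemma partInvariant_self (hD : D.Admissible) {k s s' : ℕ} (hR : D.Reached k)
    (h : D.LastMeeting k k s s') : D.PartInvariant k s s' := by
  have hc := coherent hD hR
  have hI : ∀ {p}, p ∈ D.commonInterval k s s' ↔ p ∈ D.realWaves k ∧ D.pos k p = D.pos k s :=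
    h.mem_commonInterval hD hR
  have hsame : ∀ {p q}, D.SamePart k s s' p q ↔ p ∈ D.commonInterval k s s' ∧
      q ∈ D.realWaves k ∧ D.frontOf k q = D.frontOf k p := by
    intro p q
    rw [h.samePart_self]
    constructor
    · rintro ⟨hp, hq, hj⟩
      exact ⟨hp, (hI.1 hq).1, ((joined_iff (hI.1 hp).1 (hI.1 hq).1).1 hj).symm⟩
    · rintro ⟨hp, hq, hj⟩
      exact ⟨hp, hI.2 ⟨hq, (frontOf_eq_iff.1 hj).1.trans (hI.1 hp).2⟩,
        (joined_iff (hI.1 hp).1 hq).2 hj.symm⟩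
  have hpart : ∀ {p}, p ∈ D.commonInterval k s s' → D.part k s s' p =
      (D.realWaves k).filter fun r => D.frontOf k r = D.frontOf k p := by
    intro p hp
    ext r
    rw [part, Finset.mem_filter, Finset.mem_filter, hsame]
    refine ⟨fun h => h.2.2, fun h => ⟨?_, hp, h⟩⟩
    exact hI.2 ⟨h.1, (frontOf_eq_iff.1 h.2).1.trans (hI.1 hp).2⟩
  obtain ⟨c, hc1⟩ := exists_effFlux_add_const hD hc (y := D.waveV k s)
    (h.commonInterval_subset hD hR) fun r hr a ha b hb h1 h2 =>
      waveV_eq_of_pos_eq (hI.1 (h.commonInterval_convex hD hR ha hb hr h1 h2)).2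
  have hc2 : ∀ {p}, ∀ r ∈ D.part k s s' p, D.cellSlope (D.effFlux k s) r =
      D.cellSlope (fun z => D.f z (D.waveV k s)) r + -c := fun r hr => by
    rw [hc1 r (Finset.mem_filter.1 hr).1]; ring
  have hV : ∀ {p}, p ∈ D.commonInterval k s s' → D.waveV k p = D.waveV k s := fun hp =>
    waveV_eq_of_pos_eq (hI.1 hp).2
  have hne : ∀ {p}, p ∈ D.commonInterval k s s' → (D.part k s s' p).Nonempty := fun {p} hp =>
    ⟨p, by rw [hpart hp]; exact Finset.mem_filter.2 ⟨(hI.1 hp).1, rfl⟩⟩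
  have havg : ∀ {p}, p ∈ D.commonInterval k s s' →
      average (D.part k s s' p) (D.cellSlope (D.effFlux k s)) = D.waveSpeed k p + -c := by
    intro p hp
    rw [average_add_const (hne hp) hc2, hpart hp, ← hV hp, (isShock_front hD hc (hI.1 hp).1).2]
  refine ⟨fun hpq => ?_, fun hp => ?_, fun hpq => ?_, fun hpq hqr => ?_, fun {p q r} hpq hr h1 h2 => ?_,
    fun hpq => ?_, fun hp => ?_, fun hp hq hlt => ?_⟩
  · exact ⟨(hsame.1 hpq).1, (h.samePart_self.1 hpq).2.1⟩
  · exact hsame.2 ⟨hp, (hI.1 hp).1, rfl⟩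
  · have := hsame.1 hpq
    exact hsame.2 ⟨(h.samePart_self.1 hpq).2.1, (hI.1 this.1).1, this.2.2.symm⟩
  · have h1 := hsame.1 hpq
    have h2 := hsame.1 hqr
    exact hsame.2 ⟨h1.1, h2.2.1, h2.2.2.trans h1.2.2⟩
  · obtain ⟨hp, hq, hf⟩ := hsame.1 hpq
    obtain ⟨e1, e2⟩ := frontOf_eq_iff.1 hf
    have hpr : D.pos k p = D.pos k r := le_antisymm (hc.pos_mono (hI.1 hp).1 hr h1)
      (by rw [← e1]; exact hc.pos_mono hr hq h2)
    refine hsame.2 ⟨hp, hr, frontOf_eq_iff.2 ⟨hpr.symm, le_antisymm ?_ ?_⟩⟩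
    · rw [← e2]
      exact hc.waveSpeed_mono hD hr hq (hpr.symm.trans e1.symm) h2
    · exact hc.waveSpeed_mono hD (hI.1 hp).1 hr hpr h1
  · exact (hsame.1 hpq).2.2.symm
  · have := (isShock_front hD hc (hI.1 hp).1).1
    rw [← hpart hp, hV hp] at this
    exact this.add_const hc2
  · refine le_trans ?_ (pairGap_nonneg hD s s' _ _)
    rw [havg hp, havg hq]
    linarith [hc.waveSpeed_mono hD (hI.1 hp).1 (hI.1 hq).1 ((hI.1 hp).2.trans (hI.1 hq).2.symm)
      hlt.le]

namespace PartInvariant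

variable {s s' : ℕ}

lemma part_eq (h : D.PartInvariant j s s') {p q : ℕ} (hpq : D.SamePart j s s' p q) :
    D.part j s s' p = D.part j s s' q :=
  Finset.filter_congr fun _ _ => ⟨h.trans (h.symm hpq), h.trans hpq⟩

lemma mem_part (h : D.PartInvariant j s s') {p q : ℕ} :
    q ∈ D.part j s s' p ↔ D.SamePart j s s' p q := by
  rw [part, Finset.mem_filter]
  exact ⟨fun hq => hq.2, fun hq => ⟨(h.mem hq).2, hq⟩⟩

lemma mem_part_self (h : D.PartInvariant j s s') {p : ℕ} (hp : p ∈ D.commonInterval j s s') :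
    p ∈ D.part j s s' p := h.mem_part.2 (h.refl hp)

lemma commonInterval_subset_realWaves : D.commonInterval j s s' ⊆ D.realWaves j :=
  Finset.filter_subset _ _

/-- Different elements of the partition are ordered. -/
lemma lt_of_le (h : D.PartInvariant j s s') {p q a b x y : ℕ} (ha : D.SamePart j s s' p a)
    (hb : D.SamePart j s s' q b) (hab : a ≤ b) (hne : ¬ D.SamePart j s s' p q)
    (hx : D.SamePart j s s' p x) (hy : D.SamePart j s s' q y) : x < y := by
  by_contra hcon
  push Not at hcon
  have hyr := commonInterval_subset_realWaves (h.mem hy).2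
  have har := commonInterval_subset_realWaves (h.mem ha).2
  rcases le_total a y with h1 | h1
  · have := h.convex (h.trans (h.symm ha) hx) hyr h1 hcon
    exact hne (h.trans ha (h.trans this (h.symm hy)))
  · have := h.convex (h.trans (h.symm hy) hb) har h1 hab
    exact hne (h.trans ha (h.trans (h.symm this) (h.symm hy)))

lemma intervalLE (h : D.PartInvariant j s s') {p q a b : ℕ} (ha : D.SamePart j s s' p a)
    (hb : D.SamePart j s s' q b) (hab : a ≤ b) :
    IntervalLE (D.part j s s' p) (D.part j s s' q) := by
  by_cases hpq : D.SamePart j s s' p q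
  · exact Or.inr (h.part_eq hpq)
  · exact Or.inl fun x hx y hy => h.lt_of_le ha hb hab hpq (h.mem_part.1 hx) (h.mem_part.1 hy)

end PartInvariant

end WavefrontData

/-! ### Evolution of the partitions along the collisions. -/

/-- Averaging `hB` over the rectangle `C₁ × C₂` compares means over the two pieces; the four sum
bounds pass from these means to the given constants. -/
lemma sub_le_of_parts {C₁ C₂ : Finset ℕ} {d d' : ℕ → ℝ} {a₁ a₂ a₁' a₂' B : ℝ} (h₁ : C₁.Nonempty)
    (h₂ : C₂.Nonempty) (u₁ : (C₁.card : ℝ) * a₁' ≤ ∑ q ∈ C₁, d' q)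
    (u₂ : ∑ q ∈ C₂, d' q ≤ (C₂.card : ℝ) * a₂') (l₁ : ∑ q ∈ C₁, d q ≤ (C₁.card : ℝ) * a₁)
    (l₂ : (C₂.card : ℝ) * a₂ ≤ ∑ q ∈ C₂, d q)
    (hB : ∀ a ∈ C₁, ∀ b ∈ C₂, d' a - d' b ≤ d a - d b + B) : a₁' - a₂' ≤ a₁ - a₂ + B := by
  have n₁ : (0 : ℝ) < C₁.card := by exact_mod_cast h₁.card_pos
  have n₂ : (0 : ℝ) < C₂.card := by exact_mod_cast h₂.card_pos
  have key : ∀ g : ℕ → ℝ, ∑ a ∈ C₁, ∑ b ∈ C₂, (g a - g b) =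
      C₂.card * ∑ a ∈ C₁, g a - C₁.card * ∑ b ∈ C₂, g b := fun g => by
    simp only [Finset.sum_sub_distrib, Finset.sum_const, nsmul_eq_mul, Finset.mul_sum]
  have h := Finset.sum_le_sum fun a ha => Finset.sum_le_sum fun b hb => hB a ha b hb
  simp only [Finset.sum_add_distrib (f := fun b => d _ - d b), key, Finset.sum_add_distrib,
    Finset.sum_const, nsmul_eq_mul] at h
  refine le_of_mul_le_mul_left ?_ (mul_pos n₁ n₂)
  nlinarith [mul_le_mul_of_nonneg_left u₁ n₂.le, mul_le_mul_of_nonneg_left u₂ n₁.le,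
    mul_le_mul_of_nonneg_left l₁ n₂.le, mul_le_mul_of_nonneg_left l₂ n₁.le]

namespace WavefrontData

variable {D : WavefrontData} {j : ℕ}

lemma arrival_eq_of_samePart {s s' p q : ℕ} (h : D.PartInvariant j s s')
    (hpq : D.SamePart j s s' p q) : D.arrival j p = D.arrival j q :=
  arrival_eq_of_frontOf_eq (h.frontOf_eq hpq)

/-- At a transversal interaction the change of the flux between two waves is controlled by the
transversal length. -/
lemma sum_waveV_change_le (hD : D.Admissible) (hR : D.Reached (j + 1)) {k s s' : ℕ}
    (h : D.LastMeeting k (j + 1) s s') (hk : k ≤ j) (ih : D.PartInvariant j s s')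
    (hT : D.IsTransversal (j + 1)) {p q a b : ℕ} (ha : D.SamePart j s s' p a)
    (hb : D.SamePart j s s' q b) :
    ∑ r ∈ (D.realWaves (j + 1)).filter (fun r => a ≤ r ∧ r ≤ b),
        D.normwwv * |D.waveV (j + 1) r - D.waveV j r| * D.ε ≤
      D.normwwv * D.firstStrength (j + 1) * D.transversalLength j s s' p q := by
  have hR' := reached_of_succ hR
  have hc := coherent hD hR'
  have hN := normwwv_nonneg hD
  have hε := hD.ε_pos
  have hW := realWaves_succ_of_transversal hD hc hR hT
  have h' := h.of_le hk j.le_succ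
  -- Only the waves crossed by the front of the first family contribute, each by the same amount.
  set E := ((D.realWaves (j + 1)).filter (fun r => a ≤ r ∧ r ≤ b)).filter
    fun r => D.waveV (j + 1) r ≠ D.waveV j r with hE
  have hsum : ∑ r ∈ (D.realWaves (j + 1)).filter (fun r => a ≤ r ∧ r ≤ b),
      D.normwwv * |D.waveV (j + 1) r - D.waveV j r| * D.ε =
        E.card * (D.normwwv * D.firstStrength (j + 1) * D.ε) := by
    rw [← nsmul_eq_mul, ← Finset.sum_const]
    refine (Finset.sum_congr rfl fun r hr => ?_).trans (Finset.sum_filter _ _).symm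
    split_ifs with h1
    · rw [(transversal_of_waveV_ne hD hc hR (Finset.mem_filter.1 hr).1 h1).2.2]
    · push Not at h1
      rw [h1]; simp
  set P := (D.partition j s s').filter (fun K =>
      IntervalLE (D.part j s s' p) K ∧ IntervalLE K (D.part j s s' q) ∧
      K ⊆ D.wavesAt (j + 1) (D.collisionPoint (j + 1) : WithTop ℝ)) with hP
  -- An element of the partition lies in one wavefront, so a single crossed wave brings its whole
  -- element to the collision point.
  have hsub : E ⊆ P.biUnion id := by
    intro r hr
    obtain ⟨hr1, hr2⟩ := Finset.mem_filter.1 hr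
    obtain ⟨hr1, har, hrb⟩ := Finset.mem_filter.1 hr1
    have hrI := h'.commonInterval_convex hD hR' (ih.mem ha).2 (ih.mem hb).2
      (D.realWaves_succ_subset j hr1) har hrb
    have hx := (transversal_of_waveV_ne hD hc hR hr1 hr2).2.1
    refine Finset.mem_biUnion.2 ⟨D.part j s s' r, Finset.mem_filter.2
      ⟨Finset.mem_image_of_mem _ hrI, ih.intervalLE ha (ih.refl hrI) har,
        ih.intervalLE (ih.refl hrI) hb hrb, fun q' hq' => ?_⟩, ih.mem_part_self hrI⟩
    have hs := ih.mem_part.1 hq'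
    have hqW : q' ∈ D.realWaves (j + 1) := by
      rw [hW]; exact PartInvariant.commonInterval_subset_realWaves (ih.mem hs).2
    refine mem_wavesAt.2 ⟨hqW, ?_⟩
    rw [pos_succ hqW, ← arrival_eq_of_samePart ih hs, ← pos_succ hr1, hx]
  have hcard : D.ε * E.card ≤ D.transversalLength j s s' p q := by
    have h1 : (E.card : ℝ) ≤ ∑ K ∈ P, (K.card : ℝ) := by
      exact_mod_cast (Finset.card_le_card hsub).trans Finset.card_biUnion_le
    calc D.ε * E.card ≤ D.ε * ∑ K ∈ P, (K.card : ℝ) := mul_le_mul_of_nonneg_left h1 hε.le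
      _ = D.transversalLength j s s' p q := by rw [Finset.mul_sum]; rfl
  rw [hsum]
  have := mul_le_mul_of_nonneg_left hcard (mul_nonneg hN (D.firstStrength_nonneg (j := j + 1)))
  linarith

/-- The increase of the pair gap bounds the increase of the differences of slopes. -/
lemma effFlux_slope_sub_le (hD : D.Admissible) (hR : D.Reached (j + 1)) {k s s' : ℕ}
    (h : D.LastMeeting k (j + 1) s s') (hk : k ≤ j) (ih : D.PartInvariant j s s')
    {p q a b : ℕ} (ha : D.SamePart j s s' p a) (hb : D.SamePart j s s' q b)
    (ha' : a ∈ D.commonInterval (j + 1) s s') (hb' : b ∈ D.commonInterval (j + 1) s s')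
    (hab : a ≤ b) (hJ : ¬ D.Joined j s s') :
    D.cellSlope (D.effFlux (j + 1) s) a - D.cellSlope (D.effFlux (j + 1) s) b ≤
      D.cellSlope (D.effFlux j s) a - D.cellSlope (D.effFlux j s) b +
        (D.pairGap (j + 1) s s' p q - D.pairGap j s s' p q) := by
  have hR' := reached_of_succ hR
  have hc := coherent hD hR'
  have h' := h.of_le hk j.le_succ
  have h1 := abs_effFlux_slope_change hD hc (coherent hD hR)
    (h'.commonInterval_subset hD hR' (ih.mem ha).2) (h'.commonInterval_subset hD hR' (ih.mem hb).2)
    (h.commonInterval_subset hD hR ha') (h.commonInterval_subset hD hR hb') hab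
    fun r hr h1 h2 => h.mem_realWaves_succ hD hR hk ha' hb' hr h1 h2
  rw [pairGap, if_neg hJ]
  split_ifs with hT
  -- The kernel estimate does without the factor 2 of the gap; the spare term is nonnegative.
  · have h2 := sum_waveV_change_le hD hR h hk ih hT ha hb
    have h3 := mul_nonneg (mul_nonneg (normwwv_nonneg hD) (D.firstStrength_nonneg (j := j + 1)))
      (transversalLength_nonneg hD (j := j) s s' p q)
    linarith [(abs_le.1 (h1.trans h2)).1]
  · rw [Finset.sum_eq_zero fun r hr => ?_] at h1
    · linarith [(abs_le.1 h1).1]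
    · have : D.waveV (j + 1) r = D.waveV j r := by
        by_contra hne
        exact hT (transversal_of_waveV_ne hD hc hR (Finset.mem_filter.1 hr).1 hne).1
      rw [this]; simp

/-- Two waves which are not together any more at time `t_{j+1}` are divided at time `t_j`. -/
lemma LastMeeting.not_joined_of_lt {k s s' : ℕ} (h : D.LastMeeting k (j + 1) s s') (hk : k ≤ j) :
    ¬ D.Joined j s s' := fun hJ => by
  have h1 := (joined_iff (D.realWaves_succ_subset j h.left_mem)
    (D.realWaves_succ_subset j h.right_mem)).1 hJ
  refine h.ne (j + 1) (Nat.lt_succ_of_le hk) le_rfl ?_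
  rw [pos_succ h.left_mem, pos_succ h.right_mem, arrival_eq_of_frontOf_eq h1]

/-- The surviving part `K p` of an old element gets an envelope from the new effective flux. The
level sets of its slopes are the new elements, hence shocks. -/
lemma PartInvariant.succ (hD : D.Admissible) (hR : D.Reached (j + 1)) {k s s' : ℕ}
    (h : D.LastMeeting k (j + 1) s s') (hk : k ≤ j) (ih : D.PartInvariant j s s') :
    D.PartInvariant (j + 1) s s' := by
  have hJk := h.not_joined_of_lt hk
  have hR' := reached_of_succ hR
  have hc := coherent hD hR'
  have hc' := coherent hD hR
  have h' := h.of_le hk j.le_succ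
  set g := D.effFlux (j + 1) s with hg
  set K : ℕ → Finset ℕ := fun p => (D.realWaves (j + 1)).filter fun r => D.SamePart j s s' p r
    with hK
  have hI : ∀ {p}, p ∈ D.commonInterval (j + 1) s s' ↔
      p ∈ D.realWaves (j + 1) ∧ D.pos k p = D.pos k s := h.mem_commonInterval hD hR
  have hsub := h.commonInterval_succ_subset hD hR hk
  have hmK : ∀ {p r}, r ∈ K p ↔ r ∈ D.realWaves (j + 1) ∧ D.SamePart j s s' p r :=
    Finset.mem_filter
  have hKeq : ∀ {p q}, D.SamePart j s s' p q → K p = K q := fun hpq =>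
    Finset.filter_congr fun r _ => ⟨ih.trans (ih.symm hpq), ih.trans hpq⟩
  have hKI : ∀ {p r}, r ∈ K p → r ∈ D.commonInterval (j + 1) s s' := fun hr => hI.2
    ⟨(hmK.1 hr).1, ((h'.mem_commonInterval hD hR').1 (ih.mem (hmK.1 hr).2).2).2⟩
  have hsame : ∀ {p q}, D.SamePart (j + 1) s s' p q ↔ p ∈ D.commonInterval (j + 1) s s' ∧
      q ∈ K p ∧ D.entropicSpeed g (K p) q = D.entropicSpeed g (K p) p := by
    intro p q
    rw [h.samePart_succ hD hR hk]
    constructor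
    · rintro ⟨hp, hq, h1, h2⟩
      exact ⟨hp, hmK.2 ⟨(hI.1 hq).1, h1⟩, h2.symm⟩
    · rintro ⟨hp, hq, h1⟩
      exact ⟨hp, hKI hq, (hmK.1 hq).2, h1.symm⟩
  have hself : ∀ {p}, p ∈ D.commonInterval (j + 1) s s' → p ∈ K p := fun hp =>
    hmK.2 ⟨(hI.1 hp).1, ih.refl (hsub hp)⟩
  have hKconv : ∀ {p}, ∀ r ∈ D.realWaves (j + 1), ∀ a ∈ K p, ∀ b ∈ K p, a ≤ r → r ≤ b →
      r ∈ K p := fun r hr a ha b hb h1 h2 => by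
    have ha := hmK.1 ha
    have hb := hmK.1 hb
    exact hmK.2 ⟨hr, ih.trans ha.2 (ih.convex (ih.trans (ih.symm ha.2) hb.2)
      (D.realWaves_succ_subset j hr) h1 h2)⟩
  have henv : ∀ {p}, p ∈ D.commonInterval (j + 1) s s' →
      IsEnvelope (K p) (D.cellSlope g) (D.entropicSpeed g (K p)) := by
    intro p hp
    obtain ⟨m, hm, -⟩ := hc'.isContiguous hD (Finset.filter_subset _ _) hKconv
      (fun a ha b hb => (h.sgn_eq hD hR (hKI ha)).trans (h.sgn_eq hD hR (hKI hb)).symm) (hself hp)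
    exact hm.isEnvelope hD.ε_pos g
  have hpart : ∀ {p}, p ∈ D.commonInterval (j + 1) s s' → D.part (j + 1) s s' p =
      (K p).filter fun r => D.entropicSpeed g (K p) r = D.entropicSpeed g (K p) p := by
    intro p hp
    ext r
    rw [part, Finset.mem_filter, Finset.mem_filter, hsame]
    exact ⟨fun h => h.2.2, fun h => ⟨hKI h.1, hp, h⟩⟩
  have hne : ∀ {p}, p ∈ D.commonInterval (j + 1) s s' →
      ((K p).filter fun r => D.entropicSpeed g (K p) r = D.entropicSpeed g (K p) p).Nonempty :=
    fun {p} hp => ⟨p, Finset.mem_filter.2 ⟨hself hp, rfl⟩⟩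
  have hshock : ∀ {p}, p ∈ D.commonInterval (j + 1) s s' →
      IsShock (D.part (j + 1) s s' p) (D.cellSlope g) := fun {p} hp => by
    rw [hpart hp]; exact (henv hp).isShock_level _
  have havg : ∀ {p}, p ∈ D.commonInterval (j + 1) s s' →
      average (D.part (j + 1) s s' p) (D.cellSlope g) = D.entropicSpeed g (K p) p := fun {p} hp => by
    rw [hpart hp]; exact (henv hp).average_level (hne hp)
  have hpos : ∀ {p q}, p ∈ D.commonInterval (j + 1) s s' → q ∈ K p →
      D.pos (j + 1) q = D.pos (j + 1) p := fun {p q} hp hq => by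
    rw [pos_succ (hI.1 hp).1, pos_succ (hmK.1 hq).1, arrival_eq_of_samePart ih (hmK.1 hq).2]
  refine ⟨fun hpq => ?_, fun hp => ?_, fun {p q} hpq => ?_, fun {p q r} hpq hqr => ?_,
    fun {p q r} hpq hr h1 h2 => ?_, fun {p q} hpq => ?_, fun hp => hshock hp,
    fun {p q} hp hq hlt => ?_⟩
  · exact ⟨(hsame.1 hpq).1, hKI (hsame.1 hpq).2.1⟩
  · exact hsame.2 ⟨hp, hself hp, rfl⟩
  · obtain ⟨hp, hq, e⟩ := hsame.1 hpq
    have := hKeq (hmK.1 hq).2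
    rw [hsame, ← this]
    exact ⟨hKI hq, hself hp, e.symm⟩
  · obtain ⟨hp, hq, e⟩ := hsame.1 hpq
    obtain ⟨-, hr, e'⟩ := hsame.1 hqr
    rw [← hKeq (hmK.1 hq).2] at hr e'
    exact hsame.2 ⟨hp, hr, e'.trans e⟩
  · obtain ⟨hp, hq, e⟩ := hsame.1 hpq
    have hrK := hKconv r hr p (hself hp) q hq h1 h2
    have hm := (henv hp).mono
    exact hsame.2 ⟨hp, hrK, le_antisymm ((hm r hrK q hq h2).trans e.le) (hm p (hself hp) r hrK h1)⟩
  · obtain ⟨hp, hq, e⟩ := hsame.1 hpq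
    have hCK : D.part (j + 1) s s' p ⊆ K p := by rw [hpart hp]; exact Finset.filter_subset _ _
    have hCm : ∀ {r}, r ∈ D.part (j + 1) s s' p ↔
        r ∈ K p ∧ D.entropicSpeed g (K p) r = D.entropicSpeed g (K p) p := by
      intro r; rw [hpart hp, Finset.mem_filter]
    have hconv : ∀ r ∈ D.realWaves (j + 1), ∀ a ∈ D.part (j + 1) s s' p,
        ∀ b ∈ D.part (j + 1) s s' p, a ≤ r → r ≤ b → r ∈ D.part (j + 1) s s' p := by
      intro r hr a ha b hb h1 h2
      obtain ⟨haK, hae⟩ := hCm.1 ha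
      obtain ⟨hbK, hbe⟩ := hCm.1 hb
      have hrK := hKconv r hr a haK b hbK h1 h2
      have hm := (henv hp).mono
      exact hCm.2 ⟨hrK, le_antisymm ((hm r hrK b hbK h2).trans hbe.le)
        (hae.ge.trans (hm a haK r hrK h1))⟩
    -- The new element sits at one position, where `v` has one value, so it is a shock for the true
    -- flux too, and the real Riemann problem there cannot divide it.
    obtain ⟨c, hc1⟩ := exists_effFlux_add_const hD hc' (s := s) (y := D.waveV (j + 1) p)
      (T := D.part (j + 1) s s' p)
      (fun r hr => h.commonInterval_subset hD hR (hKI (hCK hr)))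
      fun r hr a ha b hb h1 h2 => waveV_eq_of_pos_eq (hpos hp (hCK (hconv r hr a ha b hb h1 h2)))
    have hs := (hshock hp).add_const hc1
    have hwe := hc'.isEnvelope_waveSpeed hD (D.pos (j + 1) p)
    refine frontOf_eq_iff.2 ⟨(hpos hp hq).symm, hwe.eq_of_isShock (J := D.part (j + 1) s s' p)
      (fun r hr => mem_wavesAt.2 ⟨(hmK.1 (hCK hr)).1, hpos hp (hCK hr)⟩)
      (fun r hr => hconv r (mem_wavesAt.1 hr).1) hs (hCm.2 ⟨hself hp, rfl⟩) (hCm.2 ⟨hq, e⟩)⟩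
  · rw [havg hp, havg hq]
    -- Inside one old element the new speeds are monotone and the left side is nonpositive.
    by_cases hpq : D.SamePart j s s' p q
    · refine le_trans ?_ (pairGap_nonneg hD s s' p q)
      rw [← hKeq hpq]
      linarith [(henv hp).mono p (hself hp) q (hmK.2 ⟨(hI.1 hq).1, hpq⟩) hlt.le]
    have hlt' : ∀ {a b}, D.SamePart j s s' p a → D.SamePart j s s' q b → a < b := fun ha hb =>
      ih.lt_of_le (ih.refl (hsub hp)) (ih.refl (hsub hq)) hlt.le hpq ha hb
    have hgap := ih.gap (hsub hp) (hsub hq) hlt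
    -- The pieces are the waves of `K p` at least as fast as `p` and those of `K q` at most as fast
    -- as `q`. The new envelope bounds the new speeds by their new means; in the old shocks they are
    -- a final and an initial piece, which bounds their old means by the old speeds.
    have key := sub_le_of_parts
      (C₁ := (K p).filter fun r => D.entropicSpeed g (K p) p ≤ D.entropicSpeed g (K p) r)
      (C₂ := (K q).filter fun r => D.entropicSpeed g (K q) r ≤ D.entropicSpeed g (K q) q)
      (d := D.cellSlope (D.effFlux j s)) (d' := D.cellSlope g)
      (B := D.pairGap (j + 1) s s' p q - D.pairGap j s s' p q)
      ⟨p, Finset.mem_filter.2 ⟨hself hp, le_rfl⟩⟩ ⟨q, Finset.mem_filter.2 ⟨hself hq, le_rfl⟩⟩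
      ((henv hp).sum_upper_ge _) ((henv hq).sum_lower_le _)
      ((ih.shock (hsub hp)).sum_le_of_upper
        (fun r hr => ih.mem_part.2 (hmK.1 (Finset.mem_filter.1 hr).1).2)
        fun r hr a ha har => ?_)
      ((ih.shock (hsub hq)).le_sum_of_lower
        (fun r hr => ih.mem_part.2 (hmK.1 (Finset.mem_filter.1 hr).1).2)
        fun r hr b hb hrb => ?_)
      fun a ha b hb => ?_
    · linarith
    · obtain ⟨haK, hae⟩ := Finset.mem_filter.1 ha
      have hr' := ih.mem_part.1 hr
      -- A wave between the survivors `a` and `q` survives, so the piece is final in the whole old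
      -- element and not only among its survivors.
      have hrK : r ∈ K p := hmK.2 ⟨h.mem_realWaves_succ hD hR hk (hKI haK) hq
        (PartInvariant.commonInterval_subset_realWaves (ih.mem hr').2) har
        (hlt' hr' (ih.refl (hsub hq))).le, hr'⟩
      exact Finset.mem_filter.2 ⟨hrK, hae.trans ((henv hp).mono a haK r hrK har)⟩
    · obtain ⟨hbK, hbe⟩ := Finset.mem_filter.1 hb
      have hr' := ih.mem_part.1 hr
      have hrK : r ∈ K q := hmK.2 ⟨h.mem_realWaves_succ hD hR hk hp (hKI hbK)
        (PartInvariant.commonInterval_subset_realWaves (ih.mem hr').2)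
        (hlt' (ih.refl (hsub hp)) hr').le hrb, hr'⟩
      exact Finset.mem_filter.2 ⟨hrK, ((henv hq).mono r hrK b hbK hrb).trans hbe⟩
    · have haK := (Finset.mem_filter.1 ha).1
      have hbK := (Finset.mem_filter.1 hb).1
      exact effFlux_slope_sub_le hD hR h hk ih (hmK.1 haK).2 (hmK.1 hbK).2 (hKI haK) (hKI hbK)
        (hlt' (hmK.1 haK).2 (hmK.1 hbK).2).le hJk

lemma LastMeeting.partInvariant (hD : D.Admissible) (hR : D.Reached j) {k s s' : ℕ}
    (h : D.LastMeeting k j s s') : D.PartInvariant j s s' := by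
  obtain ⟨n, rfl⟩ := Nat.exists_eq_add_of_le h.le
  induction n with
  | zero => exact partInvariant_self hD hR h
  | succ n ih =>
    have hk : k ≤ k + n := Nat.le_add_right k n
    exact PartInvariant.succ hD hR h hk
      (ih (reached_of_succ hR) (h.of_le hk (Nat.le_succ _)))

/-- The partition depends only on the common interval. -/
lemma LastMeeting.samePart_iff (hD : D.Admissible) (hR : D.Reached j) {k s s' p p' : ℕ}
    (h : D.LastMeeting k j s s') (h' : D.LastMeeting k j p p') (hps : D.pos k p = D.pos k s)
    {a b : ℕ} : D.SamePart j p p' a b ↔ D.SamePart j s s' a b := by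
  obtain ⟨n, rfl⟩ := Nat.exists_eq_add_of_le h.le
  have hI : ∀ i, k ≤ i → i ≤ k + n → D.commonInterval i p p' = D.commonInterval i s s' := by
    intro i h1 h2
    rw [(h.of_le h1 h2).commonInterval_eq hD (reached_of_le hR h2),
      (h'.of_le h1 h2).commonInterval_eq hD (reached_of_le hR h2), hps]
  induction n generalizing a b with
  | zero =>
    change D.SamePart k p p' a b ↔ D.SamePart k s s' a b
    rw [samePart_self h, samePart_self h', hI _ le_rfl le_rfl]
  | succ n ih =>
    have hk : k ≤ k + n := Nat.le_add_right k n
    have hle : k + n ≤ k + (n + 1) := Nat.le_succ _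
    have ih' : ∀ {a b}, D.SamePart (k + n) p p' a b ↔ D.SamePart (k + n) s s' a b :=
      ih (reached_of_succ hR) (h.of_le hk hle) (h'.of_le hk hle)
        fun i h1 h2 => hI i h1 (h2.trans hle)
    have hpI : p ∈ D.maxHomogeneous (k + n + 1) s := by
      refine h.commonInterval_subset hD hR ?_
      rw [← hI _ (Nat.le_add_right _ _) le_rfl]
      exact h'.left_mem_commonInterval hD hR
    have e := samePart_succ (j := k + n) hD hR h hk (p := a) (q := b)
    have e' := samePart_succ (j := k + n) hD hR h' hk (p := a) (q := b)
    rw [effFlux_eq hpI, hI (k + n + 1) (hk.trans (Nat.le_succ _)) le_rfl] at e'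
    simp only [ih'] at e'
    exact e'.trans e.symm

/-- After the last meeting the partition is only refined. -/
lemma LastMeeting.samePart_of_le (hD : D.Admissible) (hR : D.Reached j) {k i s s' : ℕ}
    (h : D.LastMeeting k j s s') (hki : k ≤ i) (hij : i ≤ j) {a b : ℕ}
    (hab : D.SamePart j s s' a b) : D.SamePart i s s' a b := by
  induction j, hij using Nat.le_induction with
  | base => exact hab
  | succ j hij ih =>
    exact ih (reached_of_succ hR) (h.of_le (hki.trans hij) j.le_succ)
      ((h.samePart_succ hD hR (hki.trans hij)).1 hab).2.2.1

/-- Waves in the same elements of the partition as `s` and `s'` met for the last time together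
with `s` and `s'`. -/
lemma LastMeeting.of_samePart (hD : D.Admissible) (hR : D.Reached j) {k s s' p p' : ℕ}
    (h : D.LastMeeting k j s s') (hp : D.SamePart j s s' s p) (hp' : D.SamePart j s s' s' p') :
    D.LastMeeting k j p p' := by
  have hinv := h.partInvariant hD hR
  -- Waves of one element were in a common wavefront at every collision since the last meeting.
  have key : ∀ {a b}, D.SamePart j s s' a b → ∀ i, k ≤ i → i ≤ j → D.pos i a = D.pos i b :=
    fun hab i h1 h2 => (frontOf_eq_iff.1 (((h.of_le h1 h2).partInvariant hD
      (reached_of_le hR h2)).frontOf_eq (h.samePart_of_le hD hR h1 h2 hab))).1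
  refine ⟨h.le, PartInvariant.commonInterval_subset_realWaves (hinv.mem hp).2,
    PartInvariant.commonInterval_subset_realWaves (hinv.mem hp').2, ?_, fun i h1 h2 he => ?_⟩
  · rw [← key hp k le_rfl h.le, ← key hp' k le_rfl h.le, h.eq]
  · rw [← key hp i h1.le h2, ← key hp' i h1.le h2] at he
    exact h.ne i h1 h2 he

lemma LastMeeting.part_eq (hD : D.Admissible) (hR : D.Reached j) {k s s' p p' : ℕ}
    (h : D.LastMeeting k j s s') (h' : D.LastMeeting k j p p') (hps : D.pos k p = D.pos k s)
    (a : ℕ) : D.part j p p' a = D.part j s s' a := by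
  unfold part
  rw [h.commonInterval_eq hD hR, h'.commonInterval_eq hD hR, hps]
  exact Finset.filter_congr fun r _ => h.samePart_iff hD hR h' hps

end WavefrontData

/-! ### The estimate at an interaction point. -/

lemma sum_product_sub (J J' : Finset ℕ) (d : ℕ → ℝ) :
    ∑ x ∈ J ×ˢ J', (d x.1 - d x.2) = J.card * J'.card * (average J d - average J' d) := by
  rw [Finset.sum_product]
  simp only [Finset.sum_sub_distrib, Finset.sum_const, nsmul_eq_mul, ← Finset.mul_sum,
    ← card_mul_average]
  ring

namespace WavefrontData

variable {D : WavefrontData} {j : ℕ}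

lemma weight_nonneg (hD : D.Admissible) (s s' : ℕ) : 0 ≤ D.weight j s s' := by
  unfold weight
  split_ifs
  · exact le_rfl
  · exact div_nonneg (pairGap_nonneg hD _ _ _ _) (abs_nonneg _)
  · exact normww_nonneg hD

namespace Interaction

variable {L R : Finset ℕ} {v : ℝ}

lemma mem_realWaves (hI : D.Interaction j L R v) {a : ℕ} (ha : a ∈ L ∪ R) : a ∈ D.realWaves j := by
  rw [← hI.arriving_eq] at ha
  exact (Finset.mem_filter.1 ha).1

lemma arrival_eq (hI : D.Interaction j L R v) {a : ℕ} (ha : a ∈ L ∪ R) :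
    D.arrival j a = D.collisionPoint (j + 1) := by
  rw [← hI.arriving_eq] at ha
  exact (Finset.mem_filter.1 ha).2

lemma convex (hD : D.Admissible) (hR : D.Reached (j + 1)) (hI : D.Interaction j L R v) {a b r : ℕ}
    (hr : r ∈ D.realWaves j) (ha : a ∈ L ∪ R) (hb : b ∈ L ∪ R) (har : a ≤ r) (hrb : r ≤ b) :
    r ∈ L ∪ R := by
  have hc := coherent hD (reached_of_succ hR)
  rw [← hI.arriving_eq]
  refine Finset.mem_filter.2 ⟨hr, le_antisymm ?_ ?_⟩
  · rw [← hI.arrival_eq hb]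
    exact arrival_mono hD hc hR hr (hI.mem_realWaves hb) hrb
  · rw [← hI.arrival_eq ha]
    exact arrival_mono hD hc hR (hI.mem_realWaves ha) hr har

lemma exists_contiguous (hD : D.Admissible) (hR : D.Reached (j + 1))
    (hI : D.Interaction j L R v) : ∃ S m, D.IsContiguous (L ∪ R) S m := by
  obtain ⟨a, ha⟩ := hI.left_nonempty
  obtain ⟨m, hm, -⟩ := (coherent hD (reached_of_succ hR)).isContiguous hD
    (fun r hr => hI.mem_realWaves hr) (fun r hr a ha b hb => hI.convex hD hR hr ha hb) hI.sgn_eq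
    (Finset.mem_union_left _ ha)
  exact ⟨_, m, hm⟩

lemma card_union (hI : D.Interaction j L R v) : (L ∪ R).card = L.card + R.card :=
  Finset.card_union_of_disjoint (Finset.disjoint_left.2 fun a ha hb => (hI.lt a ha a hb).ne rfl)

/-- The distance of the ends of the segments of two waves that interact is at most the total
strength. -/
lemma abs_hatw_sub (hD : D.Admissible) (hR : D.Reached (j + 1)) (hI : D.Interaction j L R v)
    {s s' : ℕ} (hs : s ∈ L) (hs' : s' ∈ R) :
    0 < |D.hatw s' - (D.hatw s - D.sgn s * D.ε)| ∧
      |D.hatw s' - (D.hatw s - D.sgn s * D.ε)| ≤ D.ε * (L.card + R.card) ∧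
      |D.cellLeft s' - D.cellLeft s| + D.ε ≤ D.ε * (L.card + R.card) := by
  have hε := hD.ε_pos
  obtain ⟨S, m, hm⟩ := hI.exists_contiguous hD hR
  have h1 := Finset.mem_union_left R hs
  have h2 := Finset.mem_union_right L hs'
  have r1 : (1 : ℝ) ≤ rankIn (L ∪ R) s := by exact_mod_cast rankIn_pos h1
  have r2 : (rankIn (L ∪ R) s' : ℝ) ≤ L.card + R.card := by
    exact_mod_cast (rankIn_le_card (L ∪ R) s').trans_eq hI.card_union
  have r3 : (rankIn (L ∪ R) s : ℝ) + 1 ≤ rankIn (L ∪ R) s' := by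
    exact_mod_cast rankIn_lt h2 (hI.lt s hs s' hs')
  have hS : ∀ t : ℝ, |S * t| = |t| := fun t => by rcases hm.sign with rfl | rfl <;> simp
  have e1 : D.hatw s' - (D.hatw s - D.sgn s * D.ε) =
      S * ((rankIn (L ∪ R) s' - rankIn (L ∪ R) s + 1) * D.ε) := by
    rw [hm.hatw_eq s h1, hm.hatw_eq s' h2, hm.sgn_eq s h1]; ring
  have e2 : D.cellLeft s' - D.cellLeft s =
      S * ((rankIn (L ∪ R) s' - rankIn (L ∪ R) s) * D.ε) := by
    rw [hm.cellLeft_eq h1, hm.cellLeft_eq h2]; ring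
  rw [e1, e2, hS, hS, abs_of_pos, abs_of_pos]
  · refine ⟨by nlinarith, by nlinarith, by nlinarith⟩
  · nlinarith
  · nlinarith

lemma not_joined (hI : D.Interaction j L R v) {s s' : ℕ} (hs : s ∈ L) (hs' : s' ∈ R) :
    ¬ D.Joined j s s' := fun hJ => by
  have := (wavePos_eq_iff (hI.mem_realWaves (Finset.mem_union_left _ hs))
    (hI.mem_realWaves (Finset.mem_union_right _ hs'))).1 hJ.1
  exact (hI.pos_lt s hs s' hs').ne this

lemma joined_succ (hI : D.Interaction j L R v) {s s' : ℕ} (hs : s ∈ L ∪ R) (hs' : s' ∈ L ∪ R) :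
    D.Joined (j + 1) s s' := by
  have h1 : s ∈ D.realWaves (j + 1) := by rw [hI.realWaves_eq]; exact hI.mem_realWaves hs
  have h2 : s' ∈ D.realWaves (j + 1) := by rw [hI.realWaves_eq]; exact hI.mem_realWaves hs'
  refine ⟨(wavePos_eq_iff h1 h2).2 ?_, ?_⟩
  · rw [pos_succ h1, pos_succ h2, hI.arrival_eq hs, hI.arrival_eq hs']
  · rw [hI.speed_succ s hs, hI.speed_succ s' hs']

/-- The weights do not increase at an interaction. -/
lemma weight_succ_le (hD : D.Admissible) (hR : D.Reached (j + 1)) (hI : D.Interaction j L R v)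
    {s s' : ℕ} (hs : s ∈ D.realWaves j) (hs' : s' ∈ D.realWaves j) :
    D.weight (j + 1) s s' ≤ D.weight j s s' := by
  have hR' := reached_of_succ hR
  have hc := coherent hD hR'
  have h1 : s ∈ D.realWaves (j + 1) := by rw [hI.realWaves_eq]; exact hs
  have h2 : s' ∈ D.realWaves (j + 1) := by rw [hI.realWaves_eq]; exact hs'
  by_cases hJ : D.Joined (j + 1) s s'
  · rw [weight, if_pos hJ]
    exact weight_nonneg hD s s'
  -- Waves arriving together become joined at the collision point, and elsewhere they already form
  -- one unaltered front. So a pair still not joined has not just met, and its history and gap are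
  -- unchanged.
  have hne : D.arrival j s ≠ D.arrival j s' := by
    intro he
    by_cases hA : D.arrival j s' = D.collisionPoint (j + 1)
    · refine hJ (hI.joined_succ ?_ ?_) <;> rw [← hI.arriving_eq]
      · exact Finset.mem_filter.2 ⟨hs, he.trans hA⟩
      · exact Finset.mem_filter.2 ⟨hs', hA⟩
    · have hf := frontOf_eq_of_arrival_eq hD hc hR hs hs' he hA
      refine hJ ⟨(wavePos_eq_iff h1 h2).2 ?_, ?_⟩
      · rw [pos_succ h1, pos_succ h2, he]
      · rw [waveSpeed_succ_of_not_arriving hD hc hR hs fun h =>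
            hA (he.symm.trans (Finset.mem_filter.1 h).2),
          waveSpeed_succ_of_not_arriving hD hc hR hs' fun h => hA (Finset.mem_filter.1 h).2,
          (frontOf_eq_iff.1 hf).2]
  have hJ' : ¬ D.Joined j s s' := fun h =>
    hne (arrival_eq_of_frontOf_eq ((joined_iff hs hs').1 h))
  have hiff : D.Interacted (j + 1) s s' ↔ D.Interacted j s s' := by
    rw [interacted_iff hD hR h1 h2, interacted_iff hD hR' hs hs']
    constructor
    · rintro ⟨i, hi, he⟩
      rcases Nat.le_succ_iff.1 hi with h | rfl
      · exact ⟨i, h, he⟩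
      · rw [pos_succ h1, pos_succ h2] at he
        exact absurd he hne
    · rintro ⟨i, hi, he⟩
      exact ⟨i, hi.trans j.le_succ, he⟩
  refine le_of_eq ?_
  rw [weight, weight, if_neg hJ, if_neg hJ']
  simp only [hiff]
  rw [pairGap, if_neg hJ', if_neg hI.not_transversal]

/-- The functional decreases at least by the weights of the pairs that interact. -/
lemma sum_weight_le (hD : D.Admissible) (hR : D.Reached (j + 1)) (hI : D.Interaction j L R v) :
    ∑ x ∈ L ×ˢ R, D.weight j x.1 x.2 * D.ε * D.ε ≤ D.functionalQ j - D.functionalQ (j + 1) := by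
  have hε := hD.ε_pos
  have key : ∀ F : ℕ → ℕ → ℝ, ∑ s ∈ D.realWaves j, ∑ s' ∈ D.realWaves j with s < s', F s s' =
      ∑ x ∈ (D.realWaves j ×ˢ D.realWaves j).filter (fun x => x.1 < x.2), F x.1 x.2 := by
    intro F
    rw [Finset.sum_filter, Finset.sum_product]
    exact Finset.sum_congr rfl fun s _ => Finset.sum_filter _ _
  rw [functionalQ, functionalQ, hI.realWaves_eq, key, key, ← Finset.sum_sub_distrib]
  calc ∑ x ∈ L ×ˢ R, D.weight j x.1 x.2 * D.ε * D.ε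
      = ∑ x ∈ L ×ˢ R, (D.weight j x.1 x.2 * D.ε * D.ε - D.weight (j + 1) x.1 x.2 * D.ε * D.ε) := by
        refine Finset.sum_congr rfl fun x hx => ?_
        obtain ⟨h1, h2⟩ := Finset.mem_product.1 hx
        have h0 : D.weight (j + 1) x.1 x.2 = 0 := if_pos (hI.joined_succ
          (Finset.mem_union_left _ h1) (Finset.mem_union_right _ h2))
        rw [h0]
        ring
    _ ≤ _ := by
        refine Finset.sum_le_sum_of_subset_of_nonneg (fun x hx => ?_) fun x hx _ => ?_
        · obtain ⟨h1, h2⟩ := Finset.mem_product.1 hx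
          exact Finset.mem_filter.2 ⟨Finset.mem_product.2
            ⟨hI.mem_realWaves (Finset.mem_union_left _ h1),
              hI.mem_realWaves (Finset.mem_union_right _ h2)⟩, hI.lt _ h1 _ h2⟩
        · obtain ⟨h1, -⟩ := Finset.mem_filter.1 hx
          obtain ⟨h1, h2⟩ := Finset.mem_product.1 h1
          have := hI.weight_succ_le hD hR h1 h2
          rw [sub_nonneg]
          gcongr

lemma mem_left_of_frontOf_eq (hI : D.Interaction j L R v) {s p : ℕ} (hs : s ∈ L)
    (hp : p ∈ D.realWaves j) (he : D.frontOf j s = D.frontOf j p) : p ∈ L := by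
  have hpA : p ∈ L ∪ R := by
    rw [← hI.arriving_eq]
    refine Finset.mem_filter.2 ⟨hp, ?_⟩
    rw [← arrival_eq_of_frontOf_eq he, hI.arrival_eq (Finset.mem_union_left _ hs)]
  rcases Finset.mem_union.1 hpA with h | h
  · exact h
  · exact absurd (frontOf_eq_iff.1 he).1 (hI.pos_lt s hs p h).ne

lemma mem_right_of_frontOf_eq (hI : D.Interaction j L R v) {s p : ℕ} (hs : s ∈ R)
    (hp : p ∈ D.realWaves j) (he : D.frontOf j s = D.frontOf j p) : p ∈ R := by
  have hpA : p ∈ L ∪ R := by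
    rw [← hI.arriving_eq]
    refine Finset.mem_filter.2 ⟨hp, ?_⟩
    rw [← arrival_eq_of_frontOf_eq he, hI.arrival_eq (Finset.mem_union_right _ hs)]
  rcases Finset.mem_union.1 hpA with h | h
  · exact absurd (frontOf_eq_iff.1 he).1.symm (hI.pos_lt p h s hs).ne
  · exact h

/-- The mean difference of the slopes which the weight of the pair `s`, `s'` controls. -/
def meanDiff (D : WavefrontData) (j : ℕ) (d : ℕ → ℝ) (x : ℕ × ℕ) : ℝ :=
  average (D.part j x.1 x.2 x.1) d - average (D.part j x.1 x.2 x.2) d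

lemma exists_lastMeeting' (hD : D.Admissible) (hR : D.Reached j) (hI : D.Interaction j L R v)
    {s s' : ℕ} (hs : s ∈ L) (hs' : s' ∈ R) (hint : D.Interacted j s s') :
    ∃ k, D.LastMeeting k j s s' := by
  have h1 := hI.mem_realWaves (Finset.mem_union_left _ hs)
  have h2 := hI.mem_realWaves (Finset.mem_union_right _ hs')
  exact exists_lastMeeting h1 h2 ((interacted_iff hD hR h1 h2).1 hint)

lemma part_left_subset (hD : D.Admissible) (hR : D.Reached j) (hI : D.Interaction j L R v)
    {k s s' : ℕ} (hs : s ∈ L) (h : D.LastMeeting k j s s') : D.part j s s' s ⊆ L := by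
  have hinv := h.partInvariant hD hR
  intro p hp
  have hp' := hinv.mem_part.1 hp
  exact hI.mem_left_of_frontOf_eq hs
    (PartInvariant.commonInterval_subset_realWaves (hinv.mem hp').2) (hinv.frontOf_eq hp')

lemma part_right_subset (hD : D.Admissible) (hR : D.Reached j) (hI : D.Interaction j L R v)
    {k s s' : ℕ} (hs' : s' ∈ R) (h : D.LastMeeting k j s s') : D.part j s s' s' ⊆ R := by
  have hinv := h.partInvariant hD hR
  intro p hp
  have hp' := hinv.mem_part.1 hp
  exact hI.mem_right_of_frontOf_eq hs'
    (PartInvariant.commonInterval_subset_realWaves (hinv.mem hp').2) (hinv.frontOf_eq hp')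

/-- The differences of the slopes and the mean differences have the same sum over the divided
pairs. -/
lemma sum_meanDiff (hD : D.Admissible) (hR : D.Reached j) (hI : D.Interaction j L R v)
    (d : ℕ → ℝ) :
    ∑ x ∈ (L ×ˢ R).filter (fun x => D.Interacted j x.1 x.2), meanDiff D j d x =
      ∑ x ∈ (L ×ˢ R).filter (fun x => D.Interacted j x.1 x.2), (d x.1 - d x.2) := by
  set Ω := (L ×ˢ R).filter (fun x => D.Interacted j x.1 x.2) with hΩ
  set φ : ℕ × ℕ → Finset ℕ × Finset ℕ := fun x =>
    (D.part j x.1 x.2 x.1, D.part j x.1 x.2 x.2) with hφ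
  have hmaps : ∀ x ∈ Ω, φ x ∈ Ω.image φ := fun x hx => Finset.mem_image_of_mem φ hx
  rw [← Finset.sum_fiberwise_of_maps_to hmaps, ← Finset.sum_fiberwise_of_maps_to hmaps]
  refine Finset.sum_congr rfl fun y hy => ?_
  obtain ⟨⟨s, s'⟩, hx, rfl⟩ := Finset.mem_image.1 hy
  obtain ⟨hx1, hint⟩ := Finset.mem_filter.1 hx
  obtain ⟨hs, hs'⟩ := Finset.mem_product.1 hx1
  obtain ⟨k, h⟩ := hI.exists_lastMeeting' hD hR hs hs' hint
  have hinv := h.partInvariant hD hR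
  -- The divided pairs with the same two elements fill a rectangle: waves of the elements of `s` and
  -- `s'` share the last meeting and the partition, and stay in `L` and in `R` because elements do
  -- not leave their wavefronts.
  have hfib : Ω.filter (fun x => φ x = φ (s, s')) = D.part j s s' s ×ˢ D.part j s s' s' := by
    ext ⟨p, p'⟩
    rw [Finset.mem_filter, Finset.mem_product]
    constructor
    · rintro ⟨hp, he⟩
      obtain ⟨hp1, hpint⟩ := Finset.mem_filter.1 hp
      obtain ⟨hp2, hp2'⟩ := Finset.mem_product.1 hp1
      obtain ⟨i, hm⟩ := hI.exists_lastMeeting' hD hR hp2 hp2' hpint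
      have hinv' := hm.partInvariant hD hR
      obtain ⟨e1, e2⟩ := Prod.mk.inj he
      refine ⟨?_, ?_⟩
      · change p ∈ D.part j s s' s
        rw [← e1]; exact hinv'.mem_part_self (hm.left_mem_commonInterval hD hR)
      · change p' ∈ D.part j s s' s'
        rw [← e2]; exact hinv'.mem_part_self (hm.right_mem_commonInterval hD hR)
    · rintro ⟨hp, hp'⟩
      have q := hinv.mem_part.1 hp
      have q' := hinv.mem_part.1 hp'
      have hm := h.of_samePart hD hR q q'
      have hps : D.pos k p = D.pos k s := ((h.mem_commonInterval hD hR).1 (hinv.mem q).2).2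
      refine ⟨Finset.mem_filter.2 ⟨Finset.mem_product.2 ⟨hI.part_left_subset hD hR hs h hp,
        hI.part_right_subset hD hR hs' h hp'⟩, (interacted_iff hD hR hm.left_mem hm.right_mem).2
          ⟨k, hm.le, hm.eq⟩⟩, ?_⟩
      simp only [hφ, h.part_eq hD hR hm hps, hinv.part_eq q, hinv.part_eq q']
  have hconst : ∀ x ∈ Ω.filter (fun x => φ x = φ (s, s')),
      meanDiff D j d x = meanDiff D j d (s, s') := fun x hx => by
    obtain ⟨e1, e2⟩ := Prod.mk.inj (Finset.mem_filter.1 hx).2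
    simp only [meanDiff]
    rw [e1, e2]
  rw [Finset.sum_congr rfl hconst, Finset.sum_const, nsmul_eq_mul, hfib, sum_product_sub,
    Finset.card_product, Nat.cast_mul]
  rfl

/-- The weight of a pair of waves that have not yet interacted controls the difference of the
slopes. -/
lemma slope_sub_le (hD : D.Admissible) (hR : D.Reached (j + 1)) (hI : D.Interaction j L R v)
    {s s' : ℕ} (hs : s ∈ L) (hs' : s' ∈ R) (hint : ¬ D.Interacted j s s') :
    D.cellSlope (fun z => D.f z v) s - D.cellSlope (fun z => D.f z v) s' ≤
      D.ε * (L.card + R.card) * D.weight j s s' := by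
  have hε := hD.ε_pos
  have hN := normww_nonneg hD
  have hm := mem_waves_of_mem_realWaves (hI.mem_realWaves (Finset.mem_union_left _ hs))
  have hm' := mem_waves_of_mem_realWaves (hI.mem_realWaves (Finset.mem_union_right _ hs'))
  obtain ⟨-, -, h3⟩ := hI.abs_hatw_sub hD hR hs hs'
  rw [weight, if_neg (hI.not_joined hs hs'), if_neg hint]
  refine le_trans ?_ (mul_le_mul_of_nonneg_right h3 hN)
  rcases le_total (D.cellLeft s) (D.cellLeft s') with hle | hle
  · have h1 := (abs_le.1 (abs_secondDiff_flux_le hD v hle)).1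
    rw [← neg_sub, cellSlope_sub hD _ hm hm', abs_of_nonneg (sub_nonneg.2 hle), ← neg_div,
      div_le_iff₀ hε]
    linarith
  · have h1 := (abs_le.1 (abs_secondDiff_flux_le hD v hle)).2
    rw [cellSlope_sub hD _ hm' hm, abs_of_nonpos (sub_nonpos.2 hle), div_le_iff₀ hε]
    linarith

/-- The weight of a divided pair controls the mean difference of the slopes. -/
lemma meanDiff_le (hD : D.Admissible) (hR : D.Reached (j + 1)) (hI : D.Interaction j L R v)
    {s s' : ℕ} (hs : s ∈ L) (hs' : s' ∈ R) (hint : D.Interacted j s s') :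
    meanDiff D j (D.cellSlope fun z => D.f z v) (s, s') ≤
      D.ε * (L.card + R.card) * D.weight j s s' := by
  have hR' := reached_of_succ hR
  obtain ⟨k, h⟩ := hI.exists_lastMeeting' hD hR' hs hs' hint
  have hinv := h.partInvariant hD hR'
  have hsI := h.left_mem_commonInterval hD hR'
  have hsI' := h.right_mem_commonInterval hD hR'
  have hsLR := Finset.mem_union_left R hs
  -- On `L ∪ R` the slopes of the flux and of the effective flux differ by one constant, which drops
  -- out of the difference of the averages.
  obtain ⟨c, hc⟩ := exists_effFlux_add_const hD (coherent hD hR') (s := s) (y := v)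
    (T := L ∪ R) (fun p hp => mem_maxHomogeneous.2 ⟨hI.mem_realWaves hp, fun q hq hqp => by
      rcases Set.mem_uIcc.1 hqp with ⟨h1, h2⟩ | ⟨h1, h2⟩
      · exact hI.sgn_eq _ (hI.convex hD hR hq hp hsLR h1 h2) _ hsLR
      · exact hI.sgn_eq _ (hI.convex hD hR hq hsLR hp h1 h2) _ hsLR⟩)
    fun r hr a ha b hb h1 h2 => hI.waveV_eq r (hI.convex hD hR hr ha hb h1 h2)
  have e1 := average_add_const ⟨s, hinv.mem_part_self hsI⟩ fun p hp =>
    hc p (Finset.mem_union_left R (hI.part_left_subset hD hR' hs h hp))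
  have e2 := average_add_const ⟨s', hinv.mem_part_self hsI'⟩ fun p hp =>
    hc p (Finset.mem_union_right L (hI.part_right_subset hD hR' hs' h hp))
  have hgap := hinv.gap hsI hsI' (hI.lt s hs s' hs')
  obtain ⟨h1, h2, -⟩ := hI.abs_hatw_sub hD hR hs hs'
  have hg := pairGap_nonneg hD (j := j) s s' s s'
  rw [weight, if_neg (hI.not_joined hs hs'), if_pos hint, meanDiff, e1, e2]
  calc _ ≤ D.pairGap j s s' s s' := by linarith
    _ = |D.hatw s' - (D.hatw s - D.sgn s * D.ε)| *
        (D.pairGap j s s' s s' / |D.hatw s' - (D.hatw s - D.sgn s * D.ε)|) := by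
      field_simp
    _ ≤ _ := mul_le_mul_of_nonneg_right h2 (div_nonneg hg (abs_nonneg _))

/-- The left side sums the slope differences over all pairs. On the divided ones they are first
replaced by mean differences, since only these are controlled by the weights; the other pairs are
estimated one by one. -/
lemma card_mul_average_sub_le (hD : D.Admissible) (hR : D.Reached (j + 1))
    (hI : D.Interaction j L R v) :
    (L.card * R.card : ℝ) * (average L (D.cellSlope fun z => D.f z v) -
      average R (D.cellSlope fun z => D.f z v)) ≤
      D.ε * (L.card + R.card) * ∑ x ∈ L ×ˢ R, D.weight j x.1 x.2 := by
  rw [← sum_product_sub, Finset.mul_sum,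
    ← Finset.sum_filter_add_sum_filter_not (L ×ˢ R) (fun x => D.Interacted j x.1 x.2),
    ← Finset.sum_filter_add_sum_filter_not (L ×ˢ R) (fun x => D.Interacted j x.1 x.2),
    ← hI.sum_meanDiff hD (reached_of_succ hR)]
  refine add_le_add (Finset.sum_le_sum fun x hx => ?_) (Finset.sum_le_sum fun x hx => ?_) <;>
    obtain ⟨h1, h2⟩ := Finset.mem_filter.1 hx <;> obtain ⟨h3, h4⟩ := Finset.mem_product.1 h1
  · exact hI.meanDiff_le hD hR h3 h4 h2
  · exact hI.slope_sub_le hD hR h3 h4 h2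

lemma average_union (hI : D.Interaction j L R v) (d : ℕ → ℝ) :
    (L.card + R.card : ℝ) * average (L ∪ R) d = L.card * average L d + R.card * average R d := by
  have h := card_mul_average (L ∪ R) d
  rw [hI.card_union, Nat.cast_add, Finset.sum_union
    (Finset.disjoint_left.2 fun a ha hb => (hI.lt a ha a hb).ne rfl)] at h
  rw [h, card_mul_average, card_mul_average]

/-- The total change of the speeds of the waves at an interaction. -/
lemma sum_speed_change (hD : D.Admissible) (hR : D.Reached (j + 1)) (hI : D.Interaction j L R v) :
    (L.card + R.card : ℝ) *
      ∑ s ∈ D.realWaves (j + 1), |D.waveSpeed (j + 1) s - D.waveSpeed j s| * D.ε =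
      2 * D.ε * ((L.card * R.card : ℝ) * (average L (D.cellSlope fun z => D.f z v) -
        average R (D.cellSlope fun z => D.f z v))) := by
  have hc := coherent hD (reached_of_succ hR)
  have havg := hI.average_union (D.cellSlope fun z => D.f z v)
  have hlt := hI.average_lt
  set A := average L (D.cellSlope fun z => D.f z v) with hA
  set B := average R (D.cellSlope fun z => D.f z v) with hB
  set C := average (L ∪ R) (D.cellSlope fun z => D.f z v) with hC
  have n1 : (0 : ℝ) < L.card := by exact_mod_cast hI.left_nonempty.card_pos
  have n2 : (0 : ℝ) < R.card := by exact_mod_cast hI.right_nonempty.card_pos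
  have hCA : C ≤ A := by nlinarith
  have hBC : B ≤ C := by nlinarith
  have hsub : L ∪ R ⊆ D.realWaves j := fun r hr => hI.mem_realWaves hr
  rw [hI.realWaves_eq, ← Finset.sum_subset hsub fun r hr hnr => ?_, Finset.sum_union
    (Finset.disjoint_left.2 fun a ha hb => (hI.lt a ha a hb).ne rfl)]
  · have e1 : ∀ r ∈ L, |D.waveSpeed (j + 1) r - D.waveSpeed j r| * D.ε = (A - C) * D.ε :=
      fun r hr => by
        rw [hI.speed_succ r (Finset.mem_union_left _ hr), hI.speed_left r hr, abs_sub_comm,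
          abs_of_nonneg (sub_nonneg.2 hCA)]
    have e2 : ∀ r ∈ R, |D.waveSpeed (j + 1) r - D.waveSpeed j r| * D.ε = (C - B) * D.ε :=
      fun r hr => by
        rw [hI.speed_succ r (Finset.mem_union_right _ hr), hI.speed_right r hr,
          abs_of_nonneg (sub_nonneg.2 hBC)]
    rw [Finset.sum_congr rfl e1, Finset.sum_congr rfl e2, Finset.sum_const, Finset.sum_const,
      nsmul_eq_mul, nsmul_eq_mul]
    -- Eliminates `C` through `(l + r) C = l A + r B`.
    linear_combination D.ε * (R.card - L.card : ℝ) * havg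
  · rw [waveSpeed_succ_of_not_arriving hD hc hR hr (by rwa [hI.arriving_eq]), sub_self, abs_zero,
      zero_mul]

end Interaction

end WavefrontData

end

theorem mainTheorem4 (D : WavefrontData) (hD : D.Admissible) (j : ℕ)
    (hj : D.IsInteraction (j + 1)) :
    ∑ s ∈ D.realWaves (j + 1), |D.waveSpeed (j + 1) s - D.waveSpeed j s| * D.ε ≤
      2 * (D.functionalQ j - D.functionalQ (j + 1)) := by
  have hR : D.Reached (j + 1) := by
    obtain ⟨φ, ψ, x, hcol, -⟩ := hj
    exact hcol.1
  obtain ⟨L, R, v, hI⟩ := WavefrontData.exists_interaction hD hj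
  have hε := hD.ε_pos
  have n1 : (0 : ℝ) < L.card := by exact_mod_cast hI.left_nonempty.card_pos
  have n2 : (0 : ℝ) < R.card := by exact_mod_cast hI.right_nonempty.card_pos
  have h1 := hI.sum_speed_change hD hR
  have h2 := hI.card_mul_average_sub_le hD hR
  have h3 := hI.sum_weight_le hD hR
  rw [← Finset.sum_mul, ← Finset.sum_mul] at h3
  -- The factor `l + r` multiplying the change of speed is the one that bounds the denominators of
  -- the weights, so it cancels.
  refine le_of_mul_le_mul_left ?_ (add_pos n1 n2)
  rw [h1]
  nlinarith [mul_le_mul_of_nonneg_left h2 hε.le,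
    mul_le_mul_of_nonneg_left h3 (add_pos n1 n2).le]
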